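/- Let $\Gamma=SL_2(\mathbb{Z})$ act on the upper half plane $\mathfrak{H}$, let $P\subset\Gamma$ be the subgroup of upper triangular matrices, and give $\Gamma\backslash\mathfrak{H}$ the measure $\frac{dx\,dy}{y^2}$. Let $E_s(z)$ be the meromorphic continuation in $s$ of $\sum_{\gamma\in P\backslash\Gamma}\mathrm{Im}(\gamma z)^s$ ($\mathrm{Re}(s)>1$), let $c_s=\xi(2-2s)/\xi(2s)$ (as a meromorphic function of $s$) with $\xi(s)=\pi^{-s/2}\Gamma(s/2)\zeta(s)$, let $C_\alpha=\frac{d}{ds}c_s\big|_{s=\alpha}$, and let $E_1^*$ be the constant term of the Laurent expansion of $E_s$ at $s=1$, that is, $E_1^*(z)=\lim_{s\to1}\left(E_s(z)-\frac{3/\pi}{s-1}\right)$. Let $\alpha,\beta\in\mathbb{C}\setminus\{1\}$ satisfy $\mathrm{Re}(\alpha)\ge\frac12$, $\mathrm{Re}(\beta)\ge\frac12$, $\mathrm{Re}(\alpha+\beta)\ne\frac32$, $\mathrm{Re}(\beta)\ne\mathrm{Re}(\alpha)\pm\frac12$ and $\alpha+\beta\neq1$. Define $S=S_{\alpha,\beta}$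 on $\Gamma\backslash\mathfrak{H}$ as follows. (I) If $\mathrm{Re}(\alpha)+\frac12<\mathrm{Re}(\beta)$, then $S=E_\alpha E_\beta-E_{\alpha+\beta}-c_\alpha E_{1-\alpha+\beta}$; if $\mathrm{Re}(\beta)+\frac12<\mathrm{Re}(\alpha)$, then $S_{\alpha,\beta}=S_{\beta,\alpha}$. (II) If $\alpha\ne\beta$ and $|\mathrm{Re}(\alpha)-\mathrm{Re}(\beta)|<\frac12$, then $S=E_\alpha E_\beta-E_{\alpha+\beta}-c_\beta E_{1+\alpha-\beta}-c_\alpha E_{1-\alpha+\beta}$ when $\mathrm{Re}(\alpha+\beta)>\frac32$, and $S=E_\alpha E_\beta-E_{\alpha+\beta}-c_\beta E_{1+\alpha-\beta}-c_\alpha E_{1-\alpha+\beta}-c_\alpha c_\beta E_{2-\alpha-\beta}$ when $\mathrm{Re}(\alpha+\beta)<\frac32$. (III) If $\alpha=\beta$, then $S=E_\alpha^2-E_{2\alpha}-2c_\alpha E_1^*+\frac{3}{\pi}C_\alpha$ when $\mathrm{Re}(\alpha)>\frac34$, and $S=E_\alpha^2-E_{2\alpha}-2c_\alpha E_1^*-c_\alpha^2E_{2-2\alpha}+\frac{3}{\pi}C_\alpha$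 when $\mathrm{Re}(\alpha)<\frac34$. Then $S\in L^2(\Gamma\backslash\mathfrak{H})$ and $$\langle S,1\rangle_{L^2}=\int_{\Gamma\backslash\mathfrak{H}}S\,\frac{dx\,dy}{y^2}=0 .$$ -/

import Mathlib

noncomputable section

open MeasureTheory Set Filter Topology
open scoped MatrixGroups ComplexConjugate

namespace ResidualSpectrum

/-! ### The modular surface -/

/-- The quotient `Γ \ ℍ` for `Γ = SL(2, ℤ)`. -/
abbrev ModularSurface : Type :=
  Quotient (MulAction.orbitRel SL(2, ℤ) UpperHalfPlane)

/-- The measure on `Γ \ ℍ` induced by `dx dy / y ^ 2`: the image of this measure, restricted to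
the standard fundamental domain `{z | 1 ≤ |z|, |Re z| ≤ 1 / 2}`, under the projection.
(Mathlib's `volume` on the upper half plane is `dx dy / y ^ 2`.) -/
def surfaceMeasure : Measure ModularSurface :=
  Measure.map (fun z : UpperHalfPlane => (⟦z⟧ : ModularSurface))
    ((volume : Measure UpperHalfPlane).restrict ModularGroup.fd)

/-- The pairing `⟨f, g⟩ = ∫_{Γ \ ℍ} f * conj g dx dy / y ^ 2`. -/
def pairing (f g : ModularSurface → ℂ) : ℂ :=
  ∫ x, f x * conj (g x) ∂surfaceMeasure

/-! ### Eisenstein series -/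

/-- The upper triangular subgroup `P` of `Γ = SL(2, ℤ)`. -/
def parabolic : Subgroup SL(2, ℤ) where
  carrier := {γ | γ 1 0 = 0}
  one_mem' := by simp
  mul_mem' := by
    intro a b ha hb
    simp only [mem_ofPred_eq] at ha hb ⊢
    simp [Matrix.SpecialLinearGroup.coe_mul, Matrix.mul_apply, Fin.sum_univ_two, ha, hb]
  inv_mem' := by
    intro a ha
    simp only [mem_ofPred_eq] at ha ⊢
    simp [Matrix.SpecialLinearGroup.SL2_inv_expl, ha]

theorem im_parabolic_smul {p : SL(2, ℤ)} (hp : p ∈ parabolic) (z : UpperHalfPlane) :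
    (p • z).im = z.im := by
  have h0 : p 1 0 = 0 := hp
  have hdet : p 0 0 * p 1 1 = 1 := by
    have h := Matrix.det_fin_two (p : Matrix (Fin 2) (Fin 2) ℤ)
    rw [p.det_coe] at h
    have h0' : (p : Matrix (Fin 2) (Fin 2) ℤ) 1 0 = 0 := hp
    rw [h0'] at h
    simpa using h.symm
  have h1 : ((p 1 1 : ℤ) : ℝ) ^ 2 = 1 := by
    rcases Int.isUnit_iff.mp (IsUnit.of_mul_eq_one_right _ hdet) with h | h <;> simp [h]
  rw [ModularGroup.im_smul_eq_div_normSq, ModularGroup.denom_apply, h0]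
  have : Complex.normSq (((0 : ℤ) : ℂ) * (z : ℂ) + ((p 1 1 : ℤ) : ℂ)) = 1 := by
    have h2 : (((p 1 1 : ℤ) : ℂ)) = (((p 1 1 : ℤ) : ℝ) : ℂ) := by simp
    rw [h2]
    simp only [Int.cast_zero, zero_mul, zero_add, Complex.normSq_ofReal]
    nlinarith [h1]
  rw [this, div_one]

/-- The set `P \ Γ` of cosets `P γ`. -/
abbrev Cosets : Type := Quotient (QuotientGroup.rightRel parabolic)

/-- The summand `Im(γ z) ^ s`, as a function of the coset `P γ`. -/
def eisensteinTerm (s : ℂ) (z : UpperHalfPlane) : Cosets → ℂ :=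
  Quotient.lift (fun γ : SL(2, ℤ) => (((γ • z).im : ℝ) : ℂ) ^ s) (by
    intro a b hab
    have hab' : b * a⁻¹ ∈ parabolic := QuotientGroup.rightRel_apply.mp hab
    have h := im_parabolic_smul hab' (a • z)
    rw [smul_smul, inv_mul_cancel_right] at h
    simp only [h])

theorem tsum_eisensteinTerm_smul (s : ℂ) (g : SL(2, ℤ)) (z : UpperHalfPlane) :
    ∑' q, eisensteinTerm s (g • z) q = ∑' q, eisensteinTerm s z q := by
  let e : Cosets ≃ Cosets := Quotient.congr (Equiv.mulRight g) (by
    intro a b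
    change QuotientGroup.rightRel parabolic a b ↔
      QuotientGroup.rightRel parabolic (a * g) (b * g)
    rw [QuotientGroup.rightRel_apply, QuotientGroup.rightRel_apply]
    simp [mul_assoc])
  rw [← e.tsum_eq (eisensteinTerm s z)]
  refine tsum_congr fun q => ?_
  induction q using Quotient.inductionOn with
  | _ a => simp [e, eisensteinTerm, smul_smul]

/-- The series `∑_{γ ∈ P \ Γ} Im(γ z) ^ s`, as a function on `Γ \ ℍ`.
It converges absolutely for `Re s > 1`. -/
def eisensteinSeries (s : ℂ) : ModularSurface → ℂ :=
  Quotient.lift (fun z => ∑' q, eisensteinTerm s z q) (by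
    rintro _ b ⟨g, rfl⟩
    exact tsum_eisensteinTerm_smul s g b)

open Classical in
/-- The meromorphic continuation to `ℂ` of a function `f` given on `U` (for `U` open and
non-empty it is unique once it is normalised, as it is here, to have its removable singularities
filled in and the value `0` at its poles). -/
def continuation (U : Set ℂ) (f : ℂ → ℂ) : ℂ → ℂ :=
  if h : ∃ g : ℂ → ℂ, MeromorphicNFOn g univ ∧ EqOn g f U then h.choose else 0

/-- The Eisenstein series `E_s`: the meromorphic continuation in `s`, from `Re s > 1`, of
`∑_{γ ∈ P \ Γ} Im(γ z) ^ s`. -/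
def eisenstein (s : ℂ) (x : ModularSurface) : ℂ :=
  continuation {w : ℂ | 1 < w.re} (fun w => eisensteinSeries w x) s

/-- `E_1^*`: the constant term of the Laurent expansion at `s = 1` of `E_s`, whose residue
there is `3 / π`. -/
def eisensteinStar (x : ModularSurface) : ℂ :=
  limUnder (𝓝[≠] (1 : ℂ)) fun s => eisenstein s x - (3 / (Real.pi : ℂ)) / (s - 1)

/-- `c_s = ξ(2 - 2 s) / ξ(2 s)`, as a meromorphic function of `s` (removable singularities, such
as the one at `s = 1 / 2`, are filled in); `ξ(s) = π ^ (-s / 2) Γ(s / 2) ζ(s)`. -/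
def scatteringCoeff : ℂ → ℂ :=
  toMeromorphicNFOn
    (fun s : ℂ => completedRiemannZeta (2 - 2 * s) / completedRiemannZeta (2 * s)) univ

/-! ### The functions `S` -/

/-- The set `𝒞` of parameters `(α, β)`. -/
def admissible : Set (ℂ × ℂ) :=
  {p | p.1 ≠ 1 ∧ p.2 ≠ 1 ∧ 1 / 2 ≤ p.1.re ∧ 1 / 2 ≤ p.2.re ∧ (p.1 + p.2).re ≠ 3 / 2 ∧
    p.2.re ≠ 1 / 2 + p.1.re ∧ p.2.re ≠ -(1 / 2) + p.1.re}

open Classical in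
/-- The linear combination of Eisenstein series (and a constant, if `α = β`) that is subtracted
from `E_α * E_β`, in each of the regimes for `(α, β)`. -/
def correction (α β : ℂ) (x : ModularSurface) : ℂ :=
  if α = β then
    if 3 / 4 < α.re then
      eisenstein (2 * α) x + 2 * scatteringCoeff α * eisensteinStar x - 3 / (Real.pi : ℂ) * deriv scatteringCoeff α
    else
      eisenstein (2 * α) x + 2 * scatteringCoeff α * eisensteinStar x + scatteringCoeff α ^ 2 * eisenstein (2 - 2 * α) x
        - 3 / (Real.pi : ℂ) * deriv scatteringCoeff α
  else if α.re + 1 / 2 < β.re then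
    eisenstein (α + β) x + scatteringCoeff α * eisenstein (1 - α + β) x
  else if β.re + 1 / 2 < α.re then
    eisenstein (α + β) x + scatteringCoeff β * eisenstein (1 - β + α) x
  else if 3 / 2 < (α + β).re then
    eisenstein (α + β) x + scatteringCoeff β * eisenstein (1 + α - β) x + scatteringCoeff α * eisenstein (1 - α + β) x
  else
    eisenstein (α + β) x + scatteringCoeff β * eisenstein (1 + α - β) x + scatteringCoeff α * eisenstein (1 - α + β) x
      + scatteringCoeff α * scatteringCoeff β * eisenstein (2 - α - β) x

/-- `S = E_α * E_β - ∑ c_i E_{s_i}`. -/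
def S (α β : ℂ) (x : ModularSurface) : ℂ :=
  eisenstein α x * eisenstein β x - correction α β x

end ResidualSpectrum

end

noncomputable section

open MeasureTheory Set Filter Topology
open scoped MatrixGroups ComplexConjugate

namespace ResidualSpectrum

/-! Write `E_s` on the fundamental domain as its constant term `y ^ s + c_s y ^ (1 - s)` plus a
remainder decaying faster than any power of `y`. In `E_α E_β` the only growth comes from the product
of the constant terms, that is, from the four powers `y ^ w` with `w = α + β`, `1 + α - β`, `1 - α +
β`, `2 - α - β`. A power is square integrable for `dx dy / y ^ 2` when `Re w < 1 / 2`. When `Re w >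
1 / 2`, the difference `y ^ w - E_w = -c_w y ^ (1 - w) - remainder` is square integrable instead.
Admissibility keeps every `w` off the line `Re w = 1 / 2`, and the regimes in the definition of `S`
record which `w` lie to its right. So `S` is a rapidly decaying part (`truncatedProduct`) plus a
combination of square integrable pieces (`reducedPower`).

The integral is computed with regularisation. `powerIntegral w` is the continuation in `w` of the
integral of `y ^ w` over the fundamental domain, with a simple pole at `w = 1`. Two identities carry
the proof: the regularised integral of `E_s` vanishes (`regularised_integral_eq_zero`), and so does
that of `E_a E_b` (`regularised_product_integral_eq_zero`). Each is obtained by unfolding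
(`setIntegral_fd_tsum_cosets`) a series truncated at height 1, for large real part of the parameter,
and then by the identity theorem. In the product, `y ^ a` times the remainder of `E_b` contributes
nothing because the remainder has mean zero in `x`. The first identity shows that a reduced power
has integral `powerIntegral w` whether or not `E_w` was subtracted; the second says that these
values and the integral of the rapidly decaying part add up to zero.

For `α = β` the two middle exponents equal 1. As `a` tends to `b`, the poles of `powerIntegral (1 +
a - b)` and `powerIntegral (1 - a + b)` cancel and leave the derivative of `c_s`. It is balanced by
the constant `3 / π` times that derivative, because `3 / π` has integral 1, while `y - E_1^*`
supplies the finite part. Both facts come from the expansion at `s = 1` of the first identity.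

The continuation itself rests on Poisson summation along the rows `m z + n`, which gives the Fourier
expansion of `E_s` with entire Bessel-type coefficients. -/

/-! ### The Bessel integral -/

/-- The kernel `exp (-(a t + b / t))`. -/
def besselKernel (a b t : ℝ) : ℂ := (Real.exp (-(a * t + b / t)) : ℂ)

/-- The integral `∫_0^∞ t ^ (s - 1) exp (-(a t + b / t)) dt`. -/
def besselIntegral (a b : ℝ) (s : ℂ) : ℂ := mellin (besselKernel a b) s

theorem exp_neg_le_factorial_div_pow {x : ℝ} (hx : 0 < x) (n : ℕ) :
    Real.exp (-x) ≤ n.factorial / x ^ n := by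
  have h := Real.pow_div_factorial_le_exp x hx.le n
  rw [div_le_iff₀ (by positivity)] at h
  rw [Real.exp_neg, le_div_iff₀ (by positivity), inv_mul_le_iff₀ (Real.exp_pos x)]
  exact h

theorem norm_besselKernel (a b t : ℝ) :
    ‖besselKernel a b t‖ = Real.exp (-(a * t)) * Real.exp (-(b / t)) := by
  rw [besselKernel, Complex.norm_real, Real.norm_eq_abs, abs_of_pos (Real.exp_pos _), neg_add,
    Real.exp_add]

theorem norm_besselKernel_le {a b t : ℝ} (ha : 0 < a) (hb : 0 < b) (ht : 0 < t) (m n : ℕ) :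
    ‖besselKernel a b t‖ ≤ (m.factorial / (a * t) ^ m) * (n.factorial / (b / t) ^ n) := by
  rw [norm_besselKernel]
  have h1 := exp_neg_le_factorial_div_pow (mul_pos ha ht) m
  have h2 := exp_neg_le_factorial_div_pow (div_pos hb ht) n
  gcongr

theorem continuousOn_besselKernel (a b : ℝ) : ContinuousOn (besselKernel a b) (Ioi 0) := by
  intro t ht
  have : t ≠ 0 := ne_of_gt ht
  unfold besselKernel
  refine ContinuousAt.continuousWithinAt ?_
  fun_prop (disch := assumption)

theorem measurable_besselKernel {α : Type*} [MeasurableSpace α] {a b t : α → ℝ}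
    (ha : Measurable a) (hb : Measurable b) (ht : Measurable t) :
    Measurable fun x => besselKernel (a x) (b x) (t x) := by
  unfold besselKernel
  fun_prop

theorem besselKernel_isBigO_atTop (a : ℝ) {b : ℝ} (hb : 0 < b) :
    besselKernel a b =O[atTop] fun t => Real.exp (-a * t) := by
  refine Asymptotics.IsBigO.of_bound 1 ?_
  filter_upwards [eventually_gt_atTop 0] with t ht
  rw [norm_besselKernel, one_mul, Real.norm_eq_abs, abs_of_pos (Real.exp_pos _), neg_mul]
  exact mul_le_of_le_one_right (Real.exp_pos _).le
    (Real.exp_le_one_iff.mpr (by have := div_pos hb ht; linarith))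

/-- The factor `exp (-b / t)` vanishes to every order at 0. The exponent `-(-n)` has the shape
required by the Mellin lemmas, whose condition becomes `-n < re s`; a large `n` thus covers any
given `s`. -/
theorem besselKernel_isBigO_zero {a b : ℝ} (ha : 0 < a) (hb : 0 < b) (n : ℕ) :
    besselKernel a b =O[𝓝[>] 0] fun t : ℝ => t ^ (-(-(n : ℝ))) := by
  refine Asymptotics.IsBigO.of_bound (n.factorial / b ^ n) ?_
  filter_upwards [self_mem_nhdsWithin] with t ht
  have ht : 0 < t := ht
  refine (norm_besselKernel_le ha hb ht 0 n).trans (le_of_eq ?_)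
  rw [neg_neg, Real.rpow_natCast, Real.norm_of_nonneg (by positivity), div_pow]
  field_simp
  simp

theorem besselIntegral_convergent {a b : ℝ} (ha : 0 < a) (hb : 0 < b) (s : ℂ) :
    MellinConvergent (besselKernel a b) s := by
  obtain ⟨n, hn⟩ := exists_nat_gt (-s.re)
  exact mellinConvergent_of_isBigO_rpow_exp ha
    ((continuousOn_besselKernel a b).locallyIntegrableOn measurableSet_Ioi)
    (besselKernel_isBigO_atTop a hb) (besselKernel_isBigO_zero ha hb n) (by linarith)

theorem differentiable_besselIntegral {a b : ℝ} (ha : 0 < a) (hb : 0 < b) :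
    Differentiable ℂ (besselIntegral a b) := by
  intro s
  obtain ⟨n, hn⟩ := exists_nat_gt (-s.re)
  exact mellin_differentiableAt_of_isBigO_rpow_exp ha
    ((continuousOn_besselKernel a b).locallyIntegrableOn measurableSet_Ioi)
    (besselKernel_isBigO_atTop a hb) (besselKernel_isBigO_zero ha hb n) (by linarith)

/-- The integral of the absolute values of the integrand of `besselIntegral`. -/
theorem integral_norm_besselKernel_le {a b : ℝ} (ha : 0 < a) (hb : 0 < b) {s : ℂ} {n : ℕ}
    (hn : |s.re| + 2 ≤ n) :
    ∫ t in Ioi (0 : ℝ), ‖(t : ℂ) ^ (s - 1) • besselKernel a b t‖ ≤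
      n.factorial * ((a * b ^ n)⁻¹ + (a ^ n * b)⁻¹) := by
  have hint : IntegrableOn (fun t : ℝ => ‖(t : ℂ) ^ (s - 1) • besselKernel a b t‖) (Ioi 0) :=
    (besselIntegral_convergent ha hb s).norm
  have h1 := neg_abs_le s.re
  have h2 := le_abs_self s.re
  have hnorm : ∀ t ∈ Ioi (0 : ℝ), ‖(t : ℂ) ^ (s - 1) • besselKernel a b t‖ =
      t ^ (s.re - 1) * ‖besselKernel a b t‖ := by
    intro t ht
    rw [norm_smul, Complex.norm_cpow_eq_rpow_re_of_pos ht]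
    simp
  -- Below `t = 1` the high power `n` is spent on `exp (-b / t)` and one power on `exp (-a t)`;
  -- above `t = 1` the roles are exchanged. The size of `n` makes the exponent of `t` nonnegative
  -- below 1 and at most `-2` above.
  rw [← Ioc_union_Ioi_eq_Ioi zero_le_one, setIntegral_union (Ioc_disjoint_Ioi le_rfl)
    measurableSet_Ioi (hint.mono_set Ioc_subset_Ioi_self)
    (hint.mono_set (Ioi_subset_Ioi zero_le_one)), mul_add]
  refine add_le_add ?_ ?_
  · have : ∫ t in Ioc (0 : ℝ) 1, ‖(t : ℂ) ^ (s - 1) • besselKernel a b t‖ ≤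
        ∫ t in Ioc (0 : ℝ) 1, (n.factorial * (a * b ^ n)⁻¹ : ℝ) := by
      refine setIntegral_mono_on (hint.mono_set Ioc_subset_Ioi_self) (integrableOn_const (by simp))
        measurableSet_Ioc fun t ht => ?_
      have ht0 : 0 < t := ht.1
      rw [hnorm t ht0]
      have hb' := norm_besselKernel_le ha hb ht0 1 n
      have e : (Nat.factorial 1 / (a * t) ^ 1) * (n.factorial / (b / t) ^ n)
          = (n.factorial * (a * b ^ n)⁻¹ : ℝ) * t ^ ((n : ℝ) - 1) := by
        rw [Real.rpow_sub ht0, Real.rpow_natCast, Real.rpow_one, div_pow, mul_pow]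
        field_simp
        simp
      rw [e] at hb'
      calc t ^ (s.re - 1) * ‖besselKernel a b t‖
          ≤ t ^ (s.re - 1) * ((n.factorial * (a * b ^ n)⁻¹ : ℝ) * t ^ ((n : ℝ) - 1)) := by gcongr
        _ = (n.factorial * (a * b ^ n)⁻¹ : ℝ) * t ^ (s.re - 1 + ((n : ℝ) - 1)) := by
          rw [Real.rpow_add ht0]; ring
        _ ≤ (n.factorial * (a * b ^ n)⁻¹ : ℝ) * 1 := by
          gcongr
          exact Real.rpow_le_one ht0.le ht.2 (by linarith)
        _ = _ := mul_one _
    simpa using this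
  · have hi : IntegrableOn (fun t : ℝ => (n.factorial * (a ^ n * b)⁻¹ : ℝ) * t ^ (-2 : ℝ))
        (Ioi 1) := (integrableOn_Ioi_rpow_of_lt (by norm_num) one_pos).const_mul _
    have : ∫ t in Ioi (1 : ℝ), ‖(t : ℂ) ^ (s - 1) • besselKernel a b t‖ ≤
        ∫ t in Ioi (1 : ℝ), (n.factorial * (a ^ n * b)⁻¹ : ℝ) * t ^ (-2 : ℝ) := by
      refine setIntegral_mono_on (hint.mono_set (Ioi_subset_Ioi zero_le_one)) hi
        measurableSet_Ioi fun t ht => ?_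
      have ht1 : 1 < t := ht
      have ht0 : 0 < t := by linarith
      rw [hnorm t ht0]
      have hb' := norm_besselKernel_le ha hb ht0 n 1
      have e : (n.factorial / (a * t) ^ n) * (Nat.factorial 1 / (b / t) ^ 1)
          = (n.factorial * (a ^ n * b)⁻¹ : ℝ) * t ^ (1 - (n : ℝ)) := by
        rw [Real.rpow_sub ht0, Real.rpow_natCast, Real.rpow_one, div_pow, mul_pow]
        field_simp
        simp
      rw [e] at hb'
      calc t ^ (s.re - 1) * ‖besselKernel a b t‖
          ≤ t ^ (s.re - 1) * ((n.factorial * (a ^ n * b)⁻¹ : ℝ) * t ^ (1 - (n : ℝ))) := by gcongr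
        _ = (n.factorial * (a ^ n * b)⁻¹ : ℝ) * t ^ (s.re - 1 + (1 - (n : ℝ))) := by
          rw [Real.rpow_add ht0]; ring
        _ ≤ (n.factorial * (a ^ n * b)⁻¹ : ℝ) * t ^ (-2 : ℝ) := by
          gcongr
          · exact ht1.le
          · linarith
    refine this.trans (le_of_eq ?_)
    rw [integral_const_mul, integral_Ioi_rpow_of_lt (by norm_num) one_pos]
    norm_num

theorem norm_besselIntegral_le {a b : ℝ} (ha : 0 < a) (hb : 0 < b) {s : ℂ} {n : ℕ}
    (hn : |s.re| + 2 ≤ n) :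
    ‖besselIntegral a b s‖ ≤ n.factorial * ((a * b ^ n)⁻¹ + (a ^ n * b)⁻¹) :=
  (norm_integral_le_integral_norm _).trans (integral_norm_besselKernel_le ha hb hn)

theorem measurable_besselIntegral {α : Type*} [MeasurableSpace α] {a b : α → ℝ}
    (ha : Measurable a) (hb : Measurable b) (s : ℂ) :
    Measurable fun x => besselIntegral (a x) (b x) s := by
  unfold besselIntegral mellin
  refine StronglyMeasurable.measurable (StronglyMeasurable.integral_prod_right ?_)
  refine Measurable.stronglyMeasurable ?_
  have := measurable_besselKernel (ha.comp measurable_fst) (hb.comp measurable_fst)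
    (measurable_snd (α := α) (β := ℝ))
  have h2 : Measurable fun x : α × ℝ => ((x.2 : ℝ) : ℂ) ^ (s - 1) :=
    (Complex.measurable_ofReal.comp measurable_snd).pow_const _
  exact h2.mul this

/-! ### The non-constant part of the Fourier expansion -/

/-- The index set of the non-constant Fourier terms: pairs `(m, n)` with `m ≥ 1` and `n ≠ 0`. -/
abbrev FourierIndex : Type := ℕ+ × {n : ℤ // n ≠ 0}

/-- The Fourier term `exp (2 π i m n x) √y ∫_0^∞ t ^ (s - 3 / 2) exp (-π y (m² t + n² / t)) dt`. -/
def fourierTerm (p : FourierIndex) (s : ℂ) (z : UpperHalfPlane) : ℂ :=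
  Complex.exp (2 * Real.pi * Complex.I * ((p.1 : ℕ) : ℤ) * (p.2 : ℤ) * z.re) * (√z.im : ℂ) *
    besselIntegral (Real.pi * ((p.1 : ℕ) : ℝ) ^ 2 * z.im) (Real.pi * ((p.2 : ℤ) : ℝ) ^ 2 * z.im)
      (s - 1 / 2)

/-- The sum of the non-constant Fourier terms of `Λ(2 s) E_s`. -/
def fourierPart (s : ℂ) (z : UpperHalfPlane) : ℂ := ∑' p : FourierIndex, fourierTerm p s z

theorem summable_fourierIndex :
    Summable fun p : FourierIndex => (((p.1 : ℕ) : ℝ) ^ 2)⁻¹ * ((((p.2 : ℤ) : ℝ)) ^ 2)⁻¹ := by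
  have h1 : Summable fun m : ℕ+ => (((m : ℕ) : ℝ) ^ 2)⁻¹ :=
    (Real.summable_nat_pow_inv.mpr one_lt_two).comp_injective PNat.coe_injective
  have h2 : Summable fun n : {n : ℤ // n ≠ 0} => (((n : ℤ) : ℝ) ^ 2)⁻¹ := by
    have := (Real.summable_one_div_int_pow (p := 2)).mpr one_lt_two
    simp only [one_div] at this
    exact this.comp_injective Subtype.coe_injective
  exact h1.mul_of_nonneg h2 (fun _ => by positivity) (fun _ => by positivity)

theorem norm_fourierTerm (p : FourierIndex) (s : ℂ) (z : UpperHalfPlane) :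
    ‖fourierTerm p s z‖ = √z.im * ‖besselIntegral (Real.pi * ((p.1 : ℕ) : ℝ) ^ 2 * z.im)
      (Real.pi * ((p.2 : ℤ) : ℝ) ^ 2 * z.im) (s - 1 / 2)‖ := by
  have : (2 * Real.pi * Complex.I * ((p.1 : ℕ) : ℤ) * (p.2 : ℤ) * z.re : ℂ) =
      ((2 * Real.pi * ((p.1 : ℕ) : ℤ) * (p.2 : ℤ) * z.re : ℝ) : ℂ) * Complex.I := by
    push_cast; ring
  rw [fourierTerm, norm_mul, norm_mul, this, Complex.norm_exp_ofReal_mul_I, one_mul,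
    Complex.norm_real, Real.norm_of_nonneg (Real.sqrt_nonneg _)]

/-- Separates the variables: a weight summable over `(m, n)` times a power of `y` of any chosen
order. Powers of `π`, `m ^ 2` and `n ^ 2` beyond the first are discarded, being at least 1. -/
theorem besselBound_le {m n y : ℝ} (hm : 1 ≤ m ^ 2) (hn : 1 ≤ n ^ 2) (hy : 0 < y) {k : ℕ}
    (hk : 1 ≤ k) :
    ((Real.pi * m ^ 2 * y) * (Real.pi * n ^ 2 * y) ^ k)⁻¹ +
      ((Real.pi * m ^ 2 * y) ^ k * (Real.pi * n ^ 2 * y))⁻¹ ≤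
      2 * (y ^ (k + 1))⁻¹ * ((m ^ 2)⁻¹ * (n ^ 2)⁻¹) := by
  have hpi : 1 ≤ Real.pi := by linarith [Real.pi_gt_three]
  have key : ∀ {u v : ℝ}, 1 ≤ u → 1 ≤ v →
      ((Real.pi * u * y) * (Real.pi * v * y) ^ k)⁻¹ ≤ (y ^ (k + 1))⁻¹ * (u⁻¹ * v⁻¹) := by
    intro u v hu hv
    rw [← mul_inv, ← mul_inv]
    apply inv_anti₀ (by positivity)
    have h1 : v ≤ v ^ k := le_self_pow₀ hv (by omega)
    have h2 : v ^ k ≤ (Real.pi * v) ^ k := by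
      gcongr
      exact le_mul_of_one_le_left (by linarith) hpi
    have h3 : u ≤ Real.pi * u := le_mul_of_one_le_left (by linarith) hpi
    rw [mul_pow _ y, pow_succ]
    calc y ^ k * y * (u * v) = (u * y) * (v * y ^ k) := by ring
      _ ≤ (Real.pi * u * y) * ((Real.pi * v) ^ k * y ^ k) := by
        gcongr
        exact h1.trans h2
  have h1 := key hm hn
  have h2 := key hn hm
  rw [mul_comm (Real.pi * n ^ 2 * y)] at h2
  calc _ ≤ _ := add_le_add h1 h2
    _ = _ := by ring

/-- The total of the weights `1 / (m² n²)`. -/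
def fourierWeight : ℝ := ∑' p : FourierIndex, (((p.1 : ℕ) : ℝ) ^ 2)⁻¹ * ((((p.2 : ℤ) : ℝ)) ^ 2)⁻¹

theorem one_le_sq_index (p : FourierIndex) :
    1 ≤ ((p.1 : ℕ) : ℝ) ^ 2 ∧ 1 ≤ ((p.2 : ℤ) : ℝ) ^ 2 := by
  constructor
  · have : (1 : ℝ) ≤ ((p.1 : ℕ) : ℝ) := by exact_mod_cast p.1.2
    nlinarith
  · have : (1 : ℤ) ≤ (p.2 : ℤ) ^ 2 := by
      have := sq_pos_of_ne_zero p.2.2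
      omega
    exact_mod_cast this

/-- Polynomial decay of arbitrary order `k` replaces the exponential decay of the Bessel function.
The margin 3 instead of 2 absorbs the shift from `s` to `s - 1 / 2`. -/
theorem norm_fourierTerm_le (p : FourierIndex) {s : ℂ} (z : UpperHalfPlane) {k : ℕ}
    (hk : |s.re| + 3 ≤ k) :
    ‖fourierTerm p s z‖ ≤ (k.factorial * 2 * (√z.im * (z.im ^ (k + 1))⁻¹)) *
      ((((p.1 : ℕ) : ℝ) ^ 2)⁻¹ * ((((p.2 : ℤ) : ℝ)) ^ 2)⁻¹) := by
  obtain ⟨hm, hn⟩ := one_le_sq_index p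
  have hy := z.im_pos
  have hpi := Real.pi_pos
  have hk1 : 1 ≤ k := by
    have := abs_nonneg s.re
    have : (1 : ℝ) ≤ k := by linarith
    exact_mod_cast this
  have hs : |(s - 1 / 2).re| + 2 ≤ k := by
    have : (s - 1 / 2).re = s.re - 1 / 2 := by simp
    rw [this]
    have := abs_sub s.re (1 / 2)
    norm_num at this ⊢
    linarith
  rw [norm_fourierTerm]
  have h1 := norm_besselIntegral_le (a := Real.pi * ((p.1 : ℕ) : ℝ) ^ 2 * z.im)
    (b := Real.pi * ((p.2 : ℤ) : ℝ) ^ 2 * z.im) (by positivity) (by positivity) hs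
  have h2 := besselBound_le hm hn hy hk1
  calc _ ≤ √z.im * (k.factorial * (2 * (z.im ^ (k + 1))⁻¹ *
        ((((p.1 : ℕ) : ℝ) ^ 2)⁻¹ * ((((p.2 : ℤ) : ℝ)) ^ 2)⁻¹))) := by
        gcongr
        exact h1.trans (by gcongr)
    _ = _ := by ring

theorem summable_norm_fourierTerm (s : ℂ) (z : UpperHalfPlane) :
    Summable fun p => ‖fourierTerm p s z‖ := by
  obtain ⟨k, hk⟩ := exists_nat_ge (|s.re| + 3)
  exact Summable.of_nonneg_of_le (fun _ => norm_nonneg _) (fun p => norm_fourierTerm_le p z hk)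
    (summable_fourierIndex.mul_left _)

theorem norm_fourierPart_le {s : ℂ} (z : UpperHalfPlane) {k : ℕ} (hk : |s.re| + 3 ≤ k) :
    ‖fourierPart s z‖ ≤ (k.factorial * 2 * fourierWeight) * (√z.im * (z.im ^ (k + 1))⁻¹) := by
  refine (norm_tsum_le_tsum_norm (summable_norm_fourierTerm s z)).trans ?_
  refine ((summable_norm_fourierTerm s z).tsum_le_tsum (fun p => norm_fourierTerm_le p z hk)
    (summable_fourierIndex.mul_left _)).trans (le_of_eq ?_)
  rw [tsum_mul_left, fourierWeight]
  ring

theorem differentiable_fourierTerm (p : FourierIndex) (z : UpperHalfPlane) :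
    Differentiable ℂ fun s => fourierTerm p s z := by
  obtain ⟨hm, hn⟩ := one_le_sq_index p
  have hy := z.im_pos
  have hpi := Real.pi_pos
  have := differentiable_besselIntegral (a := Real.pi * ((p.1 : ℕ) : ℝ) ^ 2 * z.im)
    (b := Real.pi * ((p.2 : ℤ) : ℝ) ^ 2 * z.im) (by positivity) (by positivity)
  unfold fourierTerm
  exact (this.comp (differentiable_id.sub_const _)).const_mul _

theorem differentiable_fourierPart (z : UpperHalfPlane) :
    Differentiable ℂ fun s => fourierPart s z := by
  intro s
  -- The extra 1 makes a single `k` serve the whole unit ball around `s`.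
  obtain ⟨k, hk⟩ := exists_nat_ge (|s.re| + 1 + 3)
  have hU : IsOpen (Metric.ball s 1) := Metric.isOpen_ball
  refine DifferentiableOn.differentiableAt (s := Metric.ball s 1) ?_
    (hU.mem_nhds (Metric.mem_ball_self one_pos))
  refine Complex.differentiableOn_tsum_of_summable_norm
    (summable_fourierIndex.mul_left (k.factorial * 2 * (√z.im * (z.im ^ (k + 1))⁻¹)))
    (fun p => (differentiable_fourierTerm p z).differentiableOn) hU fun p w hw => ?_
  refine norm_fourierTerm_le p z ?_
  have h1 : |(w - s).re| ≤ ‖w - s‖ := Complex.abs_re_le_norm _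
  have h2 : ‖w - s‖ < 1 := by simpa [dist_eq_norm] using hw
  have h3 : |w.re| ≤ |s.re| + |(w - s).re| := by
    rw [Complex.sub_re]
    have := abs_add_le s.re (w.re - s.re)
    simpa using this
  linarith

theorem measurable_fourierTerm (p : FourierIndex) (s : ℂ) :
    Measurable fun z : UpperHalfPlane => fourierTerm p s z := by
  have him : Measurable UpperHalfPlane.im := UpperHalfPlane.continuous_im.measurable
  have hre : Measurable UpperHalfPlane.re := UpperHalfPlane.continuous_re.measurable
  unfold fourierTerm
  refine Measurable.mul (by fun_prop) (measurable_besselIntegral ?_ ?_ _) <;> fun_prop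

theorem measurable_fourierPart (s : ℂ) :
    Measurable fun z : UpperHalfPlane => fourierPart s z := by
  refine measurable_of_tendsto_metrizable' (u := (atTop : Filter (Finset FourierIndex)))
    (f := fun t z => ∑ p ∈ t, fourierTerm p s z) (fun t => ?_) ?_
  · exact Finset.measurable_sum _ fun p _ => measurable_fourierTerm p s
  · rw [tendsto_pi_nhds]
    exact fun z => (summable_norm_fourierTerm s z).of_norm.hasSum

/-! ### Cosets and pairs of integers -/

/-- The pairs `(c, d)` with `c > 0`, or `c = 0` and `d > 0`. -/
def IsPositivePair (p : ℤ × ℤ) : Prop := 0 < p.1 ∨ (p.1 = 0 ∧ 0 < p.2)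

theorem isPositivePair_or_neg {p : ℤ × ℤ} (hp : p ≠ 0) :
    IsPositivePair p ∨ IsPositivePair (-p) := by
  have : ¬ (p.1 = 0 ∧ p.2 = 0) := fun h => hp (Prod.ext h.1 h.2)
  simp only [IsPositivePair, Prod.fst_neg, Prod.snd_neg]
  omega

theorem IsPositivePair.not_neg {p : ℤ × ℤ} (hp : IsPositivePair p) : ¬ IsPositivePair (-p) := by
  simp only [IsPositivePair, Prod.fst_neg, Prod.snd_neg] at hp ⊢
  omega

/-- The multiple `n (c, d)` of a pair. -/
def scalePair (n : ℕ) (p : ℤ × ℤ) : ℤ × ℤ := (n * p.1, n * p.2)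

theorem IsPositivePair.scale {p : ℤ × ℤ} (hp : IsPositivePair p) (n : ℕ+) :
    IsPositivePair (scalePair n p) := by
  have hn : (0 : ℤ) < (n : ℕ) := by exact_mod_cast n.pos
  simp only [IsPositivePair, scalePair] at hp ⊢
  rcases hp with h | ⟨h, h'⟩
  · exact Or.inl (mul_pos hn h)
  · exact Or.inr ⟨by simp [h], mul_pos hn h'⟩

/-- The bottom row of a matrix. -/
def bottomRow (γ : SL(2, ℤ)) : ℤ × ℤ := (γ 1 0, γ 1 1)

theorem isCoprime_bottomRow (γ : SL(2, ℤ)) : IsCoprime (bottomRow γ).1 (bottomRow γ).2 :=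
  ModularGroup.bottom_row_coprime γ

theorem bottomRow_ne_zero (γ : SL(2, ℤ)) : bottomRow γ ≠ 0 := by
  intro h
  have := isCoprime_bottomRow γ
  rw [h] at this
  exact not_isCoprime_zero_zero this

theorem det_eq_one (γ : SL(2, ℤ)) : γ 0 0 * γ 1 1 - γ 0 1 * γ 1 0 = 1 := by
  have h := Matrix.det_fin_two (γ : Matrix (Fin 2) (Fin 2) ℤ)
  rw [γ.det_coe] at h
  exact h.symm

theorem mul_inv_mem_parabolic_iff (a b : SL(2, ℤ)) :
    b * a⁻¹ ∈ parabolic ↔ bottomRow b = bottomRow a ∨ bottomRow b = -bottomRow a := by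
  have hmem : b * a⁻¹ ∈ parabolic ↔ b 1 0 * a 1 1 - b 1 1 * a 1 0 = 0 := by
    change (b * a⁻¹) 1 0 = 0 ↔ _
    have : (b * a⁻¹) 1 0 = b 1 0 * a 1 1 - b 1 1 * a 1 0 := by
      rw [Matrix.SpecialLinearGroup.coe_mul, Matrix.mul_apply, Fin.sum_univ_two,
        Matrix.SpecialLinearGroup.coe_inv, Matrix.adjugate_fin_two]
      simp [sub_eq_add_neg]
    rw [this]
  rw [hmem]
  simp only [bottomRow, Prod.mk.injEq, Prod.neg_mk]
  constructor
  · intro h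
    have ha := det_eq_one a
    have hb := det_eq_one b
    -- `u` and `v` are the diagonal entries of `b * a⁻¹`. Its lower left entry vanishes, so `u * v =
    -- 1`, and the bottom row of `b` is `u` times that of `a`.
    set u := a 0 0 * b 1 1 - a 0 1 * b 1 0 with hu
    set v := b 0 0 * a 1 1 - b 0 1 * a 1 0 with hv
    have h10 : b 1 0 = u * a 1 0 := by
      rw [hu]; linear_combination (-(b 1 0)) * ha + a 0 0 * h
    have h11 : b 1 1 = u * a 1 1 := by
      rw [hu]; linear_combination (-(b 1 1)) * ha + a 0 1 * h
    have huv : u * v = 1 := by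
      rw [hv]
      linear_combination (-(b 0 0)) * h11 + b 0 1 * h10 + hb
    rcases Int.isUnit_iff.mp (IsUnit.of_mul_eq_one _ huv) with h | h
    · left; rw [h10, h11, h]; simp
    · right; rw [h10, h11, h]; simp
  · rintro (⟨h, h'⟩ | ⟨h, h'⟩) <;> rw [h, h'] <;> ring

open Classical in
/-- The bottom row of a matrix, up to the sign that makes it a positive pair. -/
def positiveRow (γ : SL(2, ℤ)) : ℤ × ℤ :=
  if IsPositivePair (bottomRow γ) then bottomRow γ else -bottomRow γ

theorem positiveRow_eq_or (γ : SL(2, ℤ)) :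
    positiveRow γ = bottomRow γ ∨ positiveRow γ = -bottomRow γ := by
  unfold positiveRow; split_ifs <;> simp

theorem isPositivePair_positiveRow (γ : SL(2, ℤ)) : IsPositivePair (positiveRow γ) := by
  unfold positiveRow
  split_ifs with h
  · exact h
  · exact (isPositivePair_or_neg (bottomRow_ne_zero γ)).resolve_left h

theorem isCoprime_positiveRow (γ : SL(2, ℤ)) :
    IsCoprime (positiveRow γ).1 (positiveRow γ).2 := by
  rcases positiveRow_eq_or γ with h | h <;> rw [h]
  · exact isCoprime_bottomRow γ
  · exact (isCoprime_bottomRow γ).neg_neg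

theorem positiveRow_eq_iff (a b : SL(2, ℤ)) :
    positiveRow a = positiveRow b ↔ b * a⁻¹ ∈ parabolic := by
  rw [mul_inv_mem_parabolic_iff]
  constructor
  · intro h
    rcases positiveRow_eq_or a with ha | ha <;> rcases positiveRow_eq_or b with hb | hb <;>
      rw [ha, hb] at h
    · exact Or.inl h.symm
    · exact Or.inr (by rw [h, neg_neg])
    · exact Or.inr h.symm
    · exact Or.inl (neg_injective h).symm
  · rintro (h | h)
    · unfold positiveRow; rw [h]
    · have hp := isPositivePair_or_neg (bottomRow_ne_zero a)
      unfold positiveRow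
      rw [h]
      by_cases h' : IsPositivePair (bottomRow a)
      · simp [h', h'.not_neg]
      · simp [h', hp.resolve_left h']

/-- The positive pair attached to a coset. -/
def cosetRow : Cosets → ℤ × ℤ :=
  Quotient.lift positiveRow fun a b hab =>
    (positiveRow_eq_iff a b).mpr (QuotientGroup.rightRel_apply.mp hab)

theorem cosetRow_injective : Function.Injective cosetRow := by
  intro p q
  induction p using Quotient.inductionOn with | _ a => ?_
  induction q using Quotient.inductionOn with | _ b => ?_
  intro h
  exact Quotient.sound (QuotientGroup.rightRel_apply.mpr ((positiveRow_eq_iff a b).mp h))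

theorem isPositivePair_cosetRow (q : Cosets) : IsPositivePair (cosetRow q) := by
  induction q using Quotient.inductionOn with | _ a => exact isPositivePair_positiveRow a

theorem isCoprime_cosetRow (q : Cosets) : IsCoprime (cosetRow q).1 (cosetRow q).2 := by
  induction q using Quotient.inductionOn with | _ a => exact isCoprime_positiveRow a

theorem exists_cosetRow_eq {p : ℤ × ℤ} (hp : IsPositivePair p) (hc : IsCoprime p.1 p.2) :
    ∃ q, cosetRow q = p := by
  obtain ⟨γ, -, hγ⟩ := ModularGroup.bottom_row_surj (R := ℤ) (a := ![p.1, p.2]) (by simpa using hc)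
  have h0 : γ 1 0 = p.1 := congrFun hγ 0
  have h1 : γ 1 1 = p.2 := congrFun hγ 1
  refine ⟨⟦γ⟧, ?_⟩
  have hb : bottomRow γ = p := Prod.ext h0 h1
  change positiveRow γ = p
  unfold positiveRow
  rw [hb, if_pos hp]

/-- Multiples of the coprime positive pairs: all positive pairs, each of them once. -/
def multipleRow (x : ℕ+ × Cosets) : {p : ℤ × ℤ // IsPositivePair p} :=
  ⟨scalePair x.1 (cosetRow x.2), (isPositivePair_cosetRow x.2).scale x.1⟩

/-- The multiplier is recovered from a pair as its gcd, and dividing by the gcd leaves a coprime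
positive pair, which comes from exactly one coset. -/
theorem multipleRow_bijective : Function.Bijective multipleRow := by
  constructor
  · rintro ⟨m, p⟩ ⟨n, q⟩ h
    have h' : scalePair m (cosetRow p) = scalePair n (cosetRow q) := congrArg Subtype.val h
    have hg : ∀ (k : ℕ) (r : Cosets),
        Int.gcd (scalePair k (cosetRow r)).1 (scalePair k (cosetRow r)).2 = k := by
      intro k r
      have := Int.isCoprime_iff_gcd_eq_one.mp (isCoprime_cosetRow r)
      simp [scalePair, Int.gcd_mul_left, this]
    have hmn : (m : ℕ) = n := by rw [← hg m p, h', hg]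
    have hmn' : m = n := PNat.coe_injective hmn
    subst hmn'
    have hm : (m : ℕ) ≠ 0 := m.ne_zero
    have : cosetRow p = cosetRow q := by
      refine Prod.ext ?_ ?_
      · have := congrArg Prod.fst h'
        simpa [scalePair, hm] using this
      · have := congrArg Prod.snd h'
        simpa [scalePair, hm] using this
    rw [cosetRow_injective this]
  · rintro ⟨⟨c, d⟩, hp⟩
    have hne : 0 < Int.gcd c d := by
      refine Nat.pos_of_ne_zero fun h => ?_
      obtain ⟨h1, h2⟩ := Int.gcd_eq_zero_iff.mp h
      simp [IsPositivePair, h1, h2] at hp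
    obtain ⟨c', d', hcop, hc, hd⟩ := Int.exists_gcd_one hne
    have hg : (0 : ℤ) < (Int.gcd c d : ℤ) := by exact_mod_cast hne
    have hp' : IsPositivePair (c', d') := by
      simp only [IsPositivePair] at hp ⊢
      rcases hp with h | ⟨h, h'⟩
      · left
        rw [hc] at h
        exact pos_of_mul_pos_left h hg.le
      · right
        rw [hc] at h
        rw [hd] at h'
        exact ⟨(mul_eq_zero.mp h).resolve_right hg.ne', pos_of_mul_pos_left h' hg.le⟩
    obtain ⟨q, hq⟩ := exists_cosetRow_eq hp' (Int.isCoprime_iff_gcd_eq_one.mpr hcop)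
    refine ⟨(⟨Int.gcd c d, hne⟩, q), Subtype.ext ?_⟩
    simp only [multipleRow, hq, PNat.mk_coe]
    refine Prod.ext ?_ ?_
    · rw [mul_comm] at hc; exact hc.symm
    · rw [mul_comm] at hd; exact hd.symm

/-- Positive pairs, sorted by whether the first entry vanishes. -/
def sumToPositivePair : ℕ+ ⊕ ℕ+ × ℤ → {p : ℤ × ℤ // IsPositivePair p} :=
  Sum.elim (fun n => ⟨(0, (n : ℕ)), Or.inr ⟨rfl, Int.natCast_pos.mpr n.pos⟩⟩)
    (fun x => ⟨((x.1 : ℕ), x.2), Or.inl (Int.natCast_pos.mpr x.1.pos)⟩)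

theorem sumToPositivePair_bijective : Function.Bijective sumToPositivePair := by
  constructor
  · rintro (a | ⟨a, a'⟩) (b | ⟨b, b'⟩) h <;>
      simp [sumToPositivePair, Subtype.ext_iff] at h ⊢
    · exact h
    · exact absurd h.1.symm (Int.natCast_ne_zero.mpr b.ne_zero)
    · exact h
  · rintro ⟨⟨c, d⟩, h | ⟨h, h'⟩⟩
    · have h : 0 < c := h
      refine ⟨Sum.inr (⟨c.toNat, by omega⟩, d), Subtype.ext ?_⟩
      simp [sumToPositivePair, h.le]
    · have h : c = 0 := h
      have h' : 0 < d := h'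
      refine ⟨Sum.inl ⟨d.toNat, by omega⟩, Subtype.ext ?_⟩
      refine Prod.ext h.symm ?_
      change ((d.toNat : ℕ) : ℤ) = d
      simp [h'.le]

/-! ### Lattice sums -/

/-- The summand `(y / |m z + n|²) ^ s`. -/
def latticeTerm (s : ℂ) (z : UpperHalfPlane) (p : ℤ × ℤ) : ℂ :=
  ((z.im / Complex.normSq (p.1 * (z : ℂ) + p.2) : ℝ) : ℂ) ^ s

theorem latticeTerm_neg (s : ℂ) (z : UpperHalfPlane) (p : ℤ × ℤ) :
    latticeTerm s z (-p) = latticeTerm s z p := by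
  unfold latticeTerm
  congr 3
  rw [← Complex.normSq_neg]
  congr 1
  push_cast [Prod.fst_neg, Prod.snd_neg]
  ring

theorem eisensteinTerm_eq_latticeTerm (s : ℂ) (z : UpperHalfPlane) (q : Cosets) :
    eisensteinTerm s z q = latticeTerm s z (cosetRow q) := by
  induction q using Quotient.inductionOn with | _ a => ?_
  change (((a • z).im : ℝ) : ℂ) ^ s = latticeTerm s z (positiveRow a)
  have : (((a • z).im : ℝ) : ℂ) ^ s = latticeTerm s z (bottomRow a) := by
    rw [ModularGroup.im_smul_eq_div_normSq, ModularGroup.denom_apply]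
    rfl
  rw [this]
  rcases positiveRow_eq_or a with h | h <;> rw [h]
  rw [latticeTerm_neg]

theorem latticeTerm_scalePair (s : ℂ) (z : UpperHalfPlane) (p : ℤ × ℤ) (n : ℕ+) :
    latticeTerm s z (scalePair n p) = 1 / ((n : ℕ) : ℂ) ^ (2 * s) * latticeTerm s z p := by
  have hn : ((n : ℕ) : ℂ) ≠ 0 := by exact_mod_cast n.ne_zero
  unfold latticeTerm
  have h1 : z.im / Complex.normSq (((scalePair n p).1 : ℤ) * (z : ℂ) + ((scalePair n p).2 : ℤ)) =
      (((n : ℕ) : ℝ) * ((n : ℕ) : ℝ))⁻¹ * (z.im / Complex.normSq (p.1 * (z : ℂ) + p.2)) := by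
    have : (((scalePair n p).1 : ℤ) * (z : ℂ) + ((scalePair n p).2 : ℤ)) =
        (((n : ℕ) : ℝ) : ℂ) * (p.1 * (z : ℂ) + p.2) := by
      simp only [scalePair]; push_cast; ring
    rw [this, map_mul, Complex.normSq_ofReal, mul_inv, div_eq_mul_inv, div_eq_mul_inv, mul_inv,
      mul_inv]
    ring
  rw [h1, Complex.ofReal_mul, Complex.mul_cpow_ofReal_nonneg (by positivity)
    (div_nonneg z.im_pos.le (Complex.normSq_nonneg _))]
  congr 1
  rw [two_mul, Complex.cpow_add _ _ hn, one_div, ← Complex.natCast_mul_natCast_cpow]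
  push_cast
  rw [Complex.inv_cpow]
  -- `Complex.inv_cpow` needs an argument different from `π`; here it is 0.
  rw [← Nat.cast_mul, Complex.natCast_arg]
  exact Real.pi_pos.ne

theorem norm_latticeTerm (s : ℂ) (hs : 0 < s.re) (z : UpperHalfPlane) (p : ℤ × ℤ) :
    ‖latticeTerm s z p‖ = z.im ^ s.re * ‖(p.1 * (z : ℂ) + p.2)‖ ^ (-(2 * s.re)) := by
  unfold latticeTerm
  rw [Complex.norm_cpow_eq_rpow_re_of_nonneg
    (div_nonneg z.im_pos.le (Complex.normSq_nonneg _)) hs.ne',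
    Real.div_rpow z.im_pos.le (Complex.normSq_nonneg _), Complex.normSq_eq_norm_sq,
    Real.rpow_neg (norm_nonneg _), div_eq_mul_inv, ← Real.rpow_natCast, ← Real.rpow_mul
    (norm_nonneg _)]
  norm_num

theorem summable_norm_latticeTerm {s : ℂ} (hs : 1 < s.re) (z : UpperHalfPlane) :
    Summable fun p : ℤ × ℤ => ‖latticeTerm s z p‖ := by
  have h := EisensteinSeries.summable_one_div_norm_rpow (k := 2 * s.re) (by linarith)
  have h2 : Summable fun x : Fin 2 → ℤ =>
      z.im ^ s.re * ‖(x 0 * (z : ℂ) + x 1)‖ ^ (-(2 * s.re)) := by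
    refine Summable.mul_left _ (Summable.of_nonneg_of_le (fun _ => by positivity)
      (fun x => EisensteinSeries.summand_bound z (by linarith) x) (h.mul_left _))
  have h3 := (finTwoArrowEquiv ℤ).symm.summable_iff.mpr h2
  refine h3.congr fun p => ?_
  rw [norm_latticeTerm s (by linarith)]
  simp [finTwoArrowEquiv]

theorem summable_norm_eisensteinTerm {s : ℂ} (hs : 1 < s.re) (z : UpperHalfPlane) :
    Summable fun q => ‖eisensteinTerm s z q‖ := by
  simp only [eisensteinTerm_eq_latticeTerm]
  exact (summable_norm_latticeTerm hs z).comp_injective cosetRow_injective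

theorem hasSum_pnat_one_div_cpow {s : ℂ} (hs : 1 < s.re) :
    HasSum (fun n : ℕ+ => 1 / ((n : ℕ) : ℂ) ^ s) (riemannZeta s) := by
  have h0 : s ≠ 0 := by rintro rfl; simp at hs; linarith
  rw [zeta_eq_tsum_one_div_nat_cpow hs]
  have h := (Complex.summable_one_div_nat_cpow.mpr hs).hasSum
  refine (Function.Injective.hasSum_iff PNat.coe_injective fun n hn => ?_).mpr h
  have : n = 0 := by
    by_contra h
    exact hn ⟨⟨n, Nat.pos_of_ne_zero h⟩, rfl⟩
  simp [this, h0]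

/-- The factor `n ^ (-2 s)` of the zeta series is absorbed by scaling the coprime pair by `n`, so
the coprimality condition disappears. -/
theorem zeta_mul_tsum_eisensteinTerm {s : ℂ} (hs : 1 < s.re) (z : UpperHalfPlane) :
    riemannZeta (2 * s) * ∑' q, eisensteinTerm s z q =
      ∑' p : {p : ℤ × ℤ // IsPositivePair p}, latticeTerm s z p := by
  have h2s : 1 < (2 * s).re := by simp; linarith
  have hz := hasSum_pnat_one_div_cpow h2s
  have hzn : Summable fun n : ℕ+ => ‖1 / ((n : ℕ) : ℂ) ^ (2 * s)‖ := hz.summable.norm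
  rw [← hz.tsum_eq, tsum_mul_tsum_of_summable_norm hzn (summable_norm_eisensteinTerm hs z),
    ← (Equiv.ofBijective _ multipleRow_bijective).tsum_eq]
  refine tsum_congr fun x => ?_
  rw [eisensteinTerm_eq_latticeTerm, ← latticeTerm_scalePair]
  rfl

theorem tsum_isPositivePair {s : ℂ} (hs : 1 < s.re) (z : UpperHalfPlane) :
    ∑' p : {p : ℤ × ℤ // IsPositivePair p}, latticeTerm s z p =
      ∑' n : ℕ+, latticeTerm s z (0, ((n : ℕ) : ℤ)) +
        ∑' x : ℕ+ × ℤ, latticeTerm s z (((x.1 : ℕ) : ℤ), x.2) := by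
  have hsum := (summable_norm_latticeTerm hs z).of_norm
  have hpos : Summable fun p : {p : ℤ × ℤ // IsPositivePair p} => latticeTerm s z p :=
    hsum.comp_injective Subtype.coe_injective
  have h1 : Summable fun x => latticeTerm s z (sumToPositivePair x) :=
    (Equiv.ofBijective _ sumToPositivePair_bijective).summable_iff.mpr hpos
  rw [← (Equiv.ofBijective _ sumToPositivePair_bijective).tsum_eq]
  refine HasSum.tsum_eq (HasSum.sum ?_ ?_)
  · exact (h1.comp_injective Sum.inl_injective).hasSum
  · exact (h1.comp_injective Sum.inr_injective).hasSum

/-! ### The Fourier expansion in the region of absolute convergence -/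

theorem besselKernel_isBigO_zero_right (a : ℝ) :
    besselKernel a 0 =O[𝓝[>] 0] fun t : ℝ => t ^ (-(0 : ℝ)) := by
  have h : Tendsto (besselKernel a 0) (𝓝 0) (𝓝 (besselKernel a 0 0)) := by
    have : besselKernel a 0 = fun t : ℝ => ((Real.exp (-(a * t)) : ℝ) : ℂ) := by
      funext t; simp [besselKernel]
    rw [this]
    exact Continuous.tendsto (by fun_prop) 0
  simpa using (h.mono_left nhdsWithin_le_nhds).isBigO_one ℝ

theorem besselIntegral_zero_right_convergent {a : ℝ} (ha : 0 < a) {s : ℂ} (hs : 0 < s.re) :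
    MellinConvergent (besselKernel a 0) s := by
  refine mellinConvergent_of_isBigO_rpow_exp ha
    ((continuousOn_besselKernel a 0).locallyIntegrableOn measurableSet_Ioi)
    ?_ (besselKernel_isBigO_zero_right a) hs
  refine Asymptotics.isBigO_of_le _ fun t => ?_
  rw [norm_besselKernel]
  simp

theorem besselIntegral_zero_right {a : ℝ} (ha : 0 < a) {s : ℂ} (hs : 0 < s.re) :
    besselIntegral a 0 s = (1 / (a : ℂ)) ^ s * Complex.Gamma s := by
  rw [← Complex.integral_cpow_mul_exp_neg_mul_Ioi hs ha]
  unfold besselIntegral mellin besselKernel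
  refine setIntegral_congr_fun measurableSet_Ioi fun t _ => ?_
  simp

theorem integral_norm_besselKernel_zero_right {a : ℝ} (ha : 0 < a) {s : ℂ} (hs : 0 < s.re) :
    ∫ t in Ioi (0 : ℝ), ‖(t : ℂ) ^ (s - 1) • besselKernel a 0 t‖ =
      (1 / a) ^ s.re * Real.Gamma s.re := by
  rw [← Real.integral_rpow_mul_exp_neg_mul_Ioi hs ha]
  refine setIntegral_congr_fun measurableSet_Ioi fun t ht => ?_
  rw [norm_smul, Complex.norm_cpow_eq_rpow_re_of_pos ht, norm_besselKernel]
  simp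

/-- The archimedean factor `π ^ (-s) Γ(s)`. -/
def gammaFactor (s : ℂ) : ℂ := (Real.pi : ℂ) ^ (-s) * Complex.Gamma s

theorem gammaFactor_mul_riemannZeta {s : ℂ} (hs : 1 < (2 * s).re) :
    gammaFactor s * riemannZeta (2 * s) = completedRiemannZeta (2 * s) := by
  rw [completedZeta_eq_tsum_of_one_lt_re hs, ← zeta_eq_tsum_one_div_nat_cpow hs, gammaFactor]
  congr 3 <;> ring_nf

theorem normSq_lattice (z : UpperHalfPlane) (m n : ℤ) :
    Complex.normSq (m * (z : ℂ) + n) = (n + m * z.re) ^ 2 + m ^ 2 * z.im ^ 2 := by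
  rw [Complex.normSq_apply]
  simp
  ring

theorem normSq_lattice_pos (z : UpperHalfPlane) (m : ℕ+) (n : ℤ) :
    0 < Complex.normSq (((m : ℕ) : ℤ) * (z : ℂ) + n) := by
  have hm : (0 : ℝ) < (((m : ℕ) : ℤ) : ℝ) := by exact_mod_cast m.pos
  have := z.im_pos
  rw [normSq_lattice]
  positivity

/-- This is Euler's integral for `Γ(s)`, rescaled. It turns a lattice term into the Mellin transform
of a Gaussian in the lattice point, to which Poisson summation applies. -/
theorem gammaFactor_mul_latticeTerm {s : ℂ} (hs : 0 < s.re) (z : UpperHalfPlane) (p : ℤ × ℤ)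
    (hp : 0 < Complex.normSq (p.1 * (z : ℂ) + p.2)) :
    gammaFactor s * latticeTerm s z p =
      besselIntegral (Real.pi * Complex.normSq (p.1 * (z : ℂ) + p.2) / z.im) 0 s := by
  have hy := z.im_pos
  have hpi := Real.pi_pos
  rw [besselIntegral_zero_right (by positivity) hs, gammaFactor, latticeTerm]
  have h1 : (1 / ((Real.pi * Complex.normSq (p.1 * (z : ℂ) + p.2) / z.im : ℝ) : ℂ)) =
      ((Real.pi⁻¹ : ℝ) : ℂ) * ((z.im / Complex.normSq (p.1 * (z : ℂ) + p.2) : ℝ) : ℂ) := by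
    rw [← Complex.ofReal_mul, ← Complex.ofReal_one, ← Complex.ofReal_div]
    congr 1
    field_simp
  rw [h1, Complex.mul_cpow_ofReal_nonneg (by positivity) (by positivity), Complex.ofReal_inv,
    Complex.inv_cpow _ _ (by
      rw [Complex.arg_ofReal_of_nonneg hpi.le]; exact hpi.ne), Complex.cpow_neg]
  ring

/-- The additive character `exp (2 π i m n x)`. -/
def rowPhase (m : ℕ+) (n : ℤ) (z : UpperHalfPlane) : ℂ :=
  Complex.exp (2 * Real.pi * Complex.I * ((m : ℕ) : ℤ) * n * z.re)

theorem norm_rowPhase (m : ℕ+) (n : ℤ) (z : UpperHalfPlane) : ‖rowPhase m n z‖ = 1 := by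
  have : (2 * Real.pi * Complex.I * ((m : ℕ) : ℤ) * n * z.re : ℂ) =
      ((2 * Real.pi * ((m : ℕ) : ℤ) * n * z.re : ℝ) : ℂ) * Complex.I := by
    push_cast; ring
  rw [rowPhase, this, Complex.norm_exp_ofReal_mul_I]

/-- Poisson summation in `n` for the Gaussian of `m z + n`. -/
theorem tsum_besselKernel_poisson (z : UpperHalfPlane) (m : ℕ+) {t : ℝ} (ht : 0 < t) :
    ∑' n : ℤ, besselKernel (Real.pi * Complex.normSq (((m : ℕ) : ℤ) * (z : ℂ) + n) / z.im) 0 t =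
      ∑' n : ℤ, rowPhase m n z * ((√z.im : ℂ) * ((t : ℂ) ^ (-(1 / 2) : ℂ) *
        besselKernel (Real.pi * ((m : ℕ) : ℝ) ^ 2 * z.im) (Real.pi * (n : ℝ) ^ 2 * z.im) t)) := by
  have hy := z.im_pos
  have hyt : 0 < z.im / t := by positivity
  have hP := Complex.tsum_exp_neg_quadratic (a := ((z.im / t : ℝ) : ℂ)) (by simpa using hyt)
    (Complex.I * (((m : ℕ) : ℂ) * z.re))
  have hroot : ((z.im / t : ℝ) : ℂ) ^ (1 / 2 : ℂ) = (√z.im : ℂ) * (t : ℂ) ^ (-(1 / 2) : ℂ) := by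
    rw [div_eq_mul_inv, Complex.ofReal_mul, Complex.mul_cpow_ofReal_nonneg hy.le
      (inv_nonneg.mpr ht.le), Complex.ofReal_inv, Complex.inv_cpow _ _ (by
      rw [Complex.arg_ofReal_of_nonneg ht.le]; exact Real.pi_pos.ne), ← Complex.cpow_neg,
      Real.sqrt_eq_rpow, Complex.ofReal_cpow hy.le]
    norm_num
  have hne : ((z.im / t : ℝ) : ℂ) ^ (1 / 2 : ℂ) ≠ 0 := by
    rw [Complex.cpow_def_of_ne_zero (by exact_mod_cast hyt.ne')]
    exact Complex.exp_ne_zero _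
  have hyc : (z.im : ℂ) ≠ 0 := by exact_mod_cast hy.ne'
  have htc : (t : ℂ) ≠ 0 := by exact_mod_cast ht.ne'
  -- Completing the square is unnecessary: the imaginary shift `I * m * x` in the quadratic Poisson
  -- formula becomes a real translation. It has the sign `n - m x`, so the sum is reindexed by `n ↦
  -- -n`.
  have hL : ∀ n : ℤ,
      besselKernel (Real.pi * Complex.normSq (((m : ℕ) : ℤ) * (z : ℂ) + n) / z.im) 0 t =
      besselKernel (Real.pi * ((m : ℕ) : ℝ) ^ 2 * z.im) 0 t *
        Complex.exp (-Real.pi / ((z.im / t : ℝ) : ℂ) *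
          (((-n : ℤ) : ℂ) + Complex.I * (Complex.I * (((m : ℕ) : ℂ) * z.re))) ^ 2) := by
    intro n
    rw [normSq_lattice]
    simp only [besselKernel, Complex.ofReal_exp]
    rw [← Complex.exp_add]
    congr 1
    push_cast
    have : Complex.I * (Complex.I * (((m : ℕ) : ℂ) * z.re)) = -(((m : ℕ) : ℂ) * z.re) := by
      rw [← mul_assoc, Complex.I_mul_I]; ring
    rw [this]
    field_simp
    ring
  have hR : ∀ n : ℤ, rowPhase m n z * ((√z.im : ℂ) * ((t : ℂ) ^ (-(1 / 2) : ℂ) *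
        besselKernel (Real.pi * ((m : ℕ) : ℝ) ^ 2 * z.im) (Real.pi * (n : ℝ) ^ 2 * z.im) t)) =
      besselKernel (Real.pi * ((m : ℕ) : ℝ) ^ 2 * z.im) 0 t *
        (((z.im / t : ℝ) : ℂ) ^ (1 / 2 : ℂ) *
        Complex.exp (-Real.pi * ((z.im / t : ℝ) : ℂ) * n ^ 2 +
          2 * Real.pi * (Complex.I * (((m : ℕ) : ℂ) * z.re)) * n)) := by
    intro n
    rw [hroot]
    simp only [besselKernel, Complex.ofReal_exp, rowPhase]
    have : Complex.exp (2 * Real.pi * Complex.I * ((m : ℕ) : ℤ) * n * z.re) *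
        Complex.exp ((-(Real.pi * ((m : ℕ) : ℝ) ^ 2 * z.im * t +
          Real.pi * (n : ℝ) ^ 2 * z.im / t) : ℝ) : ℂ) =
        Complex.exp ((-(Real.pi * ((m : ℕ) : ℝ) ^ 2 * z.im * t + 0 / t) : ℝ) : ℂ) *
        Complex.exp (-Real.pi * ((z.im / t : ℝ) : ℂ) * n ^ 2 +
          2 * Real.pi * (Complex.I * (((m : ℕ) : ℂ) * z.re)) * n) := by
      rw [← Complex.exp_add, ← Complex.exp_add]
      congr 1
      push_cast
      field_simp
      ring
    linear_combination ((√z.im : ℂ) * (t : ℂ) ^ (-(1 / 2) : ℂ)) * this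
  simp_rw [hL, hR]
  rw [tsum_mul_left, tsum_mul_left, tsum_mul_left, hP, ← (Equiv.neg ℤ).tsum_eq]
  simp only [Equiv.neg_apply, neg_neg]
  rw [← mul_assoc (((z.im / t : ℝ) : ℂ) ^ (1 / 2 : ℂ)), mul_one_div_cancel hne, one_mul]

/-- A single term of the Poisson-summed row `m`. -/
def rowTerm (m : ℕ+) (n : ℤ) (s : ℂ) (z : UpperHalfPlane) : ℂ :=
  rowPhase m n z * (√z.im : ℂ) *
    besselIntegral (Real.pi * ((m : ℕ) : ℝ) ^ 2 * z.im) (Real.pi * (n : ℝ) ^ 2 * z.im) (s - 1 / 2)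

theorem besselIntegral_row_convergent (m : ℕ+) (n : ℤ) {s : ℂ} (hs : 0 < s.re)
    (z : UpperHalfPlane) : MellinConvergent
      (besselKernel (Real.pi * ((m : ℕ) : ℝ) ^ 2 * z.im) (Real.pi * (n : ℝ) ^ 2 * z.im)) s := by
  have hm : (0 : ℝ) < ((m : ℕ) : ℝ) := by exact_mod_cast m.pos
  have hy := z.im_pos
  have hpi := Real.pi_pos
  by_cases hn : n = 0
  · subst hn
    simpa using besselIntegral_zero_right_convergent (by positivity) hs
  · have hn' : (0 : ℝ) < (n : ℝ) ^ 2 := by positivity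
    exact besselIntegral_convergent (by positivity) (by positivity) s

/-- Poisson summation under the Mellin integral, with sum and integral interchanged on both sides.
The factor `t ^ (-1 / 2)` it produces is the shift from `s` to `s - 1 / 2`. -/
theorem tsum_latticeTerm_row {s : ℂ} (hs : 1 < s.re) (z : UpperHalfPlane) (m : ℕ+) :
    Summable (fun n : ℤ => rowTerm m n s z) ∧
    gammaFactor s * ∑' n : ℤ, latticeTerm s z (((m : ℕ) : ℤ), n) = ∑' n : ℤ, rowTerm m n s z := by
  have hm : (0 : ℝ) < ((m : ℕ) : ℝ) := by exact_mod_cast m.pos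
  have hy := z.im_pos
  have hpi := Real.pi_pos
  have hs' : 0 < (s - 1 / 2).re := by simp; linarith
  have hN := normSq_lattice_pos z m
  set A : ℤ → ℝ → ℂ := fun n t => (t : ℂ) ^ (s - 1) •
    besselKernel (Real.pi * Complex.normSq (((m : ℕ) : ℤ) * (z : ℂ) + n) / z.im) 0 t with hA
  set B : ℤ → ℝ → ℂ := fun n t => (t : ℂ) ^ (s - 1 / 2 - 1) •
    besselKernel (Real.pi * ((m : ℕ) : ℝ) ^ 2 * z.im) (Real.pi * (n : ℝ) ^ 2 * z.im) t with hB
  have hAint : ∀ n, IntegrableOn (A n) (Ioi 0) := fun n =>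
    besselIntegral_zero_right_convergent (by have := hN n; positivity) (by linarith)
  have hBint : ∀ n, IntegrableOn (B n) (Ioi 0) := fun n =>
    besselIntegral_row_convergent m n hs' z
  have hAsum : Summable fun n => ∫ t in Ioi (0 : ℝ), ‖A n t‖ := by
    have h1 : Summable fun n : ℤ => ‖latticeTerm s z (((m : ℕ) : ℤ), n)‖ :=
      (summable_norm_latticeTerm hs z).comp_injective (Prod.mk_right_injective ((m : ℕ) : ℤ))
    refine (h1.mul_left (Real.pi ^ (-s.re) * Real.Gamma s.re)).congr fun n => ?_
    have hn := hN n
    rw [hA, integral_norm_besselKernel_zero_right (by positivity) (by linarith), latticeTerm,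
      Complex.norm_cpow_eq_rpow_re_of_nonneg (by positivity) (by linarith), mul_right_comm]
    congr 1
    rw [Real.rpow_neg hpi.le, ← Real.inv_rpow hpi.le, ← Real.mul_rpow (by positivity)
      (by positivity)]
    congr 1
    field_simp
  have hBsum : Summable fun n => ∫ t in Ioi (0 : ℝ), ‖B n t‖ := by
    obtain ⟨k, hk⟩ := exists_nat_ge (|(s - 1 / 2).re| + 2)
    have h2 : Summable fun n : ℤ => (k.factorial * (2 * (z.im ^ (k + 1))⁻¹ *
        (((((m : ℕ) : ℝ)) ^ 2)⁻¹)) : ℝ) * (1 / (n : ℝ) ^ 2) :=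
      (Real.summable_one_div_int_pow.mpr one_lt_two).mul_left _
    -- Only cofinitely many terms need the bound; `n = 0` is left out because the Bessel estimate
    -- requires `b > 0`.
    refine Summable.of_norm_bounded_eventually h2 ?_
    filter_upwards [(finite_singleton (0 : ℤ)).compl_mem_cofinite] with n hn
    have hn : n ≠ 0 := hn
    have hn' : (0 : ℝ) < (n : ℝ) ^ 2 := by positivity
    rw [Real.norm_of_nonneg (by positivity)]
    have hk1 : 1 ≤ k := by
      have := abs_nonneg (s - 1 / 2).re
      have : (1 : ℝ) ≤ k := by linarith
      exact_mod_cast this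
    obtain ⟨h3, h4⟩ := one_le_sq_index (m, ⟨n, hn⟩)
    refine (integral_norm_besselKernel_le (by positivity) (by positivity) hk).trans ?_
    calc _ ≤ (k.factorial : ℝ) * (2 * (z.im ^ (k + 1))⁻¹ *
          ((((m : ℕ) : ℝ) ^ 2)⁻¹ * ((n : ℝ) ^ 2)⁻¹)) := by
          gcongr
          exact besselBound_le h3 h4 hy hk1
      _ = _ := by ring
  set B' : ℤ → ℝ → ℂ := fun n t => (rowPhase m n z * (√z.im : ℂ)) * B n t with hB'
  have hB'int : ∀ n, IntegrableOn (B' n) (Ioi 0) := fun n => (hBint n).const_mul _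
  have hB'sum : Summable fun n => ∫ t in Ioi (0 : ℝ), ‖B' n t‖ := by
    refine (hBsum.mul_left (√z.im)).congr fun n => ?_
    rw [← integral_const_mul]
    refine integral_congr_ae (Eventually.of_forall fun t => ?_)
    simp [hB', norm_rowPhase, abs_of_nonneg (Real.sqrt_nonneg z.im)]
  have hAS := hasSum_integral_of_summable_integral_norm hAint hAsum
  have hBS := hasSum_integral_of_summable_integral_norm hB'int hB'sum
  have hrow : ∀ n, ∫ t in Ioi (0 : ℝ), B' n t = rowTerm m n s z := by
    intro n
    rw [hB', integral_const_mul]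
    rfl
  simp_rw [hrow] at hBS
  refine ⟨hBS.summable, ?_⟩
  rw [← tsum_mul_left, hBS.tsum_eq]
  have : ∀ n : ℤ, gammaFactor s * latticeTerm s z (((m : ℕ) : ℤ), n) =
      ∫ t in Ioi (0 : ℝ), A n t := fun n =>
    gammaFactor_mul_latticeTerm (by linarith) z (((m : ℕ) : ℤ), n) (hN n)
  simp_rw [this]
  rw [hAS.tsum_eq]
  refine setIntegral_congr_fun measurableSet_Ioi fun t ht => ?_
  have ht : 0 < t := ht
  have htc : (t : ℂ) ≠ 0 := by exact_mod_cast ht.ne'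
  simp only [hA, hB', hB, smul_eq_mul]
  rw [tsum_mul_left, tsum_besselKernel_poisson z m ht, ← tsum_mul_left]
  refine tsum_congr fun n => ?_
  have h5 : (t : ℂ) ^ (s - 1 / 2 - 1) = (t : ℂ) ^ (s - 1) * (t : ℂ) ^ (-(1 / 2) : ℂ) := by
    rw [← Complex.cpow_add _ _ htc]; congr 1; ring
  rw [h5]
  ring

/-- At frequency zero the Bessel integral degenerates to a Gamma integral. Summed over `m`, these
terms form the second part of the constant term, with coefficient `Λ(2 s - 1)`. -/
theorem rowTerm_zero {s : ℂ} (hs : 1 < s.re) (z : UpperHalfPlane) (m : ℕ+) :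
    rowTerm m 0 s z = gammaFactor (s - 1 / 2) * (z.im : ℂ) ^ (1 - s) *
      (1 / ((m : ℕ) : ℂ) ^ (2 * s - 1)) := by
  have hm : (0 : ℝ) < ((m : ℕ) : ℝ) := by exact_mod_cast m.pos
  have hmc : ((m : ℕ) : ℂ) ≠ 0 := by exact_mod_cast m.ne_zero
  have hy := z.im_pos
  have hyc : (z.im : ℂ) ≠ 0 := by exact_mod_cast hy.ne'
  have hpi := Real.pi_pos
  have hs' : 0 < (s - 1 / 2).re := by simp; linarith
  have hsq : (√z.im : ℂ) = (z.im : ℂ) ^ (1 / 2 : ℂ) := by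
    rw [Real.sqrt_eq_rpow, Complex.ofReal_cpow hy.le]; norm_num
  unfold rowTerm gammaFactor
  have h0 : Real.pi * ((0 : ℤ) : ℝ) ^ 2 * z.im = 0 := by simp
  rw [h0, besselIntegral_zero_right (by positivity) hs', rowPhase, hsq]
  have h1 : (1 / ((Real.pi * ((m : ℕ) : ℝ) ^ 2 * z.im : ℝ) : ℂ)) ^ (s - 1 / 2) =
      (Real.pi : ℂ) ^ (-(s - 1 / 2)) * (1 / ((m : ℕ) : ℂ) ^ (2 * s - 1)) *
        (z.im : ℂ) ^ (-(s - 1 / 2)) := by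
    rw [one_div, ← Complex.ofReal_inv, mul_inv, mul_inv, Complex.ofReal_mul,
      Complex.mul_cpow_ofReal_nonneg (by positivity) (by positivity), Complex.ofReal_mul,
      Complex.mul_cpow_ofReal_nonneg (by positivity) (by positivity)]
    have h2 : ∀ {r : ℝ}, 0 < r → ((r⁻¹ : ℝ) : ℂ) ^ (s - 1 / 2) = (r : ℂ) ^ (-(s - 1 / 2)) := by
      intro r hr
      rw [Complex.ofReal_inv, Complex.inv_cpow _ _ (by
        rw [Complex.arg_ofReal_of_nonneg hr.le]; exact hpi.ne), Complex.cpow_neg]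
    rw [h2 hpi, h2 hy, h2 (by positivity), sq, Complex.ofReal_mul,
      Complex.mul_cpow_ofReal_nonneg hm.le hm.le, Complex.ofReal_natCast,
      ← Complex.cpow_add _ _ hmc, one_div (((m : ℕ) : ℂ) ^ _), ← Complex.cpow_neg]
    congr 3
    ring
  have h2 : (z.im : ℂ) ^ (1 - s) = (z.im : ℂ) ^ (1 / 2 : ℂ) * (z.im : ℂ) ^ (-(s - 1 / 2)) := by
    rw [← Complex.cpow_add _ _ hyc]; congr 1; ring
  rw [h1, h2]
  simp
  ring

/-- The Fourier expansion of the completed Eisenstein series. -/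
theorem completedZeta_mul_eisenstein {s : ℂ} (hs : 1 < s.re) (z : UpperHalfPlane) :
    completedRiemannZeta (2 * s) * ∑' q, eisensteinTerm s z q =
      completedRiemannZeta (2 * s) * (z.im : ℂ) ^ s +
      completedRiemannZeta (2 * s - 1) * (z.im : ℂ) ^ (1 - s) + fourierPart s z := by
  have h2s : 1 < (2 * s).re := by simp; linarith
  have h2s' : 1 < (2 * (s - 1 / 2)).re := by simp; linarith
  have h2s1 : 1 < (2 * s - 1).re := by simp; linarith
  have hy := z.im_pos
  rw [← gammaFactor_mul_riemannZeta h2s, mul_assoc, zeta_mul_tsum_eisensteinTerm hs,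
    tsum_isPositivePair hs, mul_add, add_assoc]
  congr 1
  · rw [mul_assoc, ← (hasSum_pnat_one_div_cpow h2s).tsum_eq, ← tsum_mul_right]
    congr 1
    refine tsum_congr fun n => ?_
    have : ((0 : ℤ), ((n : ℕ) : ℤ)) = scalePair n (0, 1) := by simp [scalePair]
    rw [this, latticeTerm_scalePair]
    congr 1
    simp [latticeTerm]
  · have hsum : Summable fun x : ℕ+ × ℤ => latticeTerm s z (((x.1 : ℕ) : ℤ), x.2) := by
      refine (summable_norm_latticeTerm hs z).of_norm.comp_injective
        (i := fun x : ℕ+ × ℤ => (((x.1 : ℕ) : ℤ), x.2)) ?_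
      rintro ⟨a, b⟩ ⟨c, d⟩ h
      simpa using h
    have hrow := tsum_latticeTerm_row hs z
    have hf : Summable fun p : FourierIndex => fourierTerm p s z :=
      (summable_norm_fourierTerm s z).of_norm
    rw [hsum.tsum_prod, ← tsum_mul_left]
    have hsplit : ∀ m : ℕ+, gammaFactor s * ∑' n : ℤ, latticeTerm s z (((m : ℕ) : ℤ), n) =
        rowTerm m 0 s z + ∑' n : {n : ℤ // n ≠ 0}, fourierTerm (m, n) s z := by
      intro m
      rw [(hrow m).2, ← (hrow m).1.tsum_subtype_add_tsum_subtype_compl {0},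
        tsum_singleton (0 : ℤ) (fun n => rowTerm m n s z)]
      rfl
    simp_rw [hsplit, rowTerm_zero hs]
    have hz := hasSum_pnat_one_div_cpow h2s1
    rw [Summable.tsum_add (hz.summable.mul_left _) hf.prod, tsum_mul_left, hz.tsum_eq,
      ← hf.tsum_prod, fourierPart]
    congr 1
    have h3 : 2 * s - 1 = 2 * (s - 1 / 2) := by ring
    rw [h3, ← gammaFactor_mul_riemannZeta h2s']
    ring

/-! ### Meromorphic continuation -/

/-- The entire function `s (s - 1) Λ(s)`. -/
def xi (s : ℂ) : ℂ := s * (s - 1) * completedRiemannZeta₀ s + 1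

theorem differentiable_xi : Differentiable ℂ xi := by
  have := differentiable_completedZeta₀
  unfold xi
  fun_prop

theorem xi_eq {s : ℂ} (h0 : s ≠ 0) (h1 : s ≠ 1) : xi s = s * (s - 1) * completedRiemannZeta s := by
  have h1' : 1 - s ≠ 0 := sub_ne_zero.mpr h1.symm
  rw [xi, completedRiemannZeta_eq]
  field_simp
  ring

theorem xi_one : xi 1 = 1 := by simp [xi]

/-- Nonvanishing of zeta up to the edge `Re s = 1`, where the prefactor cancels the pole at 1. The
edge is needed for parameters with real part exactly `1 / 2`. -/
theorem xi_ne_zero {s : ℂ} (hs : 1 ≤ s.re) : xi s ≠ 0 := by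
  by_cases h1 : s = 1
  · rw [h1, xi_one]; exact one_ne_zero
  have h0 : s ≠ 0 := by rintro rfl; simp at hs; linarith
  rw [xi_eq h0 h1]
  have hz := riemannZeta_ne_zero_of_one_le_re hs
  rw [riemannZeta_def_of_ne_zero h0] at hz
  exact mul_ne_zero (mul_ne_zero h0 (sub_ne_zero.mpr h1)) fun h => hz (by rw [h, zero_div])

/-- The points where `c_s` and `E_s` are visibly regular. -/
def regularSet : Set ℂ := {s | s ≠ 1 ∧ xi (2 * s) ≠ 0}

theorem mem_regularSet {s : ℂ} (hs : 1 / 2 ≤ s.re) (h1 : s ≠ 1) : s ∈ regularSet :=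
  ⟨h1, xi_ne_zero (by simp; linarith)⟩

theorem isOpen_regularSet : IsOpen regularSet :=
  isOpen_ne.inter (isOpen_ne.preimage (differentiable_xi.continuous.comp (by fun_prop)))

/-- The zeros of a nonzero entire function are isolated, hence countable. Countability suffices for
continuation, since the complement of a countable set in the plane is connected. -/
theorem countable_compl_regularSet : regularSetᶜ.Countable := by
  have hd : Differentiable ℂ fun s : ℂ => xi (2 * s) :=
    differentiable_xi.comp (differentiable_id.const_mul 2)
  have han : AnalyticOnNhd ℂ (fun s : ℂ => xi (2 * s)) univ := fun s _ => hd.analyticAt s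
  have h0 : (fun s : ℂ => xi (2 * s)) ⁻¹' {0}ᶜ ∈ codiscreteWithin univ :=
    han.preimage_zero_mem_codiscrete (x := 1) (xi_ne_zero (by norm_num))
  have h1 : ((fun s : ℂ => xi (2 * s)) ⁻¹' {0}).Countable := by
    have := (HereditarilyLindelofSpace.isLindelof _).countable_of_isDiscrete
      (isDiscrete_of_codiscreteWithin (s := (fun s : ℂ => xi (2 * s)) ⁻¹' {0}) (U := univ)
        (by rwa [← preimage_compl]))
    simpa using this
  refine (h1.union (countable_singleton 1)).mono fun s hs => ?_
  simp only [regularSet, mem_compl_iff, mem_ofPred_eq, not_and_or, not_not] at hs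
  rcases hs with h | h
  · exact Or.inr h
  · exact Or.inl h

theorem isPreconnected_regularSet_diff {A : Set ℂ} (hA : A.Countable) :
    IsPreconnected (regularSet \ A) := by
  have h := (countable_compl_regularSet.union hA).isConnected_compl_of_one_lt_rank
    (E := ℂ) (by simp)
  have e : (regularSetᶜ ∪ A)ᶜ = regularSet \ A := by
    rw [compl_union, compl_compl]; rfl
  rw [← e]
  exact h.isPreconnected

/-- The function `s xi(2 s - 1) / ((s - 1) xi(2 s))`, which agrees with `c_s`. -/
def scattering (s : ℂ) : ℂ := s * xi (2 * s - 1) / ((s - 1) * xi (2 * s))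

/-- The constant term `y ^ s + c_s y ^ (1 - s)` of `E_s`. -/
def constantTerm (s : ℂ) (y : ℝ) : ℂ := (y : ℂ) ^ s + scattering s * (y : ℂ) ^ (1 - s)

/-- The difference of `E_s` and its constant term. -/
def remainder (s : ℂ) (z : UpperHalfPlane) : ℂ :=
  2 * s * (2 * s - 1) / xi (2 * s) * fourierPart s z

/-- The Fourier expansion of `E_s`. -/
def eisensteinExpansion (s : ℂ) (z : UpperHalfPlane) : ℂ :=
  constantTerm s z.im + remainder s z

theorem differentiableOn_scattering : DifferentiableOn ℂ scattering regularSet := by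
  intro s hs
  have h1 : s - 1 ≠ 0 := sub_ne_zero.mpr hs.1
  have h2 := hs.2
  refine DifferentiableAt.differentiableWithinAt ?_
  have hd : ∀ w, DifferentiableAt ℂ xi w := differentiable_xi
  unfold scattering
  refine DifferentiableAt.div ?_ ?_ (mul_ne_zero h1 h2)
  · exact differentiableAt_id.mul ((hd _).comp s (by fun_prop))
  · exact DifferentiableAt.mul (by fun_prop) ((hd _).comp s (by fun_prop))

theorem analyticAt_scattering {s : ℂ} (hs : s ∈ regularSet) : AnalyticAt ℂ scattering s :=
  differentiableOn_scattering.analyticAt (isOpen_regularSet.mem_nhds hs)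

theorem meromorphic_xi_comp {f : ℂ → ℂ} (hf : Differentiable ℂ f) :
    Meromorphic fun s => xi (f s) := fun s =>
  ((differentiable_xi.comp hf).analyticAt s).meromorphicAt

theorem meromorphic_scattering : Meromorphic scattering := by
  have h1 := meromorphic_xi_comp (f := fun s => 2 * s - 1) (by fun_prop)
  have h2 := meromorphic_xi_comp (f := fun s => 2 * s) (by fun_prop)
  have h3 : ∀ c, Meromorphic fun s : ℂ => s - c := fun c s =>
    (MeromorphicAt.id s).sub (MeromorphicAt.const c s)
  intro s
  exact ((MeromorphicAt.id s).mul (h1 s)).div ((h3 1 s).mul (h2 s))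

theorem differentiable_ofReal_cpow {y : ℝ} (hy : 0 < y) {f : ℂ → ℂ} (hf : Differentiable ℂ f) :
    Differentiable ℂ fun s => (y : ℂ) ^ f s := fun s =>
  (hf s).const_cpow (Or.inl (by exact_mod_cast hy.ne'))

theorem differentiableOn_constantTerm {y : ℝ} (hy : 0 < y) :
    DifferentiableOn ℂ (fun s => constantTerm s y) regularSet :=
  (differentiable_ofReal_cpow hy differentiable_id).differentiableOn.add
    (differentiableOn_scattering.mul
      (differentiable_ofReal_cpow hy (by fun_prop)).differentiableOn)

theorem differentiableOn_remainder (z : UpperHalfPlane) :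
    DifferentiableOn ℂ (fun s => remainder s z) {s | xi (2 * s) ≠ 0} := by
  refine DifferentiableOn.mul ?_ (differentiable_fourierPart z).differentiableOn
  refine DifferentiableOn.div (by fun_prop) ?_ fun s hs => hs
  exact (differentiable_xi.comp (by fun_prop)).differentiableOn

theorem differentiableOn_eisensteinExpansion (z : UpperHalfPlane) :
    DifferentiableOn ℂ (fun s => eisensteinExpansion s z) regularSet :=
  (differentiableOn_constantTerm z.im_pos).add
    ((differentiableOn_remainder z).mono fun _ hs => hs.2)

theorem analyticAt_eisensteinExpansion {s : ℂ} (hs : s ∈ regularSet) (z : UpperHalfPlane) :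
    AnalyticAt ℂ (fun s => eisensteinExpansion s z) s :=
  (differentiableOn_eisensteinExpansion z).analyticAt (isOpen_regularSet.mem_nhds hs)

theorem meromorphic_eisensteinExpansion (z : UpperHalfPlane) :
    Meromorphic fun s => eisensteinExpansion s z := by
  have h1 := meromorphic_scattering
  have h2 := meromorphic_xi_comp (f := fun s => 2 * s) (by fun_prop)
  have h3 : Meromorphic fun s : ℂ => (z.im : ℂ) ^ s := fun s =>
    ((differentiable_ofReal_cpow z.im_pos differentiable_id).analyticAt s).meromorphicAt
  have h4 : Meromorphic fun s : ℂ => (z.im : ℂ) ^ (1 - s) := fun s =>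
    ((differentiable_ofReal_cpow z.im_pos (f := fun s => 1 - s)
      (by fun_prop)).analyticAt s).meromorphicAt
  have h5 : Meromorphic fun s => fourierPart s z := fun s =>
    ((differentiable_fourierPart z).analyticAt s).meromorphicAt
  have h6 : Meromorphic fun s : ℂ => 2 * s * (2 * s - 1) := fun s =>
    (Differentiable.analyticAt (f := fun s : ℂ => 2 * s * (2 * s - 1)) (by fun_prop)
      s).meromorphicAt
  intro s
  exact ((h3 s).add ((h1 s).mul (h4 s))).add (((h6 s).div (h2 s)).mul (h5 s))

theorem eisensteinSeries_eq {s : ℂ} (hs : 1 < s.re) (z : UpperHalfPlane) :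
    eisensteinSeries s ⟦z⟧ = eisensteinExpansion s z := by
  have h := completedZeta_mul_eisenstein hs z
  have h2s : 1 < (2 * s).re := by simp; linarith
  have h0 : 2 * s ≠ 0 := by intro h; rw [h] at h2s; simp at h2s; linarith
  have h1 : 2 * s ≠ 1 := by intro h; rw [h] at h2s; simp at h2s
  have h2 : 2 * s - 1 ≠ 0 := sub_ne_zero.mpr h1
  have hs0 : s ≠ 0 := right_ne_zero_of_mul h0
  have hs1 : s - 1 ≠ 0 := by intro h; rw [sub_eq_zero.mp h] at hs; simp at hs
  have h3 : 2 * s - 1 ≠ 1 := by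
    intro h; apply hs1; linear_combination h / 2
  have hx : xi (2 * s) ≠ 0 := xi_ne_zero h2s.le
  have hx1 := xi_eq h0 h1
  have hx2 := xi_eq h2 h3
  have hL : completedRiemannZeta (2 * s) ≠ 0 := by
    intro h; rw [h, mul_zero] at hx1; exact hx hx1
  change ∑' q, eisensteinTerm s z q = _
  apply mul_left_cancel₀ hL
  rw [h, eisensteinExpansion, constantTerm, remainder, scattering, hx1, hx2]
  have h4 : 2 * s - 1 - 1 = 2 * (s - 1) := by ring
  rw [h4]
  field_simp

/-- A meromorphic function in normal form that agrees with `f` on a nonempty open set agrees with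
`f` wherever `f` is analytic. -/
theorem eq_of_meromorphicNFOn {f g : ℂ → ℂ} {V : Set ℂ} (hV : IsOpen V) {v : ℂ} (hv : v ∈ V)
    (hg : MeromorphicNFOn g univ) (hf : Meromorphic f) (h : ∀ w ∈ V, g w = f w) {s : ℂ}
    (hs : AnalyticAt ℂ f s) : g s = f s := by
  have hm : MeromorphicOn (g - f) univ := hg.meromorphicOn.sub hf.meromorphicOn
  -- The identity theorem in terms of orders: the order of `g - f` is infinite at `v`, hence at
  -- every point of the connected plane.
  have htop : meromorphicOrderAt (g - f) s = ⊤ := by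
    by_contra hne
    refine hm.meromorphicOrderAt_ne_top_of_isPreconnected isPreconnected_univ (mem_univ s)
      (mem_univ v) hne (meromorphicOrderAt_eq_top_iff.mpr ?_)
    filter_upwards [mem_nhdsWithin_of_mem_nhds (hV.mem_nhds hv)] with w hw
    simp [h w hw]
  have heq : g =ᶠ[𝓝[≠] s] f := by
    filter_upwards [meromorphicOrderAt_eq_top_iff.mp htop] with w hw
    exact sub_eq_zero.mp hw
  exact (((hg (mem_univ s)).eventuallyEq_nhdsNE_iff_eventuallyEq_nhds
    hs.meromorphicNFAt).mp heq).eq_of_nhds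

/-- `eisenstein` is a chosen continuation. The normal form of the expansion shows that one exists,
and uniqueness then fixes the value of any choice wherever the expansion is analytic. -/
theorem eisenstein_eq {s : ℂ} (hs : s ∈ regularSet) (z : UpperHalfPlane) :
    eisenstein s ⟦z⟧ = eisensteinExpansion s z := by
  have hV : IsOpen {w : ℂ | 1 < w.re} := isOpen_lt continuous_const Complex.continuous_re
  have hreg : ∀ w : ℂ, 1 < w.re → w ∈ regularSet := fun w hw =>
    mem_regularSet (by linarith) (by rintro rfl; simp at hw)
  have hmer := meromorphic_eisensteinExpansion z
  have hex : ∃ g : ℂ → ℂ, MeromorphicNFOn g univ ∧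
      EqOn g (fun w => eisensteinSeries w ⟦z⟧) {w : ℂ | 1 < w.re} := by
    refine ⟨_, meromorphicNFOn_toMeromorphicNFOn (fun s => eisensteinExpansion s z) univ,
      fun w hw => ?_⟩
    have hw : 1 < w.re := hw
    simp only
    rw [eisensteinSeries_eq hw, toMeromorphicNFOn_eq_toMeromorphicNFAt hmer.meromorphicOn
      (mem_univ w), toMeromorphicNFAt_eq_self.mpr
      (analyticAt_eisensteinExpansion (hreg w hw) z).meromorphicNFAt]
  unfold eisenstein continuation
  rw [dif_pos hex]
  refine eq_of_meromorphicNFOn hV (v := 2) (by simp) hex.choose_spec.1 hmer (fun w hw => ?_)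
    (analyticAt_eisensteinExpansion hs z)
  rw [hex.choose_spec.2 hw]
  exact eisensteinSeries_eq hw z

theorem scattering_eq_div {s : ℂ} (h0 : s ≠ 0) (h1 : s ≠ 1) (h2 : s ≠ 1 / 2) :
    completedRiemannZeta (2 - 2 * s) / completedRiemannZeta (2 * s) = scattering s := by
  have e0 : 2 * s ≠ 0 := mul_ne_zero two_ne_zero h0
  have e1 : 2 * s ≠ 1 := fun h => h2 (by linear_combination h / 2)
  have e2 : 2 * s - 1 ≠ 0 := sub_ne_zero.mpr e1
  have e3 : 2 * s - 1 ≠ 1 := fun h => h1 (by linear_combination h / 2)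
  have e4 : s - 1 ≠ 0 := sub_ne_zero.mpr h1
  have : completedRiemannZeta (2 - 2 * s) = completedRiemannZeta (2 * s - 1) := by
    rw [← completedRiemannZeta_one_sub]; congr 1; ring
  rw [this, scattering, xi_eq e0 e1, xi_eq e2 e3]
  have h4 : 2 * s - 1 - 1 = 2 * (s - 1) := by ring
  rw [h4]
  -- At a zero of the denominator both sides are 0 by the convention for division.
  by_cases hL : completedRiemannZeta (2 * s) = 0
  · simp [hL]
  · field_simp

/-- Near any point the quotient of zeta values agrees with `scattering` off that point, and two
functions in normal form that agree on a punctured neighbourhood agree on a full one. The full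
neighbourhood is what identifies the derivatives as well. -/
theorem scatteringCoeff_eventuallyEq {s : ℂ} (hs : s ∈ regularSet) :
    scatteringCoeff =ᶠ[𝓝 s] scattering := by
  have hne : ∀ x, (fun s : ℂ => completedRiemannZeta (2 - 2 * s) / completedRiemannZeta (2 * s))
      =ᶠ[𝓝[≠] x] scattering := by
    intro x
    have hfin : ({0, 1, 1 / 2} : Set ℂ).Finite := toFinite _
    have : ∀ᶠ w in 𝓝[≠] x, w ∉ ({0, 1, 1 / 2} : Set ℂ) := by
      have h1 : (({0, 1, 1 / 2} : Set ℂ) \ {x})ᶜ ∈ 𝓝 x :=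
        ((hfin.subset sdiff_subset).isClosed.isOpen_compl).mem_nhds (by simp)
      filter_upwards [mem_nhdsWithin_of_mem_nhds h1, self_mem_nhdsWithin] with w hw hw' hmem
      exact hw ⟨hmem, hw'⟩
    filter_upwards [this] with w hw
    simp only [mem_insert_iff, mem_singleton_iff, not_or] at hw
    exact scattering_eq_div hw.1 hw.2.1 hw.2.2
  have hmer : MeromorphicOn (fun s : ℂ => completedRiemannZeta (2 - 2 * s) /
      completedRiemannZeta (2 * s)) univ := fun x _ =>
    (meromorphic_scattering x).congr (hne x).symm
  have hnf := meromorphicNFOn_toMeromorphicNFOn (fun s : ℂ => completedRiemannZeta (2 - 2 * s) /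
      completedRiemannZeta (2 * s)) univ (mem_univ s)
  exact (hnf.eventuallyEq_nhdsNE_iff_eventuallyEq_nhds
    (analyticAt_scattering hs).meromorphicNFAt).mp
    ((hmer.toMeromorphicNFOn_eq_self_on_nhdsNE (mem_univ s)).trans (hne s))

theorem scatteringCoeff_eq {s : ℂ} (hs : s ∈ regularSet) : scatteringCoeff s = scattering s :=
  (scatteringCoeff_eventuallyEq hs).eq_of_nhds

theorem deriv_scatteringCoeff_eq {s : ℂ} (hs : s ∈ regularSet) :
    deriv scatteringCoeff s = deriv scattering s :=
  (scatteringCoeff_eventuallyEq hs).deriv_eq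

/-! ### The invariant measure in coordinates -/

/-- The density `1 / y ^ 2`. -/
def heightDensity (y : ℝ) : NNReal := (1 / ‖y‖₊) ^ 2

/-- The measure `dy / y ^ 2` on the positive reals. -/
def heightMeasure : Measure ℝ :=
  (volume.restrict (Ioi 0)).withDensity fun y => (heightDensity y : ENNReal)

theorem measurable_heightDensity : Measurable heightDensity := by
  unfold heightDensity
  fun_prop

instance : SFinite heightMeasure := by
  unfold heightMeasure
  infer_instance

theorem coe_heightDensity (y : ℝ) : (heightDensity y : ℝ) = 1 / y ^ 2 := by
  simp [heightDensity]

/-- The point `x + i y` of the upper half plane (for `y > 0`). -/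
def pairPoint (p : ℝ × ℝ) : UpperHalfPlane :=
  UpperHalfPlane.ofComplex (Complex.measurableEquivRealProd.symm p)

theorem coe_pairPoint {p : ℝ × ℝ} (hp : 0 < p.2) :
    (pairPoint p : ℂ) = Complex.measurableEquivRealProd.symm p := by
  have : 0 < (Complex.measurableEquivRealProd.symm p).im := by
    simpa [Complex.measurableEquivRealProd_symm_apply] using hp
  rw [pairPoint, UpperHalfPlane.ofComplex_apply_of_im_pos this]

theorem re_pairPoint {p : ℝ × ℝ} (hp : 0 < p.2) : (pairPoint p).re = p.1 := by
  rw [← UpperHalfPlane.coe_re, coe_pairPoint hp, Complex.measurableEquivRealProd_symm_apply]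

theorem im_pairPoint {p : ℝ × ℝ} (hp : 0 < p.2) : (pairPoint p).im = p.2 := by
  rw [← UpperHalfPlane.coe_im, coe_pairPoint hp, Complex.measurableEquivRealProd_symm_apply]

theorem measurable_ofComplex : Measurable UpperHalfPlane.ofComplex := by
  classical
  rw [← UpperHalfPlane.measurableEmbedding_coe.measurable_comp_iff]
  have : (UpperHalfPlane.coe ∘ UpperHalfPlane.ofComplex : ℂ → ℂ) = fun w =>
      if 0 < w.im then w else ((Classical.choice inferInstance : UpperHalfPlane) : ℂ) := by
    funext w
    rw [Function.comp_apply, UpperHalfPlane.ofComplex_apply_eq_ite]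
    split_ifs <;> rfl
  rw [this]
  exact Measurable.ite (measurableSet_lt measurable_const Complex.measurable_im) measurable_id
    measurable_const

theorem measurable_pairPoint : Measurable pairPoint :=
  measurable_ofComplex.comp Complex.measurableEquivRealProd.symm.measurable

theorem prod_heightMeasure : (volume : Measure ℝ).prod heightMeasure =
    (volume.restrict (univ ×ˢ Ioi (0 : ℝ))).withDensity
      fun p : ℝ × ℝ => (heightDensity p.2 : ENNReal) := by
  have h : Measurable fun y => (heightDensity y : ENNReal) :=
    measurable_heightDensity.coe_nnreal_ennreal
  rw [heightMeasure, prod_withDensity_right h, Measure.volume_eq_prod, ← Measure.prod_restrict,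
    Measure.restrict_univ]

theorem measurePreserving_pairPoint :
    MeasurePreserving pairPoint ((volume : Measure ℝ).prod heightMeasure) volume := by
  refine ⟨measurable_pairPoint, Measure.ext fun s hs => ?_⟩
  have hs' : MeasurableSet (UpperHalfPlane.coe '' s) :=
    UpperHalfPlane.measurableEmbedding_coe.measurableSet_image.mpr hs
  rw [Measure.map_apply measurable_pairPoint hs, prod_heightMeasure,
    withDensity_apply _ (measurable_pairPoint hs), Measure.restrict_restrict
      (measurable_pairPoint hs), UpperHalfPlane.volume_eq_lintegral]
  have e : pairPoint ⁻¹' s ∩ univ ×ˢ Ioi (0 : ℝ) =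
      Complex.measurableEquivRealProd.symm ⁻¹' (UpperHalfPlane.coe '' s) := by
    ext p
    simp only [mem_inter_iff, mem_preimage, mem_prod, mem_univ, true_and, mem_Ioi, mem_image]
    constructor
    · rintro ⟨h, hp⟩
      exact ⟨_, h, coe_pairPoint hp⟩
    · rintro ⟨z, hz, h⟩
      have hp : 0 < p.2 := by
        have := z.im_pos
        rw [← UpperHalfPlane.coe_im, h] at this
        simpa [Complex.measurableEquivRealProd_symm_apply] using this
      have : pairPoint p = z := UpperHalfPlane.ext (by rw [coe_pairPoint hp, h])
      exact ⟨this ▸ hz, hp⟩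
  rw [e, ← Complex.volume_preserving_equiv_real_prod.symm.setLIntegral_comp_preimage hs'
    (by fun_prop)]
  -- `heightDensity` is spelled like the density of `volume` on the upper half plane, so the
  -- integrands agree definitionally.
  rfl

/-- The rectangle `{x + i y | x ∈ A, y ∈ J}`. -/
def rectangle (A J : Set ℝ) : Set UpperHalfPlane := {z | z.re ∈ A ∧ z.im ∈ J}

theorem measurableSet_rectangle {A J : Set ℝ} (hA : MeasurableSet A) (hJ : MeasurableSet J) :
    MeasurableSet (rectangle A J) :=
  (UpperHalfPlane.continuous_re.measurable hA).inter (UpperHalfPlane.continuous_im.measurable hJ)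

theorem measurePreserving_rectangle {A J : Set ℝ} (hA : MeasurableSet A) (hJ : MeasurableSet J) :
    MeasurePreserving pairPoint ((volume.restrict A).prod (heightMeasure.restrict J))
      (volume.restrict (rectangle A J)) := by
  have h := measurePreserving_pairPoint.restrict_preimage (measurableSet_rectangle hA hJ)
  rw [Measure.prod_restrict]
  -- `pairPoint` has meaningful coordinates only for `y > 0`, so the preimage of the rectangle is `A
  -- ×ˢ J` only up to a null set.
  have hae : ∀ᵐ p : ℝ × ℝ ∂((volume : Measure ℝ).prod heightMeasure), 0 < p.2 := by
    rw [prod_heightMeasure]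
    refine (withDensity_absolutelyContinuous _ _).ae_le ?_
    filter_upwards [ae_restrict_mem (MeasurableSet.univ.prod measurableSet_Ioi)] with p hp
    exact hp.2
  rwa [Measure.restrict_congr_set (t := A ×ˢ J)] at h
  filter_upwards [hae] with p hp
  apply propext
  change ((pairPoint p).re ∈ A ∧ (pairPoint p).im ∈ J) ↔ (p.1 ∈ A ∧ p.2 ∈ J)
  rw [re_pairPoint hp, im_pairPoint hp]

theorem restrict_heightMeasure {J : Set ℝ} (hJ : MeasurableSet J) (hJ0 : J ⊆ Ioi 0) :
    heightMeasure.restrict J =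
      (volume.restrict J).withDensity fun y => (heightDensity y : ENNReal) := by
  rw [heightMeasure, restrict_withDensity hJ, Measure.restrict_restrict hJ,
    inter_eq_self_of_subset_left hJ0]

theorem setIntegral_heightMeasure {J : Set ℝ} (hJ : MeasurableSet J) (hJ0 : J ⊆ Ioi 0)
    (φ : ℝ → ℂ) : ∫ y in J, φ y ∂heightMeasure = ∫ y in J, (1 / y ^ 2 : ℝ) * φ y := by
  rw [restrict_heightMeasure hJ hJ0, integral_withDensity_eq_integral_smul
    measurable_heightDensity]
  refine integral_congr_ae (Eventually.of_forall fun y => ?_)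
  simp only [NNReal.smul_def, coe_heightDensity, Complex.real_smul]

theorem integrableOn_heightMeasure_iff {J : Set ℝ} (hJ : MeasurableSet J) (hJ0 : J ⊆ Ioi 0)
    {φ : ℝ → ℂ} : IntegrableOn φ J heightMeasure ↔
      IntegrableOn (fun y => (1 / y ^ 2 : ℝ) * φ y) J := by
  rw [IntegrableOn, restrict_heightMeasure hJ hJ0,
    integrable_withDensity_iff_integrable_smul measurable_heightDensity]
  refine integrable_congr (Eventually.of_forall fun y => ?_)
  simp only [NNReal.smul_def, coe_heightDensity, Complex.real_smul]

/-- Fubini on a rectangle. -/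
theorem setIntegral_rectangle {A J : Set ℝ} (hA : MeasurableSet A) (hJ : MeasurableSet J)
    {f : UpperHalfPlane → ℂ} (hf : IntegrableOn f (rectangle A J)) :
    ∫ z in rectangle A J, f z = ∫ y in J, (∫ x in A, f (pairPoint (x, y))) ∂heightMeasure := by
  have h := measurePreserving_rectangle hA hJ
  rw [← h.map_eq, integral_map h.measurable.aemeasurable (h.map_eq ▸ hf.1), integral_prod_symm]
  exact h.integrable_comp_of_integrable hf

theorem integrableOn_rectangle_im {A J : Set ℝ} (hA : MeasurableSet A) (hJ : MeasurableSet J)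
    (hJ0 : J ⊆ Ioi 0) (hA' : volume A ≠ ⊤) {φ : ℝ → ℂ}
    (hφ : IntegrableOn (fun y => (1 / y ^ 2 : ℝ) * φ y) J) (hm : Measurable φ) :
    IntegrableOn (fun z => φ z.im) (rectangle A J) := by
  have h := measurePreserving_rectangle hA hJ
  have : IsFiniteMeasure (volume.restrict A) := isFiniteMeasure_restrict.mpr hA'
  have h1 := ((integrableOn_heightMeasure_iff hJ hJ0).mpr hφ).integrable.comp_snd
    (volume.restrict A)
  refine (h.integrable_comp
    (hm.comp UpperHalfPlane.continuous_im.measurable).aestronglyMeasurable).mp ?_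
  refine h1.congr ?_
  have hae : ∀ᵐ p : ℝ × ℝ ∂((volume.restrict A).prod (heightMeasure.restrict J)), p.2 ∈ J :=
    Measure.quasiMeasurePreserving_snd.ae (ae_restrict_mem hJ)
  filter_upwards [hae] with p hp
  simp [im_pairPoint (hJ0 hp)]

theorem setIntegral_rectangle_im {A J : Set ℝ} (hA : MeasurableSet A) (hJ : MeasurableSet J)
    (hJ0 : J ⊆ Ioi 0) (hA' : volume A = 1) {φ : ℝ → ℂ}
    (hφ : IntegrableOn (fun y => (1 / y ^ 2 : ℝ) * φ y) J) (hm : Measurable φ) :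
    ∫ z in rectangle A J, φ z.im = ∫ y in J, (1 / y ^ 2 : ℝ) * φ y := by
  rw [setIntegral_rectangle hA hJ (integrableOn_rectangle_im hA hJ hJ0 (by simp [hA']) hφ hm),
    ← setIntegral_heightMeasure hJ hJ0]
  refine setIntegral_congr_fun hJ fun y hy => ?_
  have : ∀ x : ℝ, (pairPoint (x, y)).im = y := fun x => im_pairPoint (hJ0 hy)
  simp [this, measureReal_def, hA']

/-! ### The modular group and the standard fundamental domain -/

instance : Countable SL(2, ℤ) :=
  Function.Injective.countable (f := fun (γ : SL(2, ℤ)) (i j : Fin 2) => γ i j) fun _ _ h =>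
    Matrix.SpecialLinearGroup.ext _ _ fun i j => congrFun (congrFun h i) j

theorem measurePreserving_smul_modular (γ : SL(2, ℤ)) :
    MeasurePreserving (fun z : UpperHalfPlane => γ • z) volume volume := by
  have h := measurePreserving_smul (Matrix.SpecialLinearGroup.toGL
    (Matrix.SpecialLinearGroup.map (Int.castRingHom ℝ) γ)) (volume : Measure UpperHalfPlane)
  exact h

theorem measurable_smul_modular (γ : SL(2, ℤ)) :
    Measurable fun z : UpperHalfPlane => γ • z :=
  (measurePreserving_smul_modular γ).measurable

theorem measurableSet_fd : MeasurableSet ModularGroup.fd := ModularGroup.isClosed_fd.measurableSet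

theorem volume_fd_diff_fdo : volume (ModularGroup.fd \ ModularGroup.fdo) = 0 := by
  rw [UpperHalfPlane.volume_eq_lintegral]
  refine setLIntegral_measure_zero _ _ ?_
  have hsub : UpperHalfPlane.coe '' (ModularGroup.fd \ ModularGroup.fdo) ⊆
      (Metric.sphere (0 : ℂ) 1) ∪ (Complex.measurableEquivRealProd ⁻¹' ({1 / 2} ×ˢ univ) ∪
        Complex.measurableEquivRealProd ⁻¹' ({-(1 / 2)} ×ˢ univ)) := by
    rintro _ ⟨z, ⟨⟨h1, h2⟩, h3⟩, rfl⟩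
    by_cases h : Complex.normSq (z : ℂ) = 1
    · left
      rw [Complex.normSq_eq_norm_sq] at h
      rw [mem_sphere_zero_iff_norm]
      exact (pow_eq_one_iff_of_nonneg (norm_nonneg _) two_ne_zero).mp h
    · right
      have h4 : ¬ |z.re| < 1 / 2 := fun h' => h3 ⟨lt_of_le_of_ne h1 (Ne.symm h), h'⟩
      have h5 : |z.re| = 1 / 2 := le_antisymm h2 (not_lt.mp h4)
      rcases (abs_eq (by norm_num)).mp h5 with h | h
      · left; simp [Complex.measurableEquivRealProd_apply, h]
      · right; simp [Complex.measurableEquivRealProd_apply, h]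
  refine measure_mono_null hsub (measure_union_null ?_ (measure_union_null ?_ ?_))
  · exact Measure.addHaar_sphere _ _ _
  all_goals
    rw [Complex.volume_preserving_equiv_real_prod.measure_preimage
      ((measurableSet_singleton _).prod MeasurableSet.univ).nullMeasurableSet,
      Measure.volume_eq_prod, Measure.prod_prod]
    simp

/-- Off the countably many translates of the boundary of the fundamental domain, exactly two group
elements, differing by the sign `-1`, carry `w` into it. The general `E` serves both for the
integrals and for the extended nonnegative norms. -/
theorem sum_indicator_fd_ae {E : Type*} [AddCommMonoid E] [TopologicalSpace E] (c : UpperHalfPlane → E) :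
    ∀ᵐ w : UpperHalfPlane, HasSum
      (fun γ : SL(2, ℤ) => ModularGroup.fd.indicator (fun _ => c w) (γ⁻¹ • w)) (2 • c w) := by
  have hnull : ∀ g : SL(2, ℤ), ∀ᵐ w : UpperHalfPlane,
      g • w ∉ ModularGroup.fd \ ModularGroup.fdo := fun g =>
    measure_eq_zero_iff_ae_notMem.mp
      ((measurePreserving_smul_modular g).quasiMeasurePreserving.preimage_null volume_fd_diff_fdo)
  filter_upwards [ae_all_iff.mpr hnull] with w hw
  obtain ⟨g, hg⟩ := ModularGroup.exists_smul_mem_fd w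
  have hgo : g • w ∈ ModularGroup.fdo := by
    by_contra h
    exact hw g ⟨hg, h⟩
  have hne : g⁻¹ ≠ (-g)⁻¹ := by
    intro h
    have h1 : g = -g := inv_injective h
    have h2 := congrArg (fun γ : SL(2, ℤ) => bottomRow γ) h1
    have h3 : bottomRow (-g) = - bottomRow g := by simp [bottomRow]
    simp only [h3] at h2
    exact bottomRow_ne_zero g (self_eq_neg.mp h2)
  have hval : ∀ γ ∈ ({g⁻¹, (-g)⁻¹} : Finset SL(2, ℤ)),
      ModularGroup.fd.indicator (fun _ => c w) (γ⁻¹ • w) = c w := by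
    intro γ hγ
    rw [Finset.mem_insert, Finset.mem_singleton] at hγ
    rcases hγ with rfl | rfl
    · rw [inv_inv, indicator_of_mem hg]
    · rw [inv_inv, ModularGroup.SL_neg_smul, indicator_of_mem hg]
  have hsum : ∑ γ ∈ ({g⁻¹, (-g)⁻¹} : Finset SL(2, ℤ)),
      ModularGroup.fd.indicator (fun _ => c w) (γ⁻¹ • w) = 2 • c w := by
    rw [Finset.sum_congr rfl hval, Finset.sum_const, Finset.card_pair hne]
  rw [← hsum]
  refine hasSum_sum_of_ne_finset_zero fun γ hγ => ?_
  refine indicator_of_notMem (fun hmem => hγ ?_) _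
  have h1 : (γ⁻¹ * g⁻¹) • (g • w) ∈ ModularGroup.fd := by
    rwa [smul_smul, inv_mul_cancel_right]
  rw [Finset.mem_insert, Finset.mem_singleton]
  rcases ModularGroup.eq_one_or_neg_one_of_mem_fdo_mem_fd hgo h1 with h | h
  · left
    rw [mul_inv_eq_one] at h
    rw [← h, inv_inv]
  · right
    rw [← inv_inv γ]
    congr 1
    rw [← inv_mul_cancel_right γ⁻¹ g, h, neg_one_mul]

/-! ### Unfolding -/

/-- The strip `-1/2 < Re z ≤ 1/2`, a fundamental domain for the integral translations. -/
def strip : Set UpperHalfPlane := rectangle (Ioc (-(1 / 2)) (1 / 2)) (Ioi 0)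

theorem measurableSet_strip : MeasurableSet strip :=
  measurableSet_rectangle measurableSet_Ioc measurableSet_Ioi

theorem mem_strip_iff (z : UpperHalfPlane) : z ∈ strip ↔ z.re ∈ Ioc (-(1 / 2) : ℝ) (1 / 2) :=
  ⟨fun h => h.1, fun h => ⟨h, z.im_pos⟩⟩

theorem existsUnique_T_zpow_smul_mem_strip (z : UpperHalfPlane) :
    ∃! n : ℤ, ModularGroup.T ^ n • z ∈ strip := by
  have h := existsUnique_add_zsmul_mem_Ioc (one_pos : (0 : ℝ) < 1) z.re (-(1 / 2))
  have e : ∀ n : ℤ, ModularGroup.T ^ n • z ∈ strip ↔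
      z.re + n • (1 : ℝ) ∈ Ioc (-(1 / 2) : ℝ) (-(1 / 2) + 1) := by
    intro n
    rw [mem_strip_iff, ModularGroup.re_T_zpow_smul]
    norm_num
  simpa only [e] using h

/-- The exponent `n` for which `T ^ n` translates `z` into the strip. -/
def stripShift (z : UpperHalfPlane) : ℤ := (existsUnique_T_zpow_smul_mem_strip z).choose

theorem stripShift_spec (z : UpperHalfPlane) : ModularGroup.T ^ stripShift z • z ∈ strip :=
  (existsUnique_T_zpow_smul_mem_strip z).choose_spec.1

theorem eq_stripShift {z : UpperHalfPlane} {n : ℤ} (h : ModularGroup.T ^ n • z ∈ strip) :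
    n = stripShift z :=
  (existsUnique_T_zpow_smul_mem_strip z).choose_spec.2 n h

theorem eq_T_zpow_or_neg_of_mem_parabolic {p : SL(2, ℤ)} (hp : p ∈ parabolic) :
    ∃ n : ℤ, p = ModularGroup.T ^ n ∨ p = -ModularGroup.T ^ n := by
  have hc : p 1 0 = 0 := hp
  have had := det_eq_one p
  rw [hc, mul_zero, sub_zero] at had
  rcases Int.eq_one_or_neg_one_of_mul_eq_one' had with ⟨ha, hd⟩ | ⟨ha, hd⟩
  · refine ⟨p 0 1, Or.inl ?_⟩
    ext i j
    fin_cases i <;> fin_cases j <;> simp [ha, hc, hd, ModularGroup.coe_T_zpow]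
  · refine ⟨-(p 0 1), Or.inr ?_⟩
    ext i j
    fin_cases i <;> fin_cases j <;> simp [ha, hc, hd, ModularGroup.coe_T_zpow]

theorem bottomRow_T_zpow_mul (n : ℤ) (γ : SL(2, ℤ)) :
    bottomRow (ModularGroup.T ^ n * γ) = bottomRow γ := by
  simp [bottomRow]

theorem bottomRow_neg (γ : SL(2, ℤ)) : bottomRow (-γ) = -bottomRow γ := by
  simp [bottomRow]

/-- The two elements of a coset that move `z` into the strip. -/
def stripElement (z : UpperHalfPlane) : Cosets ⊕ Cosets → SL(2, ℤ) :=
  Sum.elim (fun q => ModularGroup.T ^ stripShift (q.out • z) * q.out)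
    (fun q => -(ModularGroup.T ^ stripShift (q.out • z) * q.out))

theorem cosetRow_eq (q : Cosets) : cosetRow q = positiveRow q.out := by
  conv_lhs => rw [← Quotient.out_eq q]
  rfl

theorem eq_of_bottomRow_out {p q : Cosets} (h : bottomRow q.out = bottomRow p.out ∨
    bottomRow q.out = -bottomRow p.out) : p = q := by
  apply cosetRow_injective
  rw [cosetRow_eq, cosetRow_eq, positiveRow_eq_iff, mul_inv_mem_parabolic_iff]
  exact h

theorem stripElement_injective (z : UpperHalfPlane) : Function.Injective (stripElement z) := by
  rintro (p | p) (q | q) h <;> have h' := congrArg bottomRow h <;>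
    simp only [stripElement, Sum.elim_inl, Sum.elim_inr, bottomRow_neg, bottomRow_T_zpow_mul] at h'
  · rw [eq_of_bottomRow_out (Or.inl h'.symm)]
  · exfalso
    obtain rfl := eq_of_bottomRow_out (p := p) (q := q) (Or.inr (by rw [h', neg_neg]))
    exact bottomRow_ne_zero _ (self_eq_neg.mp h')
  · exfalso
    obtain rfl := eq_of_bottomRow_out (p := p) (q := q) (Or.inr h'.symm)
    exact bottomRow_ne_zero _ (self_eq_neg.mp h'.symm)
  · rw [eq_of_bottomRow_out (Or.inl (neg_injective h').symm)]

theorem mem_range_stripElement {z : UpperHalfPlane} {γ : SL(2, ℤ)} (h : γ • z ∈ strip) :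
    γ ∈ range (stripElement z) := by
  set q : Cosets := ⟦γ⟧ with hq
  have hrel : γ * q.out⁻¹ ∈ parabolic := by
    have : (QuotientGroup.rightRel parabolic) q.out γ := Quotient.exact (Quotient.out_eq q)
    exact QuotientGroup.rightRel_apply.mp this
  obtain ⟨n, hn | hn⟩ := eq_T_zpow_or_neg_of_mem_parabolic hrel
  · have hγ : γ = ModularGroup.T ^ n * q.out := by rw [← hn, inv_mul_cancel_right]
    rw [hγ, mul_smul] at h
    exact ⟨Sum.inl q, by simp only [stripElement, Sum.elim_inl]; rw [← eq_stripShift h, ← hγ]⟩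
  · have hγ : γ = -(ModularGroup.T ^ n * q.out) := by
      rw [← neg_mul, ← hn, inv_mul_cancel_right]
    rw [hγ, ModularGroup.SL_neg_smul, mul_smul] at h
    exact ⟨Sum.inr q, by simp only [stripElement, Sum.elim_inr]; rw [← eq_stripShift h, ← hγ]⟩

/-- Every coset of `P` contains exactly two elements moving `z` into the strip, again differing by
sign. This 2 cancels the 2 of `sum_indicator_fd_ae` in the unfolding. -/
theorem tsum_strip_indicator {g : UpperHalfPlane → ℂ}
    (hg : ∀ (n : ℤ) (z : UpperHalfPlane), g (ModularGroup.T ^ n • z) = g z) (z : UpperHalfPlane) :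
    ∑' γ : SL(2, ℤ), strip.indicator g (γ • z) = 2 * ∑' q : Cosets, g (q.out • z) := by
  set φ : Cosets → ℂ := fun q => g (q.out • z) with hφ
  have hval : ∀ x : Cosets ⊕ Cosets, strip.indicator g (stripElement z x • z) =
      Sum.elim φ φ x := by
    rintro (q | q)
    · simp only [stripElement, Sum.elim_inl]
      rw [mul_smul, indicator_of_mem (stripShift_spec _), hg]
    · simp only [stripElement, Sum.elim_inr]
      rw [ModularGroup.SL_neg_smul, mul_smul, indicator_of_mem (stripShift_spec _), hg]
  have h1 : ∑' x : Cosets ⊕ Cosets, strip.indicator g (stripElement z x • z) =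
      ∑' γ : SL(2, ℤ), strip.indicator g (γ • z) := by
    refine (stripElement_injective z).tsum_eq (f := fun γ => strip.indicator g (γ • z)) ?_
    intro γ hγ
    refine mem_range_stripElement ?_
    by_contra h
    exact hγ (indicator_of_notMem h _)
  rw [← h1, tsum_congr hval]
  by_cases hs : Summable φ
  · have h2 : HasSum (Sum.elim φ φ) (∑' q, φ q + ∑' q, φ q) :=
      HasSum.sum (f := Sum.elim φ φ) hs.hasSum hs.hasSum
    rw [h2.tsum_eq, two_mul]
  -- Without summability both sides are 0, so no convergence hypothesis is needed.
  · have h2 : ¬ Summable (Sum.elim φ φ) := fun h =>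
      hs (h.comp_injective (Sum.inl_injective (β := Cosets)))
    rw [tsum_eq_zero_of_not_summable hs, tsum_eq_zero_of_not_summable h2, mul_zero]

/-- **Unfolding.** -/
theorem setIntegral_fd_tsum_cosets {g : UpperHalfPlane → ℂ} (hm : Measurable g)
    (hg : ∀ (n : ℤ) (z : UpperHalfPlane), g (ModularGroup.T ^ n • z) = g z)
    (hi : IntegrableOn g strip) :
    ∫ z in ModularGroup.fd, ∑' q : Cosets, g (q.out • z) = ∫ z in strip, g z := by
  set h : UpperHalfPlane → ℂ := strip.indicator g with hh
  have hmh : Measurable h := hm.indicator measurableSet_strip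
  have hih : Integrable h := (integrable_indicator_iff measurableSet_strip).mpr hi
  -- `F γ` is `h` restricted to `γ • fd`. The sum of the integrals of the `F γ` is evaluated twice:
  -- pulling back by `γ` gives the integral over `fd` of the series, and summing pointwise gives
  -- twice the integral of `h`.
  set F : SL(2, ℤ) → UpperHalfPlane → ℂ := fun γ w =>
    ModularGroup.fd.indicator (fun _ => h w) (γ⁻¹ • w) with hF
  have hpull : ∀ γ z, F γ (γ • z) = ModularGroup.fd.indicator (fun z => h (γ • z)) z := by
    intro γ z
    simp only [hF, inv_smul_smul]
    by_cases hz : z ∈ ModularGroup.fd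
    · rw [indicator_of_mem hz, indicator_of_mem hz]
    · rw [indicator_of_notMem hz, indicator_of_notMem hz]
  have hFm : ∀ γ, Measurable (F γ) := by
    intro γ
    have : F γ = ((fun w => γ⁻¹ • w) ⁻¹' ModularGroup.fd).indicator h := by
      funext w
      by_cases hz : γ⁻¹ • w ∈ ModularGroup.fd
      · rw [indicator_of_mem (show w ∈ (fun w => γ⁻¹ • w) ⁻¹' ModularGroup.fd from hz)]
        simp only [hF]
        rw [indicator_of_mem hz]
      · rw [indicator_of_notMem (show w ∉ (fun w => γ⁻¹ • w) ⁻¹' ModularGroup.fd from hz)]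
        simp only [hF]
        rw [indicator_of_notMem hz]
    rw [this]
    exact hmh.indicator (measurable_smul_modular γ⁻¹ measurableSet_fd)
  have hint : ∀ γ, ∫ z in ModularGroup.fd, h (γ • z) = ∫ w, F γ w := by
    intro γ
    have mp := measurePreserving_smul_modular γ
    have hmap := integral_map (μ := volume) mp.measurable.aemeasurable
      (f := F γ) (hFm γ).aestronglyMeasurable
    rw [mp.map_eq] at hmap
    rw [hmap, ← integral_indicator measurableSet_fd]
    exact integral_congr_ae (Eventually.of_forall fun z => (hpull γ z).symm)
  have hlint : ∀ γ, ∫⁻ z in ModularGroup.fd, ‖h (γ • z)‖ₑ = ∫⁻ w, ‖F γ w‖ₑ := by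
    intro γ
    have mp := measurePreserving_smul_modular γ
    rw [← mp.lintegral_comp (hFm γ).enorm, ← lintegral_indicator measurableSet_fd]
    refine lintegral_congr fun z => ?_
    rw [hpull]
    by_cases hz : z ∈ ModularGroup.fd
    · rw [indicator_of_mem hz, indicator_of_mem hz]
    · rw [indicator_of_notMem hz, indicator_of_notMem hz, enorm_zero]
  have hfin : ∑' γ, ∫⁻ w, ‖F γ w‖ₑ ≠ ⊤ := by
    rw [← lintegral_tsum fun γ => (hFm γ).enorm.aemeasurable]
    have : ∫⁻ w, ∑' γ, ‖F γ w‖ₑ = ∫⁻ w, 2 * ‖h w‖ₑ := by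
      refine lintegral_congr_ae ?_
      filter_upwards [sum_indicator_fd_ae fun w => ‖h w‖ₑ] with w hw
      rw [nsmul_eq_mul, Nat.cast_ofNat] at hw
      rw [← hw.tsum_eq]
      refine tsum_congr fun γ => ?_
      simp only [hF]
      by_cases hz : γ⁻¹ • w ∈ ModularGroup.fd
      · rw [indicator_of_mem hz, indicator_of_mem hz]
      · rw [indicator_of_notMem hz, indicator_of_notMem hz, enorm_zero]
    rw [this, lintegral_const_mul _ hmh.enorm]
    exact ENNReal.mul_ne_top (by simp) hih.2.ne
  have h1 : ∫ z in ModularGroup.fd, ∑' γ : SL(2, ℤ), h (γ • z) =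
      ∑' γ : SL(2, ℤ), ∫ z in ModularGroup.fd, h (γ • z) := by
    refine integral_tsum (fun γ => (hmh.comp (measurable_smul_modular γ)).aestronglyMeasurable) ?_
    simp_rw [hlint]
    exact hfin
  have h2 : ∫ w, ∑' γ : SL(2, ℤ), F γ w = ∑' γ : SL(2, ℤ), ∫ w, F γ w :=
    integral_tsum (fun γ => (hFm γ).aestronglyMeasurable) hfin
  have h3 : ∫ w, ∑' γ : SL(2, ℤ), F γ w = ∫ w, 2 * h w := by
    refine integral_congr_ae ?_
    filter_upwards [sum_indicator_fd_ae h] with w hw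
    rw [nsmul_eq_mul, Nat.cast_ofNat] at hw
    exact hw.tsum_eq
  simp_rw [hint] at h1
  rw [← h2, h3, integral_const_mul, hh, integral_indicator measurableSet_strip] at h1
  simp_rw [tsum_strip_indicator hg] at h1
  rw [integral_const_mul] at h1
  exact mul_left_cancel₀ two_ne_zero h1

/-! ### Heights of translates of points of the fundamental domain -/

theorem one_le_normSq_of_mem_fd {z : UpperHalfPlane} (hz : z ∈ ModularGroup.fd) {c d : ℤ}
    (h : (c, d) ≠ 0) : 1 ≤ Complex.normSq (c * (z : ℂ) + d) := by
  have h1 : 1 ≤ z.re ^ 2 + z.im ^ 2 := by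
    have := hz.1
    rw [Complex.normSq_apply] at this
    simpa [sq] using this
  have h2 := abs_le.mp hz.2
  rw [normSq_lattice]
  -- With `|z| ≥ 1` and `|Re z| ≤ 1 / 2`, this integral quadratic form bounds `|c z + d|²` from
  -- below; it is positive definite, hence at least 1.
  have h3 : (1 : ℤ) ≤ c ^ 2 - |c * d| + d ^ 2 := by
    by_contra hlt
    have h4 : c ^ 2 - |c * d| + d ^ 2 ≤ 0 := by omega
    rw [abs_mul, ← sq_abs c, ← sq_abs d] at h4
    have h5 : |d| = 0 := by nlinarith [sq_nonneg (2 * |c| - |d|), abs_nonneg d]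
    have h6 : |c| = 0 := by rw [h5] at h4; nlinarith [abs_nonneg c]
    exact h (Prod.ext (abs_eq_zero.mp h6) (abs_eq_zero.mp h5))
  have h3' : (1 : ℝ) ≤ (c : ℝ) ^ 2 - |(c : ℝ) * d| + (d : ℝ) ^ 2 := by exact_mod_cast h3
  have h4 : -|(c : ℝ) * d| ≤ 2 * ((c : ℝ) * d) * z.re := by
    have : |2 * ((c : ℝ) * d) * z.re| ≤ |(c : ℝ) * d| := by
      rw [mul_right_comm, abs_mul]
      have : |2 * z.re| ≤ 1 := by rw [abs_le]; constructor <;> linarith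
      nlinarith [abs_nonneg ((c : ℝ) * d)]
    exact (abs_le.mp this).1
  nlinarith [sq_nonneg (c : ℝ)]

theorem im_smul_le_one {z : UpperHalfPlane} (hz : z ∈ ModularGroup.fd) {γ : SL(2, ℤ)}
    (h : z.im ≤ 1 ∨ γ 1 0 ≠ 0) : (γ • z).im ≤ 1 := by
  have hy := z.im_pos
  rw [ModularGroup.im_smul_eq_div_normSq, ModularGroup.denom_apply]
  have h1 := one_le_normSq_of_mem_fd hz (bottomRow_ne_zero γ)
  have h1' : 1 ≤ Complex.normSq (((γ 1 0 : ℤ) : ℂ) * (z : ℂ) + (γ 1 1 : ℤ)) := h1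
  rw [div_le_one (by linarith)]
  by_cases hle : z.im ≤ 1
  · linarith
  · have hc : (1 : ℝ) ≤ ((γ 1 0 : ℤ) : ℝ) ^ 2 := by
      have h2 := h.resolve_left hle
      have : (1 : ℤ) ≤ (γ 1 0) ^ 2 := by
        have := sq_pos_of_ne_zero h2
        omega
      exact_mod_cast this
    rw [normSq_lattice]
    -- Here `y > 1` and `c ≠ 0`, so `|c z + d|² ≥ c² y² ≥ y`.
    nlinarith [sq_nonneg (((γ 1 1 : ℤ) : ℝ) + ((γ 1 0 : ℤ) : ℝ) * z.re)]

/-- For a point of the fundamental domain, only the trivial coset can reach height above `1`. -/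
theorem tsum_indicator_im_gt_one {z : UpperHalfPlane} (hz : z ∈ ModularGroup.fd) (φ : ℝ → ℂ) :
    HasSum (fun q : Cosets => (Ioi (1 : ℝ)).indicator φ (q.out • z).im)
      ((Ioi (1 : ℝ)).indicator φ z.im) := by
  set q₀ : Cosets := ⟦1⟧ with hq₀
  have hout : q₀.out ∈ parabolic := by
    have h : (QuotientGroup.rightRel parabolic) 1 q₀.out :=
      Quotient.exact (Quotient.out_eq q₀).symm
    simpa using QuotientGroup.rightRel_apply.mp h
  have hv : (Ioi (1 : ℝ)).indicator φ (q₀.out • z).im = (Ioi (1 : ℝ)).indicator φ z.im := by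
    rw [im_parabolic_smul hout]
  rw [← hv]
  refine hasSum_single q₀ fun q hq => indicator_of_notMem (fun hmem => ?_) _
  have h1 : 1 < (q.out • z).im := hmem
  have h2 := mt (im_smul_le_one hz (γ := q.out)) (not_le.mpr h1)
  push Not at h2
  have h3 : q.out ∈ parabolic := h2.2
  refine hq ?_
  rw [← Quotient.out_eq q, hq₀]
  refine Quotient.sound (QuotientGroup.rightRel_apply.mpr ?_)
  rw [one_mul]
  exact inv_mem h3

/-! ### Integrals of powers of the height over the fundamental domain -/

theorem one_half_lt_im_of_mem_fd {z : UpperHalfPlane} (hz : z ∈ ModularGroup.fd) :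
    1 / 2 < z.im := by
  have h := ModularGroup.three_le_four_mul_im_sq_of_mem_fd hz
  nlinarith [z.im_pos]

theorem fd_subset_rectangle :
    ModularGroup.fd ⊆ rectangle (Icc (-(1 / 2)) (1 / 2)) (Ioi (1 / 2)) := fun _ hz =>
  ⟨abs_le.mp hz.2, one_half_lt_im_of_mem_fd hz⟩

theorem fd_inter_one_lt_im : ModularGroup.fd ∩ {z | 1 < z.im} =
    rectangle (Icc (-(1 / 2)) (1 / 2)) (Ioi 1) := by
  ext z
  refine ⟨fun h => ⟨abs_le.mp h.1.2, h.2⟩, fun h => ⟨⟨?_, abs_le.mpr h.1⟩, h.2⟩⟩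
  have h2 : 1 < z.im := h.2
  rw [Complex.normSq_apply]
  change 1 ≤ z.re * z.re + z.im * z.im
  nlinarith [mul_self_nonneg z.re]

theorem measurable_im : Measurable UpperHalfPlane.im := UpperHalfPlane.continuous_im.measurable

theorem measurable_ofReal_cpow (w : ℂ) : Measurable fun y : ℝ => (y : ℂ) ^ w :=
  Complex.measurable_ofReal.pow_const w

theorem measurable_im_cpow (w : ℂ) : Measurable fun z : UpperHalfPlane => (z.im : ℂ) ^ w :=
  (measurable_ofReal_cpow w).comp measurable_im

theorem one_div_sq_mul_cpow {y : ℝ} (hy : 0 < y) (w : ℂ) :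
    ((1 / y ^ 2 : ℝ) : ℂ) * (y : ℂ) ^ w = (y : ℂ) ^ (w - 2) := by
  have h : (y : ℂ) ≠ 0 := by exact_mod_cast hy.ne'
  rw [Complex.cpow_sub _ _ h]
  push_cast
  rw [Complex.cpow_ofNat]
  ring

theorem integrableOn_Ioi_one_div_sq_mul_cpow {w : ℂ} (hw : w.re < 1) {c : ℝ} (hc : 0 < c) :
    IntegrableOn (fun y : ℝ => ((1 / y ^ 2 : ℝ) : ℂ) * (y : ℂ) ^ w) (Ioi c) := by
  refine (integrableOn_Ioi_cpow_of_lt (a := w - 2) (by simp; linarith) hc).congr_fun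
    (fun y hy => (one_div_sq_mul_cpow (hc.trans hy) w).symm) measurableSet_Ioi

theorem integrableOn_fd_im_cpow {w : ℂ} (hw : w.re < 1) :
    IntegrableOn (fun z : UpperHalfPlane => (z.im : ℂ) ^ w) ModularGroup.fd :=
  (integrableOn_rectangle_im (φ := fun y => (y : ℂ) ^ w) measurableSet_Icc measurableSet_Ioi
    (fun y (hy : 1 / 2 < y) => lt_trans (by norm_num) hy) (by simp)
    (integrableOn_Ioi_one_div_sq_mul_cpow hw (by norm_num))
    (measurable_ofReal_cpow w)).mono_set fd_subset_rectangle

theorem integrableOn_fd_im_rpow {σ : ℝ} (hσ : σ < 1) :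
    IntegrableOn (fun z : UpperHalfPlane => z.im ^ σ) ModularGroup.fd := by
  refine (integrableOn_fd_im_cpow (w := σ) (by simpa using hσ)).norm.congr ?_
  refine Eventually.of_forall fun z => ?_
  simp [Complex.norm_cpow_eq_rpow_re_of_pos z.im_pos]

instance isFiniteMeasure_restrict_fd :
    IsFiniteMeasure ((volume : Measure UpperHalfPlane).restrict ModularGroup.fd) := by
  have h := integrableOn_fd_im_rpow zero_lt_one
  simp only [Real.rpow_zero] at h
  rw [isFiniteMeasure_restrict]
  exact (((integrableOn_const_iff (by simp)).mp h).resolve_left (by simp)).ne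

theorem setIntegral_fd_one_lt_im_cpow {w : ℂ} (hw : w.re < 1) :
    ∫ z in ModularGroup.fd ∩ {z | 1 < z.im}, (z.im : ℂ) ^ w = -1 / (w - 1) := by
  rw [fd_inter_one_lt_im, setIntegral_rectangle_im (φ := fun y => (y : ℂ) ^ w) measurableSet_Icc
    measurableSet_Ioi (Ioi_subset_Ioi zero_le_one) (by norm_num)
    (integrableOn_Ioi_one_div_sq_mul_cpow hw one_pos) (measurable_ofReal_cpow w)]
  rw [setIntegral_congr_fun measurableSet_Ioi fun y (hy : 1 < y) =>
    one_div_sq_mul_cpow (one_pos.trans hy) w]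
  rw [integral_Ioi_cpow_of_lt (by simp; linarith) one_pos]
  simp
  ring

/-- The integral of `y ^ s` over the part of the fundamental domain below height `1`. -/
def lowIntegral (s : ℂ) : ℂ := ∫ z in ModularGroup.fd, (Iic (1 : ℝ)).indicator (fun y => (y : ℂ) ^ s) z.im

/-- The integral of `y ^ s` over the fundamental domain, continued meromorphically in `s`. -/
def powerIntegral (s : ℂ) : ℂ := lowIntegral s - 1 / (s - 1)

theorem setIntegral_fd_im_cpow {w : ℂ} (hw : w.re < 1) :
    ∫ z in ModularGroup.fd, (z.im : ℂ) ^ w = powerIntegral w := by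
  have hm : MeasurableSet {z : UpperHalfPlane | 1 < z.im} := measurable_im measurableSet_Ioi
  have h : ∀ z : UpperHalfPlane, (z.im : ℂ) ^ w =
      (Iic (1 : ℝ)).indicator (fun y : ℝ => (y : ℂ) ^ w) z.im +
        {z : UpperHalfPlane | 1 < z.im}.indicator (fun z => (z.im : ℂ) ^ w) z := by
    intro z
    by_cases hz : z.im ≤ 1
    · rw [indicator_of_mem (show z.im ∈ Iic (1 : ℝ) from hz),
        indicator_of_notMem (show z ∉ {z : UpperHalfPlane | 1 < z.im} from not_lt.mpr hz), add_zero]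
    · rw [indicator_of_notMem (show z.im ∉ Iic (1 : ℝ) from hz),
        indicator_of_mem (show z ∈ {z : UpperHalfPlane | 1 < z.im} from not_le.mp hz), zero_add]
  have hi := integrableOn_fd_im_cpow hw
  have hi2 : IntegrableOn ({z : UpperHalfPlane | 1 < z.im}.indicator
      (fun z => (z.im : ℂ) ^ w)) ModularGroup.fd := hi.indicator hm
  have hi1 : IntegrableOn (fun z : UpperHalfPlane =>
      (Iic (1 : ℝ)).indicator (fun y : ℝ => (y : ℂ) ^ w) z.im) ModularGroup.fd := by
    refine (hi.sub hi2).congr (Eventually.of_forall fun z => ?_)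
    simp only [Pi.sub_apply]
    rw [h z]
    ring
  rw [integral_congr_ae (Eventually.of_forall h), integral_add hi1 hi2,
    setIntegral_indicator hm, setIntegral_fd_one_lt_im_cpow hw, powerIntegral, lowIntegral]
  ring

/-! ### Holomorphic families of functions on the fundamental domain -/

/-- The bound `f s z = O(y ^ σ)` on the fundamental domain, uniformly for `s` close to `s₀`. -/
def LocallyBoundedBy (f : ℂ → UpperHalfPlane → ℂ) (s₀ : ℂ) (σ : ℝ) : Prop :=
  ∃ C : ℝ, 0 ≤ C ∧ ∀ᶠ s in 𝓝 s₀, ∀ z ∈ ModularGroup.fd, ‖f s z‖ ≤ C * z.im ^ σ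

/-- The fundamental domain stays above height `1 / 2`, so raising an exponent costs only a constant.
-/
theorem rpow_le_of_half_lt {y : ℝ} (hy : 1 / 2 < y) {σ τ : ℝ} (h : σ ≤ τ) :
    y ^ σ ≤ 2 ^ (τ - σ) * y ^ τ := by
  have hy0 : 0 < y := lt_trans (by norm_num) hy
  have h1 : y ^ σ = y ^ (σ - τ) * y ^ τ := by rw [← Real.rpow_add hy0]; ring_nf
  rw [h1]
  refine mul_le_mul_of_nonneg_right ?_ (Real.rpow_nonneg hy0.le _)
  have h2 : (2 : ℝ) ^ (τ - σ) = (1 / 2) ^ (σ - τ) := by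
    rw [one_div, Real.inv_rpow (by norm_num), ← Real.rpow_neg (by norm_num)]
    ring_nf
  rw [h2]
  exact Real.rpow_le_rpow_of_nonpos (by norm_num) hy.le (by linarith)

namespace LocallyBoundedBy

variable {f g : ℂ → UpperHalfPlane → ℂ} {s₀ : ℂ} {σ τ : ℝ}

theorem mono (hf : LocallyBoundedBy f s₀ σ) (h : σ ≤ τ) : LocallyBoundedBy f s₀ τ := by
  obtain ⟨C, hC, hf⟩ := hf
  refine ⟨C * 2 ^ (τ - σ), by positivity, hf.mono fun s hs z hz => ?_⟩
  rw [mul_assoc]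
  exact (hs z hz).trans
    (mul_le_mul_of_nonneg_left (rpow_le_of_half_lt (one_half_lt_im_of_mem_fd hz) h) hC)

theorem add (hf : LocallyBoundedBy f s₀ σ) (hg : LocallyBoundedBy g s₀ σ) :
    LocallyBoundedBy (fun s z => f s z + g s z) s₀ σ := by
  obtain ⟨C, hC, hf⟩ := hf
  obtain ⟨D, hD, hg⟩ := hg
  refine ⟨C + D, by positivity, ?_⟩
  filter_upwards [hf, hg] with s h1 h2 z hz
  rw [add_mul]
  exact (norm_add_le _ _).trans (add_le_add (h1 z hz) (h2 z hz))

theorem mul (hf : LocallyBoundedBy f s₀ σ) (hg : LocallyBoundedBy g s₀ τ) :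
    LocallyBoundedBy (fun s z => f s z * g s z) s₀ (σ + τ) := by
  obtain ⟨C, hC, hf⟩ := hf
  obtain ⟨D, hD, hg⟩ := hg
  refine ⟨C * D, by positivity, ?_⟩
  filter_upwards [hf, hg] with s h1 h2 z hz
  rw [norm_mul, Real.rpow_add z.im_pos, mul_mul_mul_comm]
  exact mul_le_mul (h1 z hz) (h2 z hz) (norm_nonneg _)
    (mul_nonneg hC (Real.rpow_nonneg z.im_pos.le _))

/-- Freezing the parameter lets a fixed factor, such as `E_b`, be multiplied with a family varying
around another point. -/
theorem const_family (hf : LocallyBoundedBy f s₀ σ) (s₁ : ℂ) :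
    LocallyBoundedBy (fun _ z => f s₀ z) s₁ σ := by
  obtain ⟨C, hC, hf⟩ := hf
  exact ⟨C, hC, Eventually.of_forall fun _ => hf.self_of_nhds⟩

theorem of_continuousAt {c : ℂ → ℂ} (hc : ContinuousAt c s₀) :
    LocallyBoundedBy (fun s _ => c s) s₀ 0 := by
  refine ⟨‖c s₀‖ + 1, by positivity, ?_⟩
  filter_upwards [hc.norm.eventually (gt_mem_nhds (lt_add_one ‖c s₀‖))] with s hs z _
  simpa using hs.le

theorem cpow {e : ℂ → ℂ} (he : ContinuousAt e s₀) (hσ : (e s₀).re < σ) :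
    LocallyBoundedBy (fun s z => (z.im : ℂ) ^ e s) s₀ σ := by
  refine ⟨2 ^ (σ - (e s₀).re + 1), by positivity, ?_⟩
  have h1 := Complex.continuous_re.continuousAt.comp he
  filter_upwards [h1.eventually (gt_mem_nhds hσ),
    h1.eventually (lt_mem_nhds (sub_one_lt (e s₀).re))] with s h2 h3 z hz
  simp only [Function.comp_apply] at h2 h3
  rw [Complex.norm_cpow_eq_rpow_re_of_pos z.im_pos]
  refine (rpow_le_of_half_lt (one_half_lt_im_of_mem_fd hz) h2.le).trans ?_
  refine mul_le_mul_of_nonneg_right ?_ (Real.rpow_nonneg z.im_pos.le _)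
  exact Real.rpow_le_rpow_of_exponent_le (by norm_num) (by linarith)

theorem integrableOn (hf : LocallyBoundedBy f s₀ σ) (hσ : σ < 1) (hm : Measurable (f s₀)) :
    IntegrableOn (f s₀) ModularGroup.fd := by
  obtain ⟨C, hC, hf⟩ := hf
  refine Integrable.mono' ((integrableOn_fd_im_rpow hσ).const_mul C)
    hm.aestronglyMeasurable ?_
  filter_upwards [ae_restrict_mem measurableSet_fd] with z hz
  exact hf.self_of_nhds z hz

/-- The square is bounded by `y ^ (2 σ)`, which is integrable against `dx dy / y ^ 2` once `2 σ <
1`. -/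
theorem memLp_two (hf : LocallyBoundedBy f s₀ σ) (hσ : σ < 1 / 2) (hm : Measurable (f s₀)) :
    MemLp (f s₀) 2 ((volume : Measure UpperHalfPlane).restrict ModularGroup.fd) := by
  refine (memLp_two_iff_integrable_sq_norm hm.aestronglyMeasurable).mpr ?_
  obtain ⟨C, hC, hf⟩ := hf.mul hf
  refine Integrable.mono' ((integrableOn_fd_im_rpow (σ := σ + σ) (by linarith)).const_mul C)
    (hm.norm.pow_const 2).aestronglyMeasurable ?_
  filter_upwards [ae_restrict_mem measurableSet_fd] with z hz
  have h := hf.self_of_nhds z hz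
  rw [norm_mul, ← sq] at h
  simpa using h

theorem deriv (hf : LocallyBoundedBy f s₀ σ) {U : Set ℂ} (hU : U ∈ 𝓝 s₀)
    (hd : ∀ z, DifferentiableOn ℂ (fun s => f s z) U) :
    LocallyBoundedBy (fun s z => _root_.deriv (fun s => f s z) s) s₀ σ := by
  obtain ⟨C, hC, hf⟩ := hf
  obtain ⟨r, hr, hball⟩ := Metric.eventually_nhds_iff_ball.mp (hf.and hU)
  refine ⟨C / (r / 4), by positivity, ?_⟩
  filter_upwards [Metric.ball_mem_nhds s₀ (half_pos hr)] with s hs z hz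
  -- Cauchy's estimate on circles of radius `r / 4`, which stay in the region of uniform bounds
  -- while `s` runs over the half-size ball.
  have hsub : Metric.closedBall s (r / 4) ⊆ Metric.ball s₀ r :=
    Metric.closedBall_subset_ball' (by linarith [Metric.mem_ball.mp hs])
  rw [div_mul_eq_mul_div]
  refine Complex.norm_deriv_le_of_forall_mem_sphere_norm_le (by positivity) ?_ fun w hw =>
    (hball w (hsub (Metric.sphere_subset_closedBall hw))).1 z hz
  refine DifferentiableOn.diffContOnCl ?_
  rw [closure_ball _ (by positivity)]
  exact (hd z).mono fun w hw => (hball w (hsub hw)).2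

theorem measurable_deriv {U : Set ℂ} (hU : U ∈ 𝓝 s₀) (hm : ∀ s ∈ U, Measurable (f s))
    (hd : ∀ z, DifferentiableOn ℂ (fun s => f s z) U) :
    Measurable fun z => _root_.deriv (fun s => f s z) s₀ := by
  have hseq : Tendsto (fun n : ℕ => s₀ + ((1 / ((n : ℝ) + 1) : ℝ) : ℂ)) atTop (𝓝[≠] s₀) := by
    refine tendsto_nhdsWithin_iff.mpr ⟨?_, Eventually.of_forall fun n => ?_⟩
    · have h := (Complex.continuous_ofReal.tendsto 0).comp
        tendsto_one_div_add_atTop_nhds_zero_nat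
      simpa using h.const_add s₀
    · have : (0 : ℝ) < 1 / ((n : ℝ) + 1) := by positivity
      simp only [mem_compl_iff, mem_singleton_iff, add_eq_left]
      exact_mod_cast this.ne'
  -- The derivative is a pointwise limit of difference quotients. Discarding the first `N` of them
  -- keeps all arguments in `U`, where measurability is known.
  obtain ⟨N, hN⟩ := eventually_atTop.mp
    ((tendsto_nhds_of_tendsto_nhdsWithin hseq).eventually hU)
  refine measurable_of_tendsto_metrizable' (u := (atTop : Filter ℕ))
    (f := fun n z => slope (fun s => f s z) s₀ (s₀ + ((1 / (((n + N : ℕ) : ℝ) + 1) : ℝ) : ℂ)))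
    (fun n => ?_) (tendsto_pi_nhds.mpr fun z => ?_)
  · simp only [slope, vsub_eq_sub, smul_eq_mul]
    exact ((hm _ (hN _ (Nat.le_add_left N n))).sub (hm _ (mem_of_mem_nhds hU))).const_mul _
  · exact (hasDerivAt_iff_tendsto_slope.mp ((hd z).differentiableAt hU).hasDerivAt).comp
      (hseq.comp (tendsto_add_atTop_nat N))

/-- Differentiation under the integral sign. -/
theorem hasDerivAt_setIntegral (hf : LocallyBoundedBy f s₀ σ) (hσ : σ < 1)
    {U : Set ℂ} (hU : U ∈ 𝓝 s₀) (hm : ∀ s ∈ U, Measurable (f s))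
    (hd : ∀ z, DifferentiableOn ℂ (fun s => f s z) U) :
    HasDerivAt (fun s => ∫ z in ModularGroup.fd, f s z)
      (∫ z in ModularGroup.fd, _root_.deriv (fun s => f s z) s₀) s₀ := by
  have hint := hf.integrableOn hσ (hm s₀ (mem_of_mem_nhds hU))
  obtain ⟨C, hC, hf⟩ := hf.deriv hU hd
  refine (hasDerivAt_integral_of_dominated_loc_of_deriv_le (F := f)
    (F' := fun s z => _root_.deriv (fun s => f s z) s) (bound := fun z => C * z.im ^ σ)
    (s := {s | ∀ z ∈ ModularGroup.fd, ‖_root_.deriv (fun s => f s z) s‖ ≤ C * z.im ^ σ} ∩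
      interior U) (Filter.inter_mem hf (interior_mem_nhds.mpr hU))
    (Filter.eventually_of_mem hU fun s hs => (hm s hs).aestronglyMeasurable) hint
    (measurable_deriv hU hm hd).aestronglyMeasurable ?_
    ((integrableOn_fd_im_rpow hσ).const_mul _) ?_).2
  · filter_upwards [ae_restrict_mem measurableSet_fd] with z hz s hs
    exact hs.1 z hz
  · exact Eventually.of_forall fun z s hs =>
      ((hd z).differentiableAt (mem_interior_iff_mem_nhds.mp hs.2)).hasDerivAt

end LocallyBoundedBy

theorem differentiableOn_setIntegral_fd {f : ℂ → UpperHalfPlane → ℂ} {U : Set ℂ} (hU : IsOpen U)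
    {σ : ℝ} (hσ : σ < 1) (hf : ∀ s ∈ U, LocallyBoundedBy f s σ) (hm : ∀ s ∈ U, Measurable (f s))
    (hd : ∀ z, DifferentiableOn ℂ (fun s => f s z) U) :
    DifferentiableOn ℂ (fun s => ∫ z in ModularGroup.fd, f s z) U := fun s hs =>
  ((hf s hs).hasDerivAt_setIntegral hσ (hU.mem_nhds hs) hm
    hd).differentiableAt.differentiableWithinAt

/-- On the truncated domain `1 / 2 < y ≤ 1` every power is bounded, whatever its exponent. Hence
`lowIntegral` is entire and the pole of `powerIntegral` comes from the cusp alone. -/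
theorem locallyBoundedBy_low (s : ℂ) : LocallyBoundedBy
    (fun s z => (Iic (1 : ℝ)).indicator (fun y : ℝ => (y : ℂ) ^ s) z.im) s 0 := by
  refine ⟨2 ^ (|s.re| + 1), by positivity, ?_⟩
  have h1 := Complex.continuous_re.continuousAt (x := s)
  filter_upwards [h1.eventually (lt_mem_nhds (sub_one_lt s.re)),
    h1.eventually (gt_mem_nhds (lt_add_one s.re))] with w hw1 hw2 z hz
  rw [Real.rpow_zero, mul_one]
  by_cases hz1 : z.im ≤ 1
  · rw [indicator_of_mem (show z.im ∈ Iic (1 : ℝ) from hz1),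
      Complex.norm_cpow_eq_rpow_re_of_pos z.im_pos]
    have h3 := rpow_le_of_half_lt (one_half_lt_im_of_mem_fd hz) (σ := w.re) (τ := |s.re| + 1)
      (hw2.le.trans (by gcongr; exact le_abs_self _))
    by_cases hw0 : 0 ≤ w.re
    · refine (Real.rpow_le_one z.im_pos.le hz1 hw0).trans ?_
      exact Real.one_le_rpow (by norm_num) (by positivity)
    · have h4 := rpow_le_of_half_lt (one_half_lt_im_of_mem_fd hz) (σ := w.re) (τ := 0)
        (not_le.mp hw0).le
      rw [Real.rpow_zero, mul_one] at h4
      refine h4.trans (Real.rpow_le_rpow_of_exponent_le (by norm_num) ?_)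
      linarith [neg_abs_le s.re]
  · rw [indicator_of_notMem (show z.im ∉ Iic (1 : ℝ) from hz1), norm_zero]
    positivity

theorem differentiable_lowIntegral : Differentiable ℂ lowIntegral := by
  rw [← differentiableOn_univ]
  refine differentiableOn_setIntegral_fd isOpen_univ zero_lt_one
    (fun s _ => locallyBoundedBy_low s) (fun s _ => ?_) (fun z => ?_)
  · exact ((measurable_ofReal_cpow s).indicator measurableSet_Iic).comp measurable_im
  · by_cases hz1 : z.im ≤ 1
    · simp only [indicator_of_mem (show z.im ∈ Iic (1 : ℝ) from hz1)]
      exact (differentiable_ofReal_cpow z.im_pos differentiable_id).differentiableOn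
    · simp only [indicator_of_notMem (show z.im ∉ Iic (1 : ℝ) from hz1)]
      exact differentiableOn_const 0

/-! ### The Eisenstein series on the fundamental domain -/

theorem measurable_constantTerm (s : ℂ) :
    Measurable fun z : UpperHalfPlane => constantTerm s z.im :=
  (measurable_im_cpow s).add ((measurable_im_cpow (1 - s)).const_mul _)

theorem measurable_remainder (s : ℂ) : Measurable (remainder s) :=
  (measurable_fourierPart s).const_mul _

theorem measurable_eisensteinExpansion (s : ℂ) : Measurable (eisensteinExpansion s) :=
  (measurable_constantTerm s).add (measurable_remainder s)

theorem isOpen_xi_ne_zero : IsOpen {s : ℂ | xi (2 * s) ≠ 0} :=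
  isOpen_ne.preimage (differentiable_xi.continuous.comp (by fun_prop))

theorem locallyBoundedBy_remainder {s₀ : ℂ} (hs : xi (2 * s₀) ≠ 0) (σ : ℝ) :
    LocallyBoundedBy remainder s₀ σ := by
  -- Of the 4, 3 is the margin in `norm_fourierPart_le` and 1 allows `s` to vary; `|σ|` brings the
  -- exponent `1 / 2 - (k + 1)` below `σ`.
  obtain ⟨k, hk⟩ := exists_nat_ge (|s₀.re| + 4 + |σ|)
  have h1 : LocallyBoundedBy (fun s z => 2 * s * (2 * s - 1) / xi (2 * s)) s₀ 0 := by
    refine LocallyBoundedBy.of_continuousAt (c := fun s => 2 * s * (2 * s - 1) / xi (2 * s)) ?_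
    refine ContinuousAt.div (by fun_prop) ?_ hs
    exact (differentiable_xi.continuous.comp (by fun_prop)).continuousAt
  have h2 : LocallyBoundedBy fourierPart s₀ (1 / 2 - (k + 1)) := by
    have hw : 0 ≤ fourierWeight := tsum_nonneg fun p => by positivity
    refine ⟨k.factorial * 2 * fourierWeight, by positivity, ?_⟩
    have h1 := (Complex.continuous_re.abs).continuousAt (x := s₀)
    filter_upwards [h1.eventually (gt_mem_nhds (lt_add_one |s₀.re|))] with s h3 z _
    refine (norm_fourierPart_le z (k := k) (by linarith [abs_nonneg σ])).trans (le_of_eq ?_)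
    rw [Real.rpow_sub z.im_pos, ← Real.sqrt_eq_rpow, div_eq_mul_inv]
    norm_cast
  refine (h1.mul h2).mono ?_
  linarith [neg_abs_le σ, abs_nonneg s₀.re]

theorem locallyBoundedBy_constantTerm {s₀ : ℂ} (hs : s₀ ∈ regularSet) :
    LocallyBoundedBy (fun s z => constantTerm s z.im) s₀ (|s₀.re| + 2) := by
  have h1 : LocallyBoundedBy (fun s z => (z.im : ℂ) ^ s) s₀ (|s₀.re| + 2) :=
    LocallyBoundedBy.cpow (e := fun s => s) (by fun_prop) (by linarith [le_abs_self s₀.re])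
  have h2 : LocallyBoundedBy (fun s z => (z.im : ℂ) ^ (1 - s)) s₀ (|s₀.re| + 2) :=
    LocallyBoundedBy.cpow (e := fun s => 1 - s) (by fun_prop)
      (by simp; linarith [neg_abs_le s₀.re])
  have h3 := LocallyBoundedBy.of_continuousAt (analyticAt_scattering hs).continuousAt
  refine h1.add ((h3.mul h2).mono ?_)
  linarith

/-! ### Zero mean of the remainder -/

theorem setIntegral_exp_two_pi_int {k : ℤ} (hk : k ≠ 0) :
    ∫ x in Ioc (-(1 / 2) : ℝ) (1 / 2), Complex.exp (2 * Real.pi * Complex.I * k * x) = 0 := by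
  have hc : (2 * Real.pi * Complex.I * k : ℂ) ≠ 0 := by
    simp [Complex.I_ne_zero, hk]
  rw [← intervalIntegral.integral_of_le (by norm_num), integral_exp_mul_complex hc]
  have h : Complex.exp (2 * Real.pi * Complex.I * k * ((1 / 2 : ℝ) : ℂ)) =
      Complex.exp (2 * Real.pi * Complex.I * k * ((-(1 / 2) : ℝ) : ℂ)) := by
    rw [Complex.exp_eq_exp_iff_exists_int]
    exact ⟨k, by push_cast; ring⟩
  rw [h, sub_self, zero_div]

theorem norm_fourierTerm_pairPoint (p : FourierIndex) (s : ℂ) {y : ℝ} (hy : 0 < y) (x : ℝ) :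
    ‖fourierTerm p s (pairPoint (x, y))‖ = ‖fourierTerm p s (pairPoint (0, y))‖ := by
  rw [norm_fourierTerm, norm_fourierTerm, im_pairPoint (p := (x, y)) hy,
    im_pairPoint (p := (0, y)) hy]

theorem setIntegral_fourierTerm (p : FourierIndex) (s : ℂ) {y : ℝ} (hy : 0 < y) :
    ∫ x in Ioc (-(1 / 2) : ℝ) (1 / 2), fourierTerm p s (pairPoint (x, y)) = 0 := by
  have hre : ∀ x : ℝ, (pairPoint (x, y)).re = x := fun x => re_pairPoint hy
  have him : ∀ x : ℝ, (pairPoint (x, y)).im = y := fun x => im_pairPoint hy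
  have hk : ((p.1 : ℕ) : ℤ) * (p.2 : ℤ) ≠ 0 :=
    mul_ne_zero (by exact_mod_cast p.1.ne_zero) p.2.2
  have h := setIntegral_exp_two_pi_int hk
  simp only [fourierTerm, hre, him, mul_assoc]
  rw [integral_mul_const]
  convert zero_mul _ using 2
  rw [← h]
  refine integral_congr_ae (Eventually.of_forall fun x => ?_)
  push_cast
  ring_nf

/-- Every term of the remainder has nonzero frequency `m n`. The interchange with the sum is
immediate since the norms of the terms do not depend on `x`. -/
theorem setIntegral_remainder_pairPoint (s : ℂ) {y : ℝ} (hy : 0 < y) :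
    ∫ x in Ioc (-(1 / 2) : ℝ) (1 / 2), remainder s (pairPoint (x, y)) = 0 := by
  have hmeas : ∀ p, Measurable fun x : ℝ => fourierTerm p s (pairPoint (x, y)) := fun p =>
    (measurable_fourierTerm p s).comp (measurable_pairPoint.comp (by fun_prop))
  have hint : ∀ p, Integrable (fun x : ℝ => fourierTerm p s (pairPoint (x, y)))
      (volume.restrict (Ioc (-(1 / 2) : ℝ) (1 / 2))) := fun p =>
    Integrable.of_bound (hmeas p).aestronglyMeasurable ‖fourierTerm p s (pairPoint (0, y))‖
      (Eventually.of_forall fun x => (norm_fourierTerm_pairPoint p s hy x).le)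
  have hsum : Summable fun p : FourierIndex =>
      ∫ x in Ioc (-(1 / 2) : ℝ) (1 / 2), ‖fourierTerm p s (pairPoint (x, y))‖ := by
    simp only [norm_fourierTerm_pairPoint _ s hy]
    simp only [integral_const]
    exact (summable_norm_fourierTerm s (pairPoint (0, y))).mul_left _
  have h := integral_tsum_of_summable_integral_norm hint hsum
  simp only [setIntegral_fourierTerm _ s hy, tsum_zero] at h
  simp only [remainder]
  rw [integral_const_mul]
  simp only [fourierPart]
  rw [← h, mul_zero]

/-! ### Powers of the height on the strip -/

theorem indicator_mul_cpow (A : Set ℝ) (w : ℂ) :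
    (fun y : ℝ => ((1 / y ^ 2 : ℝ) : ℂ) * A.indicator (fun y : ℝ => (y : ℂ) ^ w) y) =
      A.indicator (fun y : ℝ => ((1 / y ^ 2 : ℝ) : ℂ) * (y : ℂ) ^ w) := by
  funext y
  by_cases h : y ∈ A <;> simp [h]

theorem integrableOn_low_cpow {w : ℂ} (hw : 1 < w.re) :
    IntegrableOn (fun y : ℝ => ((1 / y ^ 2 : ℝ) : ℂ) *
      (Iic (1 : ℝ)).indicator (fun y : ℝ => (y : ℂ) ^ w) y) (Ioi 0) := by
  rw [indicator_mul_cpow, integrableOn_indicator_iff measurableSet_Iic, Iic_inter_Ioi]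
  have h := (intervalIntegrable_iff_integrableOn_Ioc_of_le (zero_le_one' ℝ)).mp
    (intervalIntegral.intervalIntegrable_cpow' (a := 0) (b := 1) (r := w - 2) (by simp; linarith))
  exact h.congr_fun (fun y hy => (one_div_sq_mul_cpow hy.1 w).symm) measurableSet_Ioc

theorem integrableOn_high_cpow {w : ℂ} (hw : w.re < 1) :
    IntegrableOn (fun y : ℝ => ((1 / y ^ 2 : ℝ) : ℂ) *
      (Ioi (1 : ℝ)).indicator (fun y : ℝ => (y : ℂ) ^ w) y) (Ioi 0) := by
  rw [indicator_mul_cpow, integrableOn_indicator_iff measurableSet_Ioi]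
  exact (integrableOn_Ioi_one_div_sq_mul_cpow hw one_pos).mono_set inter_subset_left

theorem integral_low_cpow {w : ℂ} (hw : 1 < w.re) :
    ∫ y in Ioi (0 : ℝ), ((1 / y ^ 2 : ℝ) : ℂ) *
      (Iic (1 : ℝ)).indicator (fun y : ℝ => (y : ℂ) ^ w) y = 1 / (w - 1) := by
  have hw1 : w - 1 ≠ 0 := fun h => by
    have := congrArg Complex.re h
    simp at this
    linarith
  rw [indicator_mul_cpow, setIntegral_indicator measurableSet_Iic, inter_comm, Iic_inter_Ioi,
    setIntegral_congr_fun measurableSet_Ioc fun y hy => one_div_sq_mul_cpow hy.1 w,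
    ← intervalIntegral.integral_of_le zero_le_one, integral_cpow (Or.inl (by simp; linarith))]
  have : w - 2 + 1 = w - 1 := by ring
  rw [this, Complex.ofReal_one, Complex.one_cpow, Complex.ofReal_zero, Complex.zero_cpow hw1,
    sub_zero]

theorem measurable_indicator_cpow {A : Set ℝ} (hA : MeasurableSet A) (w : ℂ) :
    Measurable (A.indicator fun y : ℝ => (y : ℂ) ^ w) :=
  (measurable_ofReal_cpow w).indicator hA

theorem volume_Ioc_strip : volume (Ioc (-(1 / 2) : ℝ) (1 / 2)) = 1 := by norm_num

theorem integrableOn_strip_low {w : ℂ} (hw : 1 < w.re) :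
    IntegrableOn (fun z : UpperHalfPlane => (Iic (1 : ℝ)).indicator (fun y : ℝ => (y : ℂ) ^ w) z.im)
      strip :=
  integrableOn_rectangle_im measurableSet_Ioc measurableSet_Ioi subset_rfl (by simp)
    (integrableOn_low_cpow hw) (measurable_indicator_cpow measurableSet_Iic w)

theorem integrableOn_strip_high {w : ℂ} (hw : w.re < 1) :
    IntegrableOn (fun z : UpperHalfPlane => (Ioi (1 : ℝ)).indicator (fun y : ℝ => (y : ℂ) ^ w) z.im)
      strip :=
  integrableOn_rectangle_im measurableSet_Ioc measurableSet_Ioi subset_rfl (by simp)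
    (integrableOn_high_cpow hw) (measurable_indicator_cpow measurableSet_Ioi w)

theorem setIntegral_strip_low {w : ℂ} (hw : 1 < w.re) :
    ∫ z in strip, (Iic (1 : ℝ)).indicator (fun y : ℝ => (y : ℂ) ^ w) z.im = 1 / (w - 1) := by
  rw [strip, setIntegral_rectangle_im measurableSet_Ioc measurableSet_Ioi subset_rfl
    volume_Ioc_strip (integrableOn_low_cpow hw) (measurable_indicator_cpow measurableSet_Iic w),
    integral_low_cpow hw]

/-! ### Unfolding Eisenstein series -/

/-- Invariance is invisible in the Fourier expansion; it is inherited from `eisenstein`, which lives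
on the quotient. -/
theorem eisensteinExpansion_smul {s : ℂ} (hs : s ∈ regularSet) (γ : SL(2, ℤ))
    (z : UpperHalfPlane) : eisensteinExpansion s (γ • z) = eisensteinExpansion s z := by
  rw [← eisenstein_eq hs, ← eisenstein_eq hs]
  congr 1
  exact Quotient.sound ⟨γ, rfl⟩

theorem remainder_T_zpow_smul {s : ℂ} (hs : s ∈ regularSet) (n : ℤ) (z : UpperHalfPlane) :
    remainder s (ModularGroup.T ^ n • z) = remainder s z := by
  have h := eisensteinExpansion_smul hs (ModularGroup.T ^ n) z
  simpa only [eisensteinExpansion, ModularGroup.im_T_zpow_smul, add_right_inj] using h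

theorem hasSum_im_cpow {s : ℂ} (hs : 1 < s.re) (z : UpperHalfPlane) :
    HasSum (fun q : Cosets => ((q.out • z).im : ℂ) ^ s) (eisensteinExpansion s z) := by
  rw [← eisensteinSeries_eq hs]
  have h := (summable_norm_eisensteinTerm hs z).of_norm.hasSum
  have e : (fun q : Cosets => ((q.out • z).im : ℂ) ^ s) = eisensteinTerm s z := by
    funext q
    conv_rhs => rw [← Quotient.out_eq q]
    rfl
  rw [e]
  exact h

theorem indicator_Iic_eq_sub (φ : ℝ → ℂ) (y : ℝ) :
    (Iic (1 : ℝ)).indicator φ y = φ y - (Ioi (1 : ℝ)).indicator φ y := by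
  rw [← compl_Iic, indicator_compl]
  simp

theorem ne_one_of_one_lt_re {s : ℂ} (hs : 1 < s.re) : s ≠ 1 := by
  rintro rfl
  simp at hs

theorem mem_regularSet_of_one_lt_re {s : ℂ} (hs : 1 < s.re) : s ∈ regularSet :=
  mem_regularSet (by linarith) (ne_one_of_one_lt_re hs)

theorem integrableOn_fd_low (w : ℂ) :
    IntegrableOn (fun z : UpperHalfPlane => (Iic (1 : ℝ)).indicator (fun y : ℝ => (y : ℂ) ^ w) z.im)
      ModularGroup.fd :=
  (locallyBoundedBy_low w).integrableOn zero_lt_one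
    ((measurable_indicator_cpow measurableSet_Iic w).comp measurable_im)

theorem integrableOn_fd_remainder {s : ℂ} (hs : xi (2 * s) ≠ 0) :
    IntegrableOn (remainder s) ModularGroup.fd :=
  (locallyBoundedBy_remainder hs 0).integrableOn zero_lt_one (measurable_remainder s)

/-- The integral of `E_s`, regularised at the cusp, vanishes: the half plane of convergence. -/
theorem regularised_integral_eq_zero_of_one_lt_re {s : ℂ} (hs : 1 < s.re) :
    powerIntegral s + scattering s * powerIntegral (1 - s) +
      ∫ z in ModularGroup.fd, remainder s z = 0 := by
  have hr := mem_regularSet_of_one_lt_re hs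
  -- The full power `y ^ s` is not integrable on the strip; the part below height 1 is, with
  -- integral `1 / (s - 1)`.
  have h := setIntegral_fd_tsum_cosets
    (g := fun z => (Iic (1 : ℝ)).indicator (fun y : ℝ => (y : ℂ) ^ s) z.im)
    ((measurable_indicator_cpow measurableSet_Iic s).comp measurable_im)
    (fun n z => by rw [ModularGroup.im_T_zpow_smul]) (integrableOn_strip_low hs)
  rw [setIntegral_strip_low hs] at h
  -- On the fundamental domain only the trivial coset reaches above height 1, so the truncated
  -- series is `E_s` minus `y ^ s` for `y > 1`.
  have hz : ∀ z ∈ ModularGroup.fd,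
      ∑' q : Cosets, (Iic (1 : ℝ)).indicator (fun y : ℝ => (y : ℂ) ^ s) (q.out • z).im =
      ((Iic (1 : ℝ)).indicator (fun y : ℝ => (y : ℂ) ^ s) z.im +
        scattering s * (z.im : ℂ) ^ (1 - s)) + remainder s z := by
    intro z hz
    have h1 := (hasSum_im_cpow hs z).sub (tsum_indicator_im_gt_one hz fun y : ℝ => (y : ℂ) ^ s)
    simp only [← indicator_Iic_eq_sub (fun y : ℝ => (y : ℂ) ^ s)] at h1
    rw [h1.tsum_eq, indicator_Iic_eq_sub, eisensteinExpansion, constantTerm]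
    ring
  have hi1 := integrableOn_fd_low s
  have hi2 := (integrableOn_fd_im_cpow (w := 1 - s) (by simp; linarith)).const_mul (scattering s)
  rw [setIntegral_congr_fun measurableSet_fd hz,
    integral_add (hi1.fun_add hi2) (integrableOn_fd_remainder hr.2), integral_add hi1 hi2,
    integral_const_mul, setIntegral_fd_im_cpow (by simp; linarith)] at h
  rw [powerIntegral, ← h, lowIntegral]
  ring

/-- Two orders of decay are used. Below height 1 the least admissible order `k₀` limits the blow-up,
which a large `Re a` outweighs; above it, an order `k₁` depending on `a` beats the growth of `y ^
a`. The majorants are `y ^ 2` and 1. -/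
theorem exists_integrableOn_strip (b : ℂ) : ∃ N : ℝ, ∀ a : ℂ, N < a.re →
    IntegrableOn (fun z : UpperHalfPlane => (z.im : ℂ) ^ a * remainder b z) strip := by
  obtain ⟨k₀, hk₀⟩ := exists_nat_ge (|b.re| + 3)
  refine ⟨k₀ + 3, fun a ha => ?_⟩
  obtain ⟨k₁, hk₁⟩ := exists_nat_ge (k₀ + a.re)
  have hw : 0 ≤ fourierWeight := tsum_nonneg fun p => by positivity
  set D : ℝ := ‖2 * b * (2 * b - 1) / xi (2 * b)‖ with hD
  have hbound : ∀ (k : ℕ), (k₀ : ℝ) ≤ k → ∀ z : UpperHalfPlane,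
      ‖(z.im : ℂ) ^ a * remainder b z‖ ≤
        (D * (k.factorial * 2 * fourierWeight)) * z.im ^ (a.re - k - 1 / 2) := by
    intro k hk z
    have h1 := norm_fourierPart_le z (hk₀.trans hk)
    have hy := z.im_pos
    rw [norm_mul, Complex.norm_cpow_eq_rpow_re_of_pos hy, remainder, norm_mul, ← hD]
    have h2 : z.im ^ (a.re - k - 1 / 2) = z.im ^ a.re * (√z.im * (z.im ^ (k + 1))⁻¹) := by
      rw [show a.re - k - 1 / 2 = a.re + (1 / 2 - ((k + 1 : ℕ) : ℝ)) by push_cast; ring,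
        Real.rpow_add hy, Real.rpow_sub hy, ← Real.sqrt_eq_rpow, Real.rpow_natCast, div_eq_mul_inv]
    rw [h2]
    calc z.im ^ a.re * (D * ‖fourierPart b z‖)
        ≤ z.im ^ a.re * (D * (k.factorial * 2 * fourierWeight * (√z.im * (z.im ^ (k + 1))⁻¹))) := by
          gcongr
      _ = _ := by ring
  set C : ℝ := max (D * (k₀.factorial * 2 * fourierWeight)) (D * (k₁.factorial * 2 * fourierWeight))
  have hC : 0 ≤ C := le_max_of_le_left (by positivity)
  refine Integrable.mono' (((integrableOn_strip_low (w := 2) (by norm_num)).norm.add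
    (integrableOn_strip_high (w := 0) (by norm_num)).norm).const_mul C)
    ((measurable_im_cpow a).mul (measurable_remainder b)).aestronglyMeasurable
    (Eventually.of_forall fun z => ?_)
  have hy := z.im_pos
  simp only [Pi.add_apply]
  by_cases hz : z.im ≤ 1
  · rw [indicator_of_mem (show z.im ∈ Iic (1 : ℝ) from hz),
      indicator_of_notMem (show z.im ∉ Ioi (1 : ℝ) from not_lt.mpr hz), norm_zero, add_zero,
      Complex.norm_cpow_eq_rpow_re_of_pos hy]
    refine (hbound k₀ le_rfl z).trans ?_
    refine mul_le_mul (le_max_left _ _) ?_ (Real.rpow_nonneg hy.le _) hC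
    exact Real.rpow_le_rpow_of_exponent_ge hy hz (by norm_num; linarith)
  · rw [indicator_of_notMem (show z.im ∉ Iic (1 : ℝ) from hz),
      indicator_of_mem (show z.im ∈ Ioi (1 : ℝ) from not_le.mp hz), norm_zero, zero_add,
      Complex.norm_cpow_eq_rpow_re_of_pos hy]
    refine (hbound k₁ (by linarith [k₀.cast_nonneg (α := ℝ)]) z).trans ?_
    refine mul_le_mul (le_max_right _ _) ?_ (Real.rpow_nonneg hy.le _) hC
    refine Real.rpow_le_rpow_of_exponent_le (not_le.mp hz).le ?_
    norm_num
    linarith [k₀.cast_nonneg (α := ℝ)]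

theorem setIntegral_strip_cpow_mul_remainder {a b : ℂ}
    (h : IntegrableOn (fun z : UpperHalfPlane => (z.im : ℂ) ^ a * remainder b z) strip) :
    ∫ z in strip, (z.im : ℂ) ^ a * remainder b z = 0 := by
  rw [strip, setIntegral_rectangle measurableSet_Ioc measurableSet_Ioi h]
  refine (setIntegral_congr_fun measurableSet_Ioi fun y (hy : 0 < y) => ?_).trans
    (integral_zero _ _)
  have him : ∀ x : ℝ, (pairPoint (x, y)).im = y := fun x => im_pairPoint hy
  simp only [him]
  rw [integral_const_mul, setIntegral_remainder_pairPoint b hy, mul_zero]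

/-- The product of two Eisenstein series minus the product of their constant terms. -/
def truncatedProduct (a b : ℂ) (z : UpperHalfPlane) : ℂ :=
  eisensteinExpansion a z * eisensteinExpansion b z - constantTerm a z.im * constantTerm b z.im

theorem measurable_truncatedProduct (a b : ℂ) : Measurable (truncatedProduct a b) :=
  ((measurable_eisensteinExpansion a).mul (measurable_eisensteinExpansion b)).sub
    ((measurable_constantTerm a).mul (measurable_constantTerm b))

/-- Once the product of the constant terms is removed, every summand contains a remainder, whose
decay can be chosen to offset the growth of the other factor. -/
theorem locallyBoundedBy_truncatedProduct {a b : ℂ} (ha : a ∈ regularSet) (hb : b ∈ regularSet) :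
    LocallyBoundedBy (fun a => truncatedProduct a b) a 0 := by
  have hb1 := (locallyBoundedBy_constantTerm hb).const_family a
  have hb2 := fun σ => (locallyBoundedBy_remainder hb.2 σ).const_family a
  have h1 := (locallyBoundedBy_constantTerm ha).mul (hb2 (-(|a.re| + 2)))
  have h2 := (locallyBoundedBy_remainder ha.2 (-(|b.re| + 2))).mul hb1
  have h3 := (locallyBoundedBy_remainder ha.2 0).mul (hb2 0)
  rw [add_neg_cancel] at h1
  rw [neg_add_cancel] at h2
  rw [add_zero] at h3
  convert (h1.add h2).add h3 using 3
  simp only [truncatedProduct, eisensteinExpansion]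
  ring

theorem integrableOn_fd_truncatedProduct {a b : ℂ} (ha : a ∈ regularSet) (hb : b ∈ regularSet) :
    IntegrableOn (truncatedProduct a b) ModularGroup.fd :=
  (locallyBoundedBy_truncatedProduct ha hb).integrableOn zero_lt_one
    (measurable_truncatedProduct a b)

/-- The constants produced by the product of the constant terms of `E_a` and `E_b`. -/
def productIntegral (a b : ℂ) : ℂ :=
  powerIntegral (a + b) + scattering b * powerIntegral (1 + a - b) +
    scattering a * powerIntegral (1 - a + b) +
    scattering a * scattering b * powerIntegral (2 - a - b)

theorem mul_constantTerm (a b : ℂ) {y : ℝ} (hy : 0 < y) :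
    (y : ℂ) ^ a * constantTerm b y = (y : ℂ) ^ (a + b) + scattering b * (y : ℂ) ^ (1 + a - b) := by
  have h : (y : ℂ) ≠ 0 := by exact_mod_cast hy.ne'
  rw [constantTerm, Complex.cpow_add _ _ h, show 1 + a - b = a + (1 - b) by ring,
    Complex.cpow_add _ _ h]
  ring

/-- Unfolds `E_a` against the invariant function `E_b`. For `Re a` large, of the four powers only `y
^ (a + b)` and `y ^ (1 + a - b)` fail to be integrable at the cusp, and these are the ones
truncated; their strip integrals below height 1 are the polar parts of `powerIntegral`. -/
theorem exists_regularised_product_integral_eq_zero {b : ℂ} (hb : b ∈ regularSet) :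
    ∃ N : ℝ, ∀ a : ℂ, N < a.re →
      productIntegral a b + ∫ z in ModularGroup.fd, truncatedProduct a b z = 0 := by
  obtain ⟨N, hN⟩ := exists_integrableOn_strip b
  refine ⟨max N (|b.re| + 2), fun a ha => ?_⟩
  have ha1 : N < a.re := (le_max_left _ _).trans_lt ha
  have ha2 : |b.re| + 2 < a.re := (le_max_right _ _).trans_lt ha
  have hb1 := neg_abs_le b.re
  have hb2 := le_abs_self b.re
  have hra : 1 < a.re := by linarith [abs_nonneg b.re]
  have har := mem_regularSet_of_one_lt_re hra
  have hab : 1 < (a + b).re := by simp; linarith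
  have hab' : 1 < (1 + a - b).re := by simp; linarith
  set φ : ℝ → ℂ := fun y => (y : ℂ) ^ a * constantTerm b y with hφ
  have hφlow : ∀ z : UpperHalfPlane, (Iic (1 : ℝ)).indicator φ z.im =
      (Iic (1 : ℝ)).indicator (fun y : ℝ => (y : ℂ) ^ (a + b)) z.im + scattering b *
        (Iic (1 : ℝ)).indicator (fun y : ℝ => (y : ℂ) ^ (1 + a - b)) z.im := by
    intro z
    by_cases hz : z.im ∈ Iic (1 : ℝ)
    · simp only [indicator_of_mem hz]
      exact mul_constantTerm a b z.im_pos
    · simp [indicator_of_notMem hz]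
  have hi0 := hN a ha1
  have hi1 := integrableOn_strip_low hab
  have hi2 := (integrableOn_strip_low hab').const_mul (scattering b)
  have hφs : IntegrableOn (fun z : UpperHalfPlane => (Iic (1 : ℝ)).indicator φ z.im) strip :=
    (hi1.add hi2).congr (Eventually.of_forall fun z => (hφlow z).symm)
  have hφm : Measurable φ := (measurable_ofReal_cpow a).mul
    ((measurable_ofReal_cpow b).add ((measurable_ofReal_cpow (1 - b)).const_mul _))
  have h := setIntegral_fd_tsum_cosets
    (g := fun z => (z.im : ℂ) ^ a * remainder b z + (Iic (1 : ℝ)).indicator φ z.im)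
    (((measurable_im_cpow a).mul (measurable_remainder b)).add
      ((hφm.indicator measurableSet_Iic).comp measurable_im))
    (fun n z => by rw [ModularGroup.im_T_zpow_smul, remainder_T_zpow_smul hb]) (hi0.add hφs)
  rw [integral_add hi0 hφs, setIntegral_strip_cpow_mul_remainder hi0,
    integral_congr_ae (Eventually.of_forall hφlow), integral_add hi1 hi2, integral_const_mul,
    setIntegral_strip_low hab, setIntegral_strip_low hab'] at h
  have hz : ∀ z ∈ ModularGroup.fd, ∑' q : Cosets, (((q.out • z).im : ℂ) ^ a *
        remainder b (q.out • z) + (Iic (1 : ℝ)).indicator φ (q.out • z).im) =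
      ((((Iic (1 : ℝ)).indicator (fun y : ℝ => (y : ℂ) ^ (a + b)) z.im + scattering b *
        (Iic (1 : ℝ)).indicator (fun y : ℝ => (y : ℂ) ^ (1 + a - b)) z.im) +
        scattering a * (z.im : ℂ) ^ (1 - a + b)) +
        scattering a * scattering b * (z.im : ℂ) ^ (2 - a - b)) + truncatedProduct a b z := by
    intro z hz
    have h1 := ((hasSum_im_cpow hra z).mul_right (eisensteinExpansion b z)).sub
      (tsum_indicator_im_gt_one hz φ)
    -- Invariance moves `E_b` inside the sum, where it is expanded at the translated point.
    have h2 : ∀ q : Cosets, ((q.out • z).im : ℂ) ^ a * eisensteinExpansion b z -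
        (Ioi (1 : ℝ)).indicator φ (q.out • z).im = ((q.out • z).im : ℂ) ^ a *
        remainder b (q.out • z) + (Iic (1 : ℝ)).indicator φ (q.out • z).im := by
      intro q
      rw [indicator_Iic_eq_sub, ← eisensteinExpansion_smul hb q.out z, eisensteinExpansion]
      simp only [hφ]
      ring
    simp only [h2] at h1
    rw [h1.tsum_eq, ← hφlow, indicator_Iic_eq_sub, truncatedProduct]
    have h3 := mul_constantTerm (1 - a) b z.im_pos
    rw [show 1 + (1 - a) - b = 2 - a - b by ring] at h3
    simp only [hφ]
    rw [constantTerm.eq_def a]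
    linear_combination scattering a * h3
  have hj1 := integrableOn_fd_low (a + b)
  have hj2 := (integrableOn_fd_low (1 + a - b)).const_mul (scattering b)
  have hr3 : (1 - a + b).re < 1 := by simp; linarith
  have hr4 : (2 - a - b).re < 1 := by simp; linarith
  have hj3 := (integrableOn_fd_im_cpow hr3).const_mul (scattering a)
  have hj4 := (integrableOn_fd_im_cpow hr4).const_mul (scattering a * scattering b)
  rw [setIntegral_congr_fun measurableSet_fd hz,
    integral_add (((hj1.fun_add hj2).fun_add hj3).fun_add hj4) (integrableOn_fd_truncatedProduct har hb),
    integral_add ((hj1.fun_add hj2).fun_add hj3) hj4, integral_add (hj1.fun_add hj2) hj3,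
    integral_add hj1 hj2, integral_const_mul, integral_const_mul, integral_const_mul,
    setIntegral_fd_im_cpow hr3, setIntegral_fd_im_cpow hr4] at h
  have h' : ∫ z in ModularGroup.fd, truncatedProduct a b z = 0 + (1 / (a + b - 1) +
      scattering b * (1 / (1 + a - b - 1))) - (lowIntegral (a + b) + scattering b *
      lowIntegral (1 + a - b) + scattering a * powerIntegral (1 - a + b) +
      scattering a * scattering b * powerIntegral (2 - a - b)) := by
    rw [← h, lowIntegral, lowIntegral]
    ring
  rw [h', productIntegral, powerIntegral.eq_def (a + b), powerIntegral.eq_def (1 + a - b)]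
  ring

/-! ### Continuation of the regularised integrals -/

theorem differentiableAt_powerIntegral {s : ℂ} (hs : s ≠ 1) :
    DifferentiableAt ℂ powerIntegral s :=
  (differentiable_lowIntegral s).sub
    ((differentiableAt_const 1).div (by fun_prop) (sub_ne_zero.mpr hs))

theorem differentiableOn_setIntegral_remainder :
    DifferentiableOn ℂ (fun s => ∫ z in ModularGroup.fd, remainder s z) {s | xi (2 * s) ≠ 0} :=
  differentiableOn_setIntegral_fd isOpen_xi_ne_zero zero_lt_one
    (fun _ hs => locallyBoundedBy_remainder hs 0) (fun s _ => measurable_remainder s)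
    differentiableOn_remainder

theorem differentiableOn_setIntegral_truncatedProduct {b : ℂ} (hb : b ∈ regularSet) :
    DifferentiableOn ℂ (fun a => ∫ z in ModularGroup.fd, truncatedProduct a b z) regularSet :=
  differentiableOn_setIntegral_fd isOpen_regularSet zero_lt_one
    (fun _ ha => locallyBoundedBy_truncatedProduct ha hb)
    (fun a _ => measurable_truncatedProduct a b)
    fun z => ((differentiableOn_eisensteinExpansion z).mul_const _).sub
      ((differentiableOn_constantTerm z.im_pos).mul_const _)

/-- The identity theorem on a connected open set, based at a real point beyond `N`, beyond 1 and to
the right of the excluded set `A`. -/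
theorem eqOn_zero_of_one_lt_re {F : ℂ → ℂ} {A : Set ℂ} (hA : A.Finite)
    (hF : ∀ s ∈ regularSet \ A, DifferentiableAt ℂ F s) {N : ℝ}
    (h : ∀ s : ℂ, N < s.re → F s = 0) : EqOn F 0 (regularSet \ A) := by
  have hopen : IsOpen (regularSet \ A) := isOpen_regularSet.sdiff hA.isClosed
  obtain ⟨M, hM⟩ := (hA.image Complex.re).bddAbove
  set x : ℝ := max (max N 1) M + 1 with hx
  have hx1 : N < x := by
    rw [hx]; linarith [le_max_left N 1, le_max_left (max N 1) M]
  have hx2 : 1 < x := by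
    rw [hx]; linarith [le_max_right N 1, le_max_left (max N 1) M]
  have hx3 : M < x := by
    rw [hx]; linarith [le_max_right (max N 1) M]
  refine AnalyticOnNhd.eqOn_zero_of_preconnected_of_eventuallyEq_zero (z₀ := (x : ℂ))
    (DifferentiableOn.analyticOnNhd (fun s hs => (hF s hs).differentiableWithinAt) hopen)
    (isPreconnected_regularSet_diff hA.countable) ⟨mem_regularSet_of_one_lt_re (by simpa), ?_⟩ ?_
  · intro hxA
    have := hM (mem_image_of_mem Complex.re hxA)
    simp at this
    linarith
  · filter_upwards [(isOpen_lt continuous_const Complex.continuous_re).mem_nhds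
      (show (x : ℂ) ∈ {s : ℂ | N < s.re} by simpa)] with s hs
    exact h s hs

/-- The integral of `E_s`, regularised at the cusp, vanishes. -/
theorem regularised_integral_eq_zero {s : ℂ} (hs : s ∈ regularSet) (h0 : s ≠ 0) :
    powerIntegral s + scattering s * powerIntegral (1 - s) +
      ∫ z in ModularGroup.fd, remainder s z = 0 := by
  refine eqOn_zero_of_one_lt_re (F := fun s => powerIntegral s + scattering s *
    powerIntegral (1 - s) + ∫ z in ModularGroup.fd, remainder s z) (A := {0}) (finite_singleton 0)
    (fun s hs => ?_) (fun s hs => regularised_integral_eq_zero_of_one_lt_re hs) ⟨hs, h0⟩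
  refine ((differentiableAt_powerIntegral hs.1.1).add
    ((analyticAt_scattering hs.1).differentiableAt.mul ?_)).add
    (differentiableOn_setIntegral_remainder.differentiableAt
      (isOpen_xi_ne_zero.mem_nhds hs.1.2))
  refine DifferentiableAt.comp s (differentiableAt_powerIntegral ?_) (by fun_prop)
  intro h
  exact hs.2 (mem_singleton_iff.mpr (by linear_combination -h))

/-- The integral of `E_a E_b`, regularised at the cusp, vanishes. -/
theorem regularised_product_integral_eq_zero {a b : ℂ} (ha : a ∈ regularSet) (hb : b ∈ regularSet)
    (h1 : a ≠ b) (h2 : a + b ≠ 1) :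
    productIntegral a b + ∫ z in ModularGroup.fd, truncatedProduct a b z = 0 := by
  obtain ⟨N, hN⟩ := exists_regularised_product_integral_eq_zero hb
  -- The excluded points are the poles of the `powerIntegral` factors: `1 + a - b` and `1 - a + b`
  -- equal 1 at `a = b`, while `a + b` and `2 - a - b` equal 1 at `a = 1 - b`.
  refine eqOn_zero_of_one_lt_re (F := fun a => productIntegral a b +
    ∫ z in ModularGroup.fd, truncatedProduct a b z) (A := {b, 1 - b}) (by simp)
    (fun a ha => ?_) hN ⟨ha, ?_⟩
  · have hab : a ≠ b := fun h => ha.2 (by simp [h])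
    have hab' : a + b ≠ 1 := fun h => ha.2 (by simp [← h])
    have hc := (analyticAt_scattering ha.1).differentiableAt
    refine DifferentiableAt.add ?_ ((differentiableOn_setIntegral_truncatedProduct
      hb).differentiableAt (isOpen_regularSet.mem_nhds ha.1))
    refine (((DifferentiableAt.comp a (differentiableAt_powerIntegral hab') (by fun_prop)).add
      ((differentiableAt_const _).mul
        (DifferentiableAt.comp a (differentiableAt_powerIntegral ?_) (by fun_prop)))).add
      (hc.mul (DifferentiableAt.comp a (differentiableAt_powerIntegral ?_) (by fun_prop)))).add
      ((hc.mul_const _).mul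
        (DifferentiableAt.comp a (differentiableAt_powerIntegral ?_) (by fun_prop)))
    · exact fun h => hab (by linear_combination h)
    · exact fun h => hab (by linear_combination -h)
    · exact fun h => hab' (by linear_combination -h)
  · rintro (h | h)
    · exact h1 h
    · exact h2 (by rw [mem_singleton_iff.mp h]; ring)

/-- The limiting case `a = b` of the vanishing of the regularised integral of `E_a E_b`. -/
theorem regularised_square_integral_eq_zero {b : ℂ} (hb : b ∈ regularSet) (h2 : b + b ≠ 1) :
    powerIntegral (b + b) + 2 * scattering b * lowIntegral 1 + deriv scattering b +
      scattering b ^ 2 * powerIntegral (2 - b - b) +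
      ∫ z in ModularGroup.fd, truncatedProduct b b z = 0 := by
  have hc := (analyticAt_scattering hb).differentiableAt
  have hs : Tendsto (slope scattering b) (𝓝[≠] b) (𝓝 (deriv scattering b)) :=
    hasDerivAt_iff_tendsto_slope.mp hc.hasDerivAt
  have hl : ∀ f : ℂ → ℂ, Continuous f → f b = 1 →
      Tendsto (fun a => lowIntegral (f a)) (𝓝[≠] b) (𝓝 (lowIntegral 1)) := fun f hf h => by
    rw [← h]
    exact ((differentiable_lowIntegral.continuous.comp hf).tendsto b).mono_left nhdsWithin_le_nhds
  have hp : ∀ f : ℂ → ℂ, Continuous f → f b ≠ 1 →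
      Tendsto (fun a => powerIntegral (f a)) (𝓝[≠] b) (𝓝 (powerIntegral (f b))) :=
    fun f hf h => ((differentiableAt_powerIntegral h).continuousAt.tendsto.comp
      (hf.tendsto b)).mono_left nhdsWithin_le_nhds
  have hc' := hc.continuousAt.tendsto.mono_left (nhdsWithin_le_nhds (s := {b}ᶜ))
  have hI := ((differentiableOn_setIntegral_truncatedProduct hb).differentiableAt
    (isOpen_regularSet.mem_nhds hb)).continuousAt.tendsto.mono_left
      (nhdsWithin_le_nhds (s := {b}ᶜ))
  have hlim := (((((hp (fun a => a + b) (by fun_prop) h2).add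
    ((hl (fun a => 1 + a - b) (by fun_prop) (by ring)).const_mul (scattering b))).add
    (hc'.mul (hl (fun a => 1 - a + b) (by fun_prop) (by ring)))).add hs).add
    ((hc'.mul_const (scattering b)).mul (hp (fun a => 2 - a - b) (by fun_prop)
      (fun h => h2 (by linear_combination -h))))).add hI
  -- The polar parts `-c_b / (a - b)` and `c_a / (a - b)` combine into the slope of `c` between `b`
  -- and `a`.
  have hz : ∀ᶠ a in 𝓝[≠] b, powerIntegral (a + b) + scattering b * lowIntegral (1 + a - b) +
      scattering a * lowIntegral (1 - a + b) + slope scattering b a +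
      scattering a * scattering b * powerIntegral (2 - a - b) +
      ∫ z in ModularGroup.fd, truncatedProduct a b z = 0 := by
    have hne : ∀ᶠ a in 𝓝[≠] b, a + b ≠ 1 :=
      ((continuous_id.add continuous_const).continuousAt.eventually_ne h2).filter_mono
        nhdsWithin_le_nhds
    filter_upwards [hne, self_mem_nhdsWithin,
      nhdsWithin_le_nhds (isOpen_regularSet.mem_nhds hb)] with a h1 hab ha
    have hab' : a - b ≠ 0 := sub_ne_zero.mpr hab
    rw [← regularised_product_integral_eq_zero ha hb hab h1, productIntegral,
      powerIntegral.eq_def (1 + a - b), powerIntegral.eq_def (1 - a + b), slope_def_field,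
      show 1 + a - b - 1 = a - b by ring, show 1 - a + b - 1 = -(a - b) by ring]
    field_simp
    ring
  have h := tendsto_nhds_unique hlim ((tendsto_congr' hz).mpr tendsto_const_nhds)
  rw [← h]
  ring

/-! ### The constant term of `E_s` at `s = 1` -/

/-- The product of `c_s` and `s - 1`. -/
def poleFactor (s : ℂ) : ℂ := s * xi (2 * s - 1) / xi (2 * s)

theorem scattering_eq_poleFactor_div (s : ℂ) : scattering s = poleFactor s / (s - 1) := by
  rw [scattering, poleFactor, div_div, mul_comm (xi _)]

theorem xi_two : xi 2 = Real.pi / 3 := by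
  have h := riemannZeta_def_of_ne_zero (s := 2) two_ne_zero
  have hG : Complex.Gammaℝ 2 = (Real.pi : ℂ)⁻¹ := by
    rw [Complex.Gammaℝ_def, show -(2 : ℂ) / 2 = -1 by norm_num, div_self two_ne_zero,
      Complex.Gamma_one, mul_one, Complex.cpow_neg_one]
  have hpi : (Real.pi : ℂ) ≠ 0 := by exact_mod_cast Real.pi_ne_zero
  rw [riemannZeta_two, hG, div_inv_eq_mul] at h
  rw [xi_eq (by norm_num) (by norm_num)]
  have h' : completedRiemannZeta 2 = Real.pi / 6 := by
    refine mul_right_cancel₀ hpi ?_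
    rw [← h]
    ring
  rw [h']
  ring

theorem poleFactor_one : poleFactor 1 = 3 / Real.pi := by
  have h : (2 * 1 - 1 : ℂ) = 1 := by norm_num
  rw [poleFactor, h, xi_one, mul_one, mul_one, xi_two, one_div_div]

theorem differentiableOn_poleFactor : DifferentiableOn ℂ poleFactor {s | xi (2 * s) ≠ 0} := by
  refine DifferentiableOn.div ?_ ?_ fun s hs => hs
  · exact (differentiable_id.mul (differentiable_xi.comp (by fun_prop))).differentiableOn
  · exact (differentiable_xi.comp (by fun_prop)).differentiableOn

/-- The polar part `(s - 1) c_s y ^ (1 - s)` of the constant term of `(s - 1) E_s`. -/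
def polarTerm (s : ℂ) (z : UpperHalfPlane) : ℂ := poleFactor s * (z.im : ℂ) ^ (1 - s)

theorem one_mem_xi_ne_zero : (1 : ℂ) ∈ {s : ℂ | xi (2 * s) ≠ 0} :=
  xi_ne_zero (s := 2 * 1) (by norm_num)

theorem measurable_polarTerm (s : ℂ) : Measurable (polarTerm s) :=
  (measurable_im_cpow (1 - s)).const_mul _

theorem differentiableOn_polarTerm (z : UpperHalfPlane) :
    DifferentiableOn ℂ (fun s => polarTerm s z) {s | xi (2 * s) ≠ 0} :=
  differentiableOn_poleFactor.mul
    (differentiable_ofReal_cpow z.im_pos (by fun_prop)).differentiableOn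

theorem locallyBoundedBy_polarTerm {σ : ℝ} (hσ : 0 < σ) : LocallyBoundedBy polarTerm 1 σ := by
  have h1 := LocallyBoundedBy.of_continuousAt (differentiableOn_poleFactor.differentiableAt
    (isOpen_xi_ne_zero.mem_nhds one_mem_xi_ne_zero)).continuousAt
  have h2 : LocallyBoundedBy (fun s z => (z.im : ℂ) ^ (1 - s)) 1 σ :=
    LocallyBoundedBy.cpow (e := fun s => 1 - s) (by fun_prop) (by simpa)
  have h := h1.mul h2
  rwa [zero_add] at h

/-- The derivative at `s = 1` of the polar part. -/
def polarDeriv (z : UpperHalfPlane) : ℂ := deriv (fun s => polarTerm s z) 1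

theorem measurable_polarDeriv : Measurable polarDeriv :=
  LocallyBoundedBy.measurable_deriv (isOpen_xi_ne_zero.mem_nhds one_mem_xi_ne_zero)
    (fun s _ => measurable_polarTerm s) differentiableOn_polarTerm

theorem locallyBoundedBy_polarDeriv {σ : ℝ} (hσ : 0 < σ) :
    LocallyBoundedBy (fun _ => polarDeriv) 1 σ :=
  ((locallyBoundedBy_polarTerm hσ).deriv (isOpen_xi_ne_zero.mem_nhds one_mem_xi_ne_zero)
    differentiableOn_polarTerm).const_family 1

theorem hasDerivAt_polarTerm (z : UpperHalfPlane) :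
    HasDerivAt (fun s => polarTerm s z) (polarDeriv z) 1 :=
  ((differentiableOn_polarTerm z).differentiableAt
    (isOpen_xi_ne_zero.mem_nhds one_mem_xi_ne_zero)).hasDerivAt

theorem eventually_mem_regularSet_one : ∀ᶠ s : ℂ in 𝓝[≠] 1, s ∈ regularSet := by
  filter_upwards [self_mem_nhdsWithin,
    nhdsWithin_le_nhds (isOpen_xi_ne_zero.mem_nhds one_mem_xi_ne_zero)] with s h1 h2
  exact ⟨h1, h2⟩

theorem polarTerm_one (z : UpperHalfPlane) : polarTerm 1 z = 3 / Real.pi := by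
  rw [polarTerm, poleFactor_one, sub_self, Complex.cpow_zero, mul_one]

/-- Near `s = 1` the singular term `c_s y ^ (1 - s)` is `polarTerm s z / (s - 1)`, and `polarTerm 1
z = 3 / π`. Subtracting the pole leaves a difference quotient. -/
theorem eisensteinStar_eq (z : UpperHalfPlane) :
    eisensteinStar ⟦z⟧ = z.im + polarDeriv z + remainder 1 z := by
  refine Tendsto.limUnder_eq ?_
  have h1 : Tendsto (fun s : ℂ => (z.im : ℂ) ^ s) (𝓝[≠] 1) (𝓝 ((z.im : ℂ) ^ (1 : ℂ))) :=
    ((differentiable_ofReal_cpow z.im_pos differentiable_id).continuous.tendsto 1).mono_left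
      nhdsWithin_le_nhds
  rw [Complex.cpow_one] at h1
  have h2 := hasDerivAt_iff_tendsto_slope.mp (hasDerivAt_polarTerm z)
  have h3 := ((differentiableOn_remainder z).differentiableAt
    (isOpen_xi_ne_zero.mem_nhds one_mem_xi_ne_zero)).continuousAt.tendsto.mono_left
      (nhdsWithin_le_nhds (s := {1}ᶜ))
  refine ((h1.add h2).add h3).congr' ?_
  filter_upwards [eventually_mem_regularSet_one] with s hs
  rw [eisenstein_eq hs, slope_def_field, polarTerm_one, eisensteinExpansion, constantTerm,
    polarTerm, scattering_eq_poleFactor_div]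
  ring

theorem setIntegral_polarTerm {s : ℂ} (hs : 0 < s.re) :
    ∫ z in ModularGroup.fd, polarTerm s z = poleFactor s * powerIntegral (1 - s) := by
  simp only [polarTerm]
  rw [integral_const_mul, setIntegral_fd_im_cpow (by simpa)]

/-- This is `s - 1` times the vanishing regularised integral of `E_s`. Its value and its derivative
at 1 give the integrals of `3 / π` and of `polarDeriv`. -/
theorem eventually_setIntegral_polarTerm_sub_one :
    ∀ᶠ s : ℂ in 𝓝[≠] 1, (∫ z in ModularGroup.fd, polarTerm s z) - 1 =
      (s - 1) * -(lowIntegral s + ∫ z in ModularGroup.fd, remainder s z) := by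
  have hpos : ∀ᶠ s : ℂ in 𝓝[≠] 1, 0 < s.re := nhdsWithin_le_nhds
    ((isOpen_lt continuous_const Complex.continuous_re).mem_nhds (by simp))
  filter_upwards [eventually_mem_regularSet_one, hpos] with s hs h0
  have h := regularised_integral_eq_zero hs (by rintro rfl; simp at h0)
  have h1 : s - 1 ≠ 0 := sub_ne_zero.mpr hs.1
  rw [scattering_eq_poleFactor_div, powerIntegral] at h
  rw [setIntegral_polarTerm h0]
  field_simp at h
  linear_combination h

theorem tendsto_lowIntegral_add_remainder :
    Tendsto (fun s => -(lowIntegral s + ∫ z in ModularGroup.fd, remainder s z)) (𝓝[≠] 1)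
      (𝓝 (-(lowIntegral 1 + ∫ z in ModularGroup.fd, remainder 1 z))) := by
  have h := (differentiableOn_setIntegral_remainder.differentiableAt
    (isOpen_xi_ne_zero.mem_nhds one_mem_xi_ne_zero)).continuousAt
  exact ((differentiable_lowIntegral.continuous.continuousAt.add h).neg).tendsto.mono_left
    nhdsWithin_le_nhds

theorem hasDerivAt_setIntegral_polarTerm :
    HasDerivAt (fun s => ∫ z in ModularGroup.fd, polarTerm s z)
      (∫ z in ModularGroup.fd, polarDeriv z) 1 :=
  (locallyBoundedBy_polarTerm (σ := 1 / 2) (by norm_num)).hasDerivAt_setIntegral (by norm_num)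
    (isOpen_xi_ne_zero.mem_nhds one_mem_xi_ne_zero) (fun s _ => measurable_polarTerm s)
    differentiableOn_polarTerm

theorem setIntegral_polarTerm_one : ∫ z in ModularGroup.fd, polarTerm 1 z = 1 := by
  have h1 := hasDerivAt_setIntegral_polarTerm.continuousAt.tendsto.mono_left
    (nhdsWithin_le_nhds (s := {1}ᶜ))
  have h2 : Tendsto (fun s : ℂ => s - 1) (𝓝[≠] 1) (𝓝 (1 - 1)) :=
    ((continuous_id.sub continuous_const).tendsto (1 : ℂ)).mono_left nhdsWithin_le_nhds
  have h3 := (h2.mul tendsto_lowIntegral_add_remainder).congr'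
    (eventually_setIntegral_polarTerm_sub_one.mono fun _ h => h.symm)
  have h4 := tendsto_nhds_unique (h1.sub_const 1) h3
  rw [sub_self, zero_mul] at h4
  exact sub_eq_zero.mp h4

theorem setIntegral_fd_three_div_pi :
    ∫ _ in ModularGroup.fd, (3 / Real.pi : ℂ) ∂(volume : Measure UpperHalfPlane) = 1 := by
  rw [← setIntegral_polarTerm_one]
  simp only [polarTerm_one]

theorem setIntegral_polarDeriv : ∫ z in ModularGroup.fd, polarDeriv z =
    -(lowIntegral 1 + ∫ z in ModularGroup.fd, remainder 1 z) := by
  refine tendsto_nhds_unique (hasDerivAt_iff_tendsto_slope.mp hasDerivAt_setIntegral_polarTerm)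
    (tendsto_lowIntegral_add_remainder.congr' ?_)
  filter_upwards [eventually_setIntegral_polarTerm_sub_one, self_mem_nhdsWithin] with s h hs
  rw [slope_def_field, setIntegral_polarTerm_one, h, mul_div_cancel_left₀ _ (sub_ne_zero.mpr hs)]

/-! ### Square integrability and the integrals of the pieces of `S` -/

/-- `f` is square integrable on the fundamental domain, with integral `c`. -/
def HasSquareIntegral (f : UpperHalfPlane → ℂ) (c : ℂ) : Prop :=
  MemLp f 2 ((volume : Measure UpperHalfPlane).restrict ModularGroup.fd) ∧
    ∫ z in ModularGroup.fd, f z = c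

namespace HasSquareIntegral

variable {f g : UpperHalfPlane → ℂ} {c d : ℂ}

theorem integrableOn (hf : HasSquareIntegral f c) : IntegrableOn f ModularGroup.fd :=
  hf.1.integrable one_le_two

theorem add (hf : HasSquareIntegral f c) (hg : HasSquareIntegral g d) :
    HasSquareIntegral (fun z => f z + g z) (c + d) :=
  ⟨hf.1.add hg.1, by rw [integral_add hf.integrableOn hg.integrableOn, hf.2, hg.2]⟩

theorem const_mul (hf : HasSquareIntegral f c) (k : ℂ) :
    HasSquareIntegral (fun z => k * f z) (k * c) :=
  ⟨hf.1.const_mul k, by rw [integral_const_mul, hf.2]⟩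

end HasSquareIntegral

theorem hasSquareIntegral_im_cpow {s : ℂ} (hs : s.re < 1 / 2) :
    HasSquareIntegral (fun z => (z.im : ℂ) ^ s) (powerIntegral s) := by
  obtain ⟨σ, h1, h2⟩ := exists_between hs
  exact ⟨(LocallyBoundedBy.cpow (s₀ := s) (e := fun w => w) (by fun_prop) h1).memLp_two h2
    (measurable_im_cpow s), setIntegral_fd_im_cpow (by linarith)⟩

theorem hasSquareIntegral_remainder {s : ℂ} (hs : xi (2 * s) ≠ 0) :
    HasSquareIntegral (remainder s) (∫ z in ModularGroup.fd, remainder s z) :=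
  ⟨(locallyBoundedBy_remainder hs 0).memLp_two (by norm_num) (measurable_remainder s), rfl⟩

/-- Subtracting `E_s` trades `y ^ s` for `-c_s y ^ (1 - s)` and a rapidly decaying term; by the
vanishing of the regularised integral of `E_s`, this leaves the regularised integral unchanged. -/
theorem hasSquareIntegral_im_cpow_sub {s : ℂ} (hs : 1 / 2 < s.re) (h1 : s ≠ 1) :
    HasSquareIntegral (fun z => (z.im : ℂ) ^ s - eisensteinExpansion s z) (powerIntegral s) := by
  have hr := mem_regularSet hs.le h1
  have h0 : s ≠ 0 := by
    rintro rfl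
    simp at hs
    linarith
  have h := ((hasSquareIntegral_im_cpow (s := 1 - s) (by simp; linarith)).const_mul
    (-scattering s)).add ((hasSquareIntegral_remainder hr.2).const_mul (-1))
  convert h using 1
  · funext z
    rw [eisensteinExpansion, constantTerm]
    ring
  · linear_combination regularised_integral_eq_zero hr h0

theorem hasSquareIntegral_truncatedProduct {a b : ℂ} (ha : a ∈ regularSet) (hb : b ∈ regularSet) :
    HasSquareIntegral (truncatedProduct a b) (∫ z in ModularGroup.fd, truncatedProduct a b z) :=
  ⟨(locallyBoundedBy_truncatedProduct ha hb).memLp_two (by norm_num)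
    (measurable_truncatedProduct a b), rfl⟩

/-- The analogue at `s = 1` of `hasSquareIntegral_im_cpow_sub`: the finite part `lowIntegral 1`
takes the place of `powerIntegral`. -/
theorem hasSquareIntegral_im_sub_star : HasSquareIntegral
    (fun z => z.im - (z.im + polarDeriv z + remainder 1 z)) (lowIntegral 1) := by
  have h1 : HasSquareIntegral polarDeriv (∫ z in ModularGroup.fd, polarDeriv z) :=
    ⟨(locallyBoundedBy_polarDeriv (σ := 1 / 4) (by norm_num)).memLp_two (by norm_num)
      measurable_polarDeriv, rfl⟩
  have h := (h1.const_mul (-1)).add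
    ((hasSquareIntegral_remainder one_mem_xi_ne_zero).const_mul (-1))
  convert h using 1
  · funext z
    ring
  · rw [setIntegral_polarDeriv]
    ring

theorem hasSquareIntegral_three_div_pi :
    HasSquareIntegral (fun _ => (3 / Real.pi : ℂ)) 1 :=
  ⟨memLp_const _, setIntegral_fd_three_div_pi⟩

open Classical in
/-- The contribution of `y ^ s` to `S`: the Eisenstein series `E_s` is subtracted if
`1 / 2 < Re s`. -/
def reducedPower (s : ℂ) (z : UpperHalfPlane) : ℂ :=
  if 1 / 2 < s.re then (z.im : ℂ) ^ s - eisensteinExpansion s z else (z.im : ℂ) ^ s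

theorem reducedPower_of_lt {s : ℂ} (hs : 1 / 2 < s.re) (z : UpperHalfPlane) :
    reducedPower s z = (z.im : ℂ) ^ s - eisensteinExpansion s z := if_pos hs

theorem reducedPower_of_le {s : ℂ} (hs : s.re ≤ 1 / 2) (z : UpperHalfPlane) :
    reducedPower s z = (z.im : ℂ) ^ s := if_neg (not_lt.mpr hs)

theorem hasSquareIntegral_reducedPower {s : ℂ} (hs : s.re ≠ 1 / 2) (h1 : s ≠ 1) :
    HasSquareIntegral (reducedPower s) (powerIntegral s) := by
  rcases lt_or_gt_of_ne hs with h | h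
  · rw [funext (reducedPower_of_le h.le)]
    exact hasSquareIntegral_im_cpow h
  · rw [funext (reducedPower_of_lt h)]
    exact hasSquareIntegral_im_cpow_sub h h1

theorem constantTerm_mul (a b : ℂ) {y : ℝ} (hy : 0 < y) :
    constantTerm a y * constantTerm b y = (y : ℂ) ^ (a + b) +
      scattering b * (y : ℂ) ^ (1 + a - b) + scattering a * (y : ℂ) ^ (1 - a + b) +
      scattering a * scattering b * (y : ℂ) ^ (2 - a - b) := by
  have h1 := mul_constantTerm a b hy
  have h2 := mul_constantTerm (1 - a) b hy
  rw [show 1 + (1 - a) - b = 2 - a - b by ring] at h2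
  rw [constantTerm.eq_def a]
  linear_combination h1 + scattering a * h2

/-- Admissibility keeps the four exponents off the line `Re = 1 / 2`, and `a ≠ b`, `a + b ≠ 1` keep
them away from 1. The integrals of the pieces then add up to the regularised integral of `E_a E_b`.
-/
theorem hasSquareIntegral_of_ne {a b : ℂ} (hab : (a, b) ∈ admissible) (hpole : a + b ≠ 1)
    (hne : a ≠ b) : HasSquareIntegral (fun z => truncatedProduct a b z +
      (reducedPower (a + b) z + scattering b * reducedPower (1 + a - b) z +
        scattering a * reducedPower (1 - a + b) z +
        scattering a * scattering b * reducedPower (2 - a - b) z)) 0 := by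
  obtain ⟨ha1, hb1, ha, hb, h1, h2, h3⟩ := hab
  simp only [Complex.add_re] at ha1 hb1 ha hb h1 h2 h3
  have hra := mem_regularSet ha ha1
  have hrb := mem_regularSet hb hb1
  have e1 := hasSquareIntegral_reducedPower (s := a + b) (by simp; intro h; linarith) hpole
  have e2 := hasSquareIntegral_reducedPower (s := 1 + a - b)
    (by simp; intro h; exact h2 (by linarith)) (fun h => hne (by linear_combination h))
  have e3 := hasSquareIntegral_reducedPower (s := 1 - a + b)
    (by simp; intro h; exact h3 (by linarith)) (fun h => hne (by linear_combination -h))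
  have e4 := hasSquareIntegral_reducedPower (s := 2 - a - b)
    (by simp; intro h; exact h1 (by linarith)) (fun h => hpole (by linear_combination -h))
  have h := (hasSquareIntegral_truncatedProduct hra hrb).add
    (((e1.add (e2.const_mul (scattering b))).add (e3.const_mul (scattering a))).add
      (e4.const_mul (scattering a * scattering b)))
  convert h using 1
  rw [add_comm]
  exact (regularised_product_integral_eq_zero hra hrb hne hpole).symm

theorem hasSquareIntegral_of_eq {a : ℂ} (hab : (a, a) ∈ admissible) (hpole : a + a ≠ 1) :
    HasSquareIntegral (fun z => truncatedProduct a a z +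
      (reducedPower (a + a) z + 2 * scattering a * (z.im - (z.im + polarDeriv z + remainder 1 z)) +
        scattering a ^ 2 * reducedPower (2 - a - a) z + deriv scattering a * (3 / Real.pi))) 0 := by
  obtain ⟨ha1, -, ha, -, h1, -, -⟩ := hab
  simp only [Complex.add_re] at ha1 ha h1
  have hra := mem_regularSet ha ha1
  have e1 := hasSquareIntegral_reducedPower (s := a + a) (by simp; intro h; linarith) hpole
  have e4 := hasSquareIntegral_reducedPower (s := 2 - a - a)
    (by simp; intro h; exact h1 (by linarith)) (fun h => hpole (by linear_combination -h))
  have h := (hasSquareIntegral_truncatedProduct hra hra).add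
    (((e1.add (hasSquareIntegral_im_sub_star.const_mul (2 * scattering a))).add
      (e4.const_mul (scattering a ^ 2))).add
        (hasSquareIntegral_three_div_pi.const_mul (deriv scattering a)))
  convert h using 1
  rw [← regularised_square_integral_eq_zero hra hpole]
  ring

/-! ### The functions `S` -/

/-- The case distinction in `correction` amounts to asking which exponents have real part above `1 /
2`. The exponent `a + b` always does, having real part at least 1. -/
theorem S_mk_of_ne {a b : ℂ} (hab : (a, b) ∈ admissible) (hpole : a + b ≠ 1) (hne : a ≠ b)
    (z : UpperHalfPlane) : S a b ⟦z⟧ = truncatedProduct a b z +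
      (reducedPower (a + b) z + scattering b * reducedPower (1 + a - b) z +
        scattering a * reducedPower (1 - a + b) z +
        scattering a * scattering b * reducedPower (2 - a - b) z) := by
  obtain ⟨ha1, hb1, ha, hb, h1, h2, h3⟩ := hab
  simp only [Complex.add_re] at ha1 hb1 ha hb h1 h2 h3
  have hra := mem_regularSet ha ha1
  have hrb := mem_regularSet hb hb1
  have n2 : 1 + a - b ≠ 1 := fun h => hne (by linear_combination h)
  have n3 : 1 - a + b ≠ 1 := fun h => hne (by linear_combination -h)
  have n4 : 2 - a - b ≠ 1 := fun h => hpole (by linear_combination -h)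
  have r1 : 1 / 2 < (a + b).re := by simp; linarith
  have hc := constantTerm_mul a b z.im_pos
  rw [S, correction, if_neg hne, eisenstein_eq hra, eisenstein_eq hrb,
    eisenstein_eq (mem_regularSet r1.le hpole), scatteringCoeff_eq hra, scatteringCoeff_eq hrb,
    reducedPower_of_lt r1, truncatedProduct, hc]
  -- Here `Re b > 1`, hence `Re (a + b) > 3 / 2`: both `1 + a - b` and `2 - a - b` lie to the left,
  -- and only `1 - a + b` needs a subtraction.
  by_cases c1 : a.re + 1 / 2 < b.re
  · have r3 : 1 / 2 < (1 - a + b).re := by simp; linarith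
    rw [if_pos c1, eisenstein_eq (mem_regularSet r3.le n3), reducedPower_of_lt r3,
      reducedPower_of_le (by simp; linarith), reducedPower_of_le (by simp; linarith)]
    ring
  rw [if_neg c1]
  by_cases c2 : b.re + 1 / 2 < a.re
  · have r2 : 1 / 2 < (1 + a - b).re := by simp; linarith
    rw [if_pos c2, show 1 - b + a = 1 + a - b by ring, eisenstein_eq (mem_regularSet r2.le n2),
      reducedPower_of_lt r2, reducedPower_of_le (s := 1 - a + b) (by simp; linarith),
      reducedPower_of_le (by simp; linarith)]
    ring
  have r2 : 1 / 2 < (1 + a - b).re := by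
    rcases lt_or_gt_of_ne h2 with h | h
    · simp; linarith
    · exact absurd (by linarith) c1
  have r3 : 1 / 2 < (1 - a + b).re := by
    rcases lt_or_gt_of_ne h3 with h | h
    · exact absurd (by linarith) c2
    · simp; linarith
  rw [if_neg c2, eisenstein_eq (mem_regularSet r2.le n2), eisenstein_eq (mem_regularSet r3.le n3),
    reducedPower_of_lt r2, reducedPower_of_lt r3]
  rcases lt_or_gt_of_ne h1 with h | h
  · have r4 : 1 / 2 < (2 - a - b).re := by simp; linarith
    rw [if_neg (by simp; linarith), eisenstein_eq (mem_regularSet r4.le n4), reducedPower_of_lt r4]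
    ring
  · rw [if_pos (by simp; linarith), reducedPower_of_le (by simp; linarith)]
    ring

/-- The two middle exponents merge into `2 c_a y`, from which `E_1^*` is subtracted because `E_s`
has a pole at 1. -/
theorem S_mk_of_eq {a : ℂ} (hab : (a, a) ∈ admissible) (hpole : a + a ≠ 1) (z : UpperHalfPlane) :
    S a a ⟦z⟧ = truncatedProduct a a z +
      (reducedPower (a + a) z + 2 * scattering a * (z.im - (z.im + polarDeriv z + remainder 1 z)) +
        scattering a ^ 2 * reducedPower (2 - a - a) z + deriv scattering a * (3 / Real.pi)) := by
  obtain ⟨ha1, -, ha, -, h1, -, -⟩ := hab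
  simp only [Complex.add_re] at ha1 ha h1
  have hra := mem_regularSet ha ha1
  have n4 : 2 - a - a ≠ 1 := fun h => hpole (by linear_combination -h)
  have r1 : 1 / 2 < (a + a).re := by simp; linarith
  have hc := constantTerm_mul a a z.im_pos
  rw [show 1 + a - a = 1 by ring, show 1 - a + a = 1 by ring, Complex.cpow_one] at hc
  rw [S, correction, if_pos rfl, two_mul a, show 2 - (a + a) = 2 - a - a by ring,
    eisenstein_eq hra, eisensteinStar_eq, eisenstein_eq (mem_regularSet r1.le hpole),
    scatteringCoeff_eq hra, deriv_scatteringCoeff_eq hra, reducedPower_of_lt r1,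
    truncatedProduct, hc]
  rcases lt_or_gt_of_ne h1 with h | h
  · have r4 : 1 / 2 < (2 - a - a).re := by simp; linarith
    rw [if_neg (by linarith), eisenstein_eq (mem_regularSet r4.le n4), reducedPower_of_lt r4]
    ring
  · rw [if_pos (by linarith), reducedPower_of_le (by simp; linarith)]
    ring

theorem measurable_reducedPower (s : ℂ) : Measurable (reducedPower s) := by
  by_cases h : 1 / 2 < s.re
  · rw [funext (reducedPower_of_lt h)]
    exact (measurable_im_cpow s).sub (measurable_eisensteinExpansion s)
  · rw [funext (reducedPower_of_le (not_lt.mp h))]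
    exact measurable_im_cpow s

theorem measurable_S {a b : ℂ} (hab : (a, b) ∈ admissible) (hpole : a + b ≠ 1) :
    Measurable (S a b) := by
  rw [measurable_from_quotient]
  by_cases hne : a = b
  · subst hne
    have e : S a a ∘ Quotient.mk'' = _ := funext fun z => S_mk_of_eq hab hpole z
    rw [e]
    have h1 : Measurable fun z : UpperHalfPlane => (z.im : ℂ) :=
      Complex.measurable_ofReal.comp measurable_im
    exact (measurable_truncatedProduct a a).add ((((measurable_reducedPower _).add
      ((h1.sub ((h1.add measurable_polarDeriv).add (measurable_remainder 1))).const_mul _)).add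
      ((measurable_reducedPower _).const_mul _)).add measurable_const)
  · have e : S a b ∘ Quotient.mk'' = _ := funext fun z => S_mk_of_ne hab hpole hne z
    rw [e]
    exact (measurable_truncatedProduct a b).add ((((measurable_reducedPower _).add
      ((measurable_reducedPower _).const_mul _)).add ((measurable_reducedPower _).const_mul _)).add
      ((measurable_reducedPower _).const_mul _))

theorem hasSquareIntegral_S {a b : ℂ} (hab : (a, b) ∈ admissible) (hpole : a + b ≠ 1) :
    HasSquareIntegral (fun z => S a b ⟦z⟧) 0 := by
  by_cases hne : a = b
  · subst hne
    rw [funext (S_mk_of_eq hab hpole)]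
    exact hasSquareIntegral_of_eq hab hpole
  · rw [funext (S_mk_of_ne hab hpole hne)]
    exact hasSquareIntegral_of_ne hab hpole hne

end ResidualSpectrum

end

/-! ### Transfer from the fundamental domain to the modular surface -/

theorem mainTheorem8 (α β : ℂ) (hαβ : (α, β) ∈ ResidualSpectrum.admissible)
    (hpole : α + β ≠ 1) :
    MeasureTheory.MemLp (ResidualSpectrum.S α β) 2 ResidualSpectrum.surfaceMeasure ∧
      ResidualSpectrum.pairing (ResidualSpectrum.S α β) 1 = 0 := by
  have hm := ResidualSpectrum.measurable_S hαβ hpole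
  have hmk : Measurable fun z : UpperHalfPlane => (⟦z⟧ : ResidualSpectrum.ModularSurface) :=
    measurable_quotient_mk''
  obtain ⟨h1, h2⟩ := ResidualSpectrum.hasSquareIntegral_S hαβ hpole
  refine ⟨(MeasureTheory.memLp_map_measure_iff hm.aestronglyMeasurable hmk.aemeasurable).mpr h1, ?_⟩
  rw [ResidualSpectrum.pairing, ← h2, ResidualSpectrum.surfaceMeasure]
  simp only [Pi.one_apply, map_one, mul_one]
  exact MeasureTheory.integral_map hmk.aemeasurable hm.aestronglyMeasurable
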